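/- Let $n\ge 1$, let $\Omega\subset\mathbb{R}^n$ be a bounded Lipschitz domain (bounded, open, with boundary locally the graph of a Lipschitz function, $\Omega$ lying on one side of it; connectedness is not needed). *Weak $N$-functions.* A function $M:\Omega\times\mathbb{R}^d\to[0,\infty)$ is a weak $N$-function if it is measurable in $x$ and continuous in $\xi$; for a.e. $x$, $M(x,0)=0$, $M(x,\cdot)$ is convex and $M(x,\xi)=M(x,-\xi)$ for all $\xi$; and there are convex $m_1,m_2:[0,\infty)\to[0,\infty)$ with $m_1(0)=0$, $m_1(s)>0$ for $s>0$, such that $m_1(|\xi|)\le M(x,\xi)\le m_2(|\xi|)$ for a.e. $x$ and all $\xi$. We write $M\in\Delta_2$ if there are $c,C>0$ and an integrable $h:\Omega\to[0,\infty)$ with $M(x,2\xi)\le cM(x,\xi)+h(x)$ for a.e. $x\in\Omega$ and all $|\xi|>C$. For a ball $B$ meeting $\Omega$ put $$M_B^-(\xi)=\operatorname*{ess\,inf}_{y\in B\cap\Omega}M(y,\xi),\qquad M_B^+(\xi)=\operatorname*{ess\,sup}_{y\in B\cap\Omega}M(y,\xi).$$ *Function spaces.* $L_M(\Omega;\mathbb{R}^n)$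 is the set of measurable $\xi:\Omega\to\mathbb{R}^n$ with $\int_\Omega M(x,\xi(x)/\lambda)\,dx<\infty$ for some $\lambda>0$. With $\nabla$ the distributional gradient, $V^1L_M(\Omega)=\{u\in W^{1,1}(\Omega):\nabla u\in L_M(\Omega;\mathbb{R}^n)\}$ and $V^1_0L_M(\Omega)=\{u\in W^{1,1}_0(\Omega):\nabla u\in L_M(\Omega;\mathbb{R}^n)\}$, where $W^{1,1}_0(\Omega)$ is the closure of $C_c^\infty(\Omega)$ in $W^{1,1}(\Omega)$. For $\gamma\in(0,1]$, $C^{0,\gamma}(\Omega)$ is the set of $u:\Omega\to\mathbb{R}$ with $\sup_{x\ne y}|u(x)-u(y)|/|x-y|^\gamma<\infty$. *Condition $(\mathsf{B}^{\mathsf{gen}}_\gamma)$, $\gamma\in[0,1]$.* There are an integer $N\ge1$, linear maps $\xi\mapsto\xi_j$ from $\mathbb{R}^n$ to $\mathbb{R}^{\ell_j}$, $j=1,\dots,N$, which jointly determine $\xi$ (for instance the blocks of a partition of the coordinates, or $N=1$ and $\xi_1=\xi$), and weak $N$-functions $M_j:\Omega\times\mathbb{R}^{\ell_j}\to[0,\infty)$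 such that $M(x,\xi)=\sum_{j=1}^N M_j(x,\xi_j)$ for all $x\in\Omega$, $\xi\in\mathbb{R}^n$; and there are constants $c^\Diamond,C^\Diamond>1$ such that for every ball $B$ of radius $r\in(0,1]$ meeting $\Omega$, every $j$ and every $\zeta\in\mathbb{R}^{\ell_j}$, $$(M_j)_B^-(C^\Diamond\zeta)\le\sup_{|\eta|=1}(M_j)_B^-\big(c^\Diamond r^{\gamma-1}\eta\big)\ \Longrightarrow\ (M_j)_B^+(\zeta)\le(M_j)_B^-(C^\Diamond\zeta)+1.$$ **Theorem.** Let $M:\Omega\times\mathbb{R}^n\to[0,\infty)$ be a weak $N$-function that is continuous in both variables jointly and satisfies $M\in\Delta_2$. Let $F:\Omega\times\mathbb{R}\times\mathbb{R}^n\to\mathbb{R}$ be measurable in the first variable, continuous in the last two variables jointly, and suppose that for some constants $0<\nu,\beta<1<L$ $$\nu M(x,\beta\xi)\le F(x,z,\xi)\le L\,(M(x,\xi)+1)\qquad\text{for all }x\in\Omega,\ z\in\mathbb{R},\ \xi\in\mathbb{R}^n.$$ Put $\mathcal{F}[u]=\int_\Omega F(x,u,\nabla u)\,dx$. Then: (i)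 If $M$ satisfies $(\mathsf{B}^{\mathsf{gen}}_0)$ and $u_0\in V^1L_M(\Omega)$, then $$\inf_{u_0+V^1_0L_M(\Omega)}\mathcal{F}=\inf_{u_0+C_c^\infty(\Omega)}\mathcal{F}.$$ (ii) If $\gamma\in(0,1]$, $M$ satisfies $(\mathsf{B}^{\mathsf{gen}}_\gamma)$ and $u_0\in V^1L_M(\Omega)\cap C^{0,\gamma}(\Omega)$, then $$\inf_{u_0+(V^1_0L_M(\Omega)\cap C^{0,\gamma}(\Omega))}\mathcal{F}=\inf_{u_0+C_c^\infty(\Omega)}\mathcal{F}.$$ -/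

import Mathlib

open MeasureTheory Set Filter Topology
open scoped ENNReal ContDiff

noncomputable section

/-- `ℝⁿ` with the Euclidean norm. -/
abbrev RSpace (n : ℕ) : Type := EuclideanSpace ℝ (Fin n)

/-- Bounded open set with Lipschitz boundary: near every boundary point, and for a suitable unit
vector `e`, the set is the strict epigraph in direction `e` of a Lipschitz function `g` of the
component orthogonal to `e`. -/
structure IsBoundedLipschitzDomain {n : ℕ} (Ω : Set (RSpace n)) : Prop where
  isOpen : IsOpen Ω
  isBounded : Bornology.IsBounded Ω
  exists_graph : ∀ p ∈ frontier Ω, ∃ e : RSpace n, ‖e‖ = 1 ∧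
    ∃ (K : NNReal) (g : RSpace n → ℝ), LipschitzWith K g ∧ ∃ U ∈ 𝓝 p, ∀ x ∈ U,
      (x ∈ Ω ↔ g (x - inner ℝ e x • e) < inner ℝ e x)

/-- The class `C_c^∞(Ω)`. -/
def TestFunctions {n : ℕ} (Ω : Set (RSpace n)) : Set (RSpace n → ℝ) :=
  {φ | ContDiff ℝ ∞ φ ∧ HasCompactSupport φ ∧ tsupport φ ⊆ Ω}

/-- `G` is a distributional gradient of `u` on `Ω`. -/
def IsWeakGradient {n : ℕ} (Ω : Set (RSpace n)) (u : RSpace n → ℝ) (G : RSpace n → RSpace n) :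
    Prop :=
  LocallyIntegrableOn u Ω ∧ LocallyIntegrableOn G Ω ∧
    ∀ φ ∈ TestFunctions Ω, ∫ x in Ω, u x • gradient φ x = - ∫ x in Ω, φ x • G x

open Classical in
/-- The distributional gradient of `u` on `Ω` (unique almost everywhere in an open `Ω`), set to be
`0` if `u` has none. -/
def weakGradient {n : ℕ} (Ω : Set (RSpace n)) (u : RSpace n → ℝ) : RSpace n → RSpace n :=
  if h : ∃ G, IsWeakGradient Ω u G then h.choose else 0

/-- The Sobolev space `W^{1,1}(Ω)`. -/
def W11 {n : ℕ} (Ω : Set (RSpace n)) : Set (RSpace n → ℝ) :=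
  {u | IntegrableOn u Ω ∧ (∃ G, IsWeakGradient Ω u G) ∧ IntegrableOn (weakGradient Ω u) Ω}

/-- `W^{1,1}_0(Ω)`, the closure of `C_c^∞(Ω)` in `W^{1,1}(Ω)`. -/
def W110 {n : ℕ} (Ω : Set (RSpace n)) : Set (RSpace n → ℝ) :=
  {u | u ∈ W11 Ω ∧ ∃ φ : ℕ → RSpace n → ℝ, (∀ k, φ k ∈ TestFunctions Ω) ∧
    Tendsto (fun k => eLpNorm (fun x => u x - φ k x) 1 (volume.restrict Ω)) atTop (𝓝 0) ∧
    Tendsto (fun k => eLpNorm (fun x => weakGradient Ω u x - gradient (φ k) x) 1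
      (volume.restrict Ω)) atTop (𝓝 0)}

/-- Weak `N`-functions `M : Ω × ℝᵈ → [0, ∞)`, where `Ω ⊆ ℝⁿ`. Values of `M` at points outside `Ω`
are irrelevant. -/
structure IsWeakNFunction {n d : ℕ} (Ω : Set (RSpace n)) (M : RSpace n → RSpace d → ℝ) :
    Prop where
  nonneg : ∀ x ∈ Ω, ∀ ξ, 0 ≤ M x ξ
  measurable_left : ∀ ξ, AEMeasurable (fun x => M x ξ) (volume.restrict Ω)
  continuous_right : ∀ᵐ x ∂volume.restrict Ω, Continuous (M x)
  map_zero : ∀ᵐ x ∂volume.restrict Ω, M x 0 = 0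
  convex : ∀ᵐ x ∂volume.restrict Ω, ConvexOn ℝ univ (M x)
  even : ∀ᵐ x ∂volume.restrict Ω, ∀ ξ, M x ξ = M x (-ξ)
  bounds : ∃ m₁ m₂ : ℝ → ℝ, ConvexOn ℝ (Ici 0) m₁ ∧ ConvexOn ℝ (Ici 0) m₂ ∧
    (∀ s, 0 ≤ s → 0 ≤ m₁ s) ∧ (∀ s, 0 ≤ s → 0 ≤ m₂ s) ∧
    m₁ 0 = 0 ∧ (∀ s, 0 < s → 0 < m₁ s) ∧
    ∀ᵐ x ∂volume.restrict Ω, ∀ ξ, m₁ ‖ξ‖ ≤ M x ξ ∧ M x ξ ≤ m₂ ‖ξ‖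

/-- The `Δ₂` condition close to infinity. -/
def DeltaTwo {n d : ℕ} (Ω : Set (RSpace n)) (M : RSpace n → RSpace d → ℝ) : Prop :=
  ∃ (c C : ℝ) (h : RSpace n → ℝ), 0 < c ∧ 0 < C ∧ (∀ x ∈ Ω, 0 ≤ h x) ∧ IntegrableOn h Ω ∧
    ∀ᵐ x ∂volume.restrict Ω, ∀ ξ, C < ‖ξ‖ → M x ((2 : ℝ) • ξ) ≤ c * M x ξ + h x

/-- The Musielak--Orlicz space `L_M(Ω; ℝᵈ)`: measurable fields some positive multiple of which has
finite modular. -/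
def LM {n d : ℕ} (Ω : Set (RSpace n)) (M : RSpace n → RSpace d → ℝ) :
    Set (RSpace n → RSpace d) :=
  {ξ | AEStronglyMeasurable ξ (volume.restrict Ω) ∧
    ∃ l : ℝ, 0 < l ∧ ∫⁻ x in Ω, ENNReal.ofReal (M x (l⁻¹ • ξ x)) < ⊤}

/-- `V¹L_M(Ω)`. -/
def V1LM {n : ℕ} (Ω : Set (RSpace n)) (M : RSpace n → RSpace n → ℝ) : Set (RSpace n → ℝ) :=
  {u | u ∈ W11 Ω ∧ weakGradient Ω u ∈ LM Ω M}

/-- `V¹₀L_M(Ω)`. -/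
def V10LM {n : ℕ} (Ω : Set (RSpace n)) (M : RSpace n → RSpace n → ℝ) : Set (RSpace n → ℝ) :=
  {u | u ∈ W110 Ω ∧ weakGradient Ω u ∈ LM Ω M}

/-- The Hölder class `C^{0,γ}(Ω)`. -/
def HolderClass {n : ℕ} (Ω : Set (RSpace n)) (γ : ℝ) : Set (RSpace n → ℝ) :=
  {u | ∃ C : NNReal, HolderOnWith C γ.toNNReal u Ω}

/-- `M_B^-(ξ)`, the essential infimum of `M(·, ξ)` over the part of `B` that lies in `Ω`. -/
def lowerEnv {n d : ℕ} (Ω : Set (RSpace n)) (M : RSpace n → RSpace d → ℝ) (B : Set (RSpace n))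
    (ξ : RSpace d) : ℝ :=
  essInf (fun y => M y ξ) (volume.restrict (B ∩ Ω))

/-- `M_B^+(ξ)`, the essential supremum of `M(·, ξ)` over the part of `B` that lies in `Ω`. -/
def upperEnv {n d : ℕ} (Ω : Set (RSpace n)) (M : RSpace n → RSpace d → ℝ) (B : Set (RSpace n))
    (ξ : RSpace d) : ℝ :=
  essSup (fun y => M y ξ) (volume.restrict (B ∩ Ω))

/-- The general balance condition with parameter `γ`. The blocks of variables are `ξⱼ = Pⱼ ξ` with
linear `Pⱼ : ℝⁿ → ℝ^{ℓⱼ}` that jointly determine `ξ` (in particular, they may be the coordinate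
projections belonging to a partition of the coordinates, or a single identity map). -/
def BalanceGen {n : ℕ} (Ω : Set (RSpace n)) (γ : ℝ) (M : RSpace n → RSpace n → ℝ) : Prop :=
  ∃ (N : ℕ) (ℓ : Fin N → ℕ) (P : ∀ j, RSpace n →L[ℝ] RSpace (ℓ j))
    (Mj : ∀ j, RSpace n → RSpace (ℓ j) → ℝ),
    0 < N ∧ (∀ ξ, (∀ j, P j ξ = 0) → ξ = 0) ∧
    (∀ j, IsWeakNFunction Ω (Mj j)) ∧
    (∀ x ∈ Ω, ∀ ξ, M x ξ = ∑ j, Mj j x (P j ξ)) ∧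
    ∃ c C : ℝ, 1 < c ∧ 1 < C ∧
      ∀ (a : RSpace n) (r : ℝ), 0 < r → r ≤ 1 → (Metric.ball a r ∩ Ω).Nonempty →
        ∀ (j : Fin N) (ξ : RSpace (ℓ j)),
          lowerEnv Ω (Mj j) (Metric.ball a r) (C • ξ) ≤
            (⨆ η : Metric.sphere (0 : RSpace (ℓ j)) 1,
              lowerEnv Ω (Mj j) (Metric.ball a r) ((c * r ^ (γ - 1)) • (η : RSpace (ℓ j)))) →
          upperEnv Ω (Mj j) (Metric.ball a r) ξ ≤
            lowerEnv Ω (Mj j) (Metric.ball a r) (C • ξ) + 1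

/-- The functional `u ↦ ∫_Ω F(x, u, ∇u) dx` for a nonnegative integrand `F`, with values in
`[0, ∞]`. -/
def energy {n : ℕ} (Ω : Set (RSpace n)) (F : RSpace n → ℝ → RSpace n → ℝ) (u : RSpace n → ℝ) :
    ℝ≥0∞ :=
  ∫⁻ x in Ω, ENNReal.ofReal (F x (u x) (weakGradient Ω u x))

end

/-! Test functions are admissible competitors, so one inequality is immediate. For the other, each
admissible `v` is approximated by test functions `ψ` with `ψ → v` in `L¹` and `∫ M(x, l(∇ψ - ∇v)) →
0` (`IsApprox`). Along a subsequence both `ψ` and `∇ψ` converge almost everywhere; the upper bound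
on `F` and `Δ₂` provide a majorant that converges in `L¹`, so the energies converge
(`IsApprox.iInf_energy_le`).

The approximants are mollifications, and the point is to bound `M(x, ·)` at the average `κ_δ * ∇v
(x)`. The lower envelope `M_B^-` need not be convex, so Jensen's inequality does not apply to it.
But `G = M(x, ·/C) - 1` is convex, and by the balance condition it lies below `M_B^-` on a sublevel
set of `M_B^-`. Affine minorants of `G`, with large values of `∇v` scaled back into that sublevel
set, yield a Jensen inequality at the price of halving the argument
(`ConvexOn.apply_half_integral_le`). The average itself must lie in the sublevel set; this follows
from `|∇(κ_δ * v)| ≤ A δ^(γ-1) ∫ |∇κ|`, valid when `v` oscillates by at most `A δ^γ` at scale `δ`,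
that is, for bounded `v` if `γ = 0` and for Hölder `v` if `γ > 0`. The outcome is `M(x, s∇v_δ) ≤ N +
κ_δ * m` with `m` integrable, and `κ_δ * m → m` in `L¹` permits dominated convergence
(`isApprox_of_mollify`).

It remains to reduce to functions whose mollifications are supported in `Ω`. For `γ = 0`, truncate
at `±k`, localize by a partition of unity and mollify each piece with a kernel centred at a vector
that points into the domain (`isApprox_of_bounded`). For `γ > 0`, subtract from `v` its truncation
at `±ε`: the remainder keeps the Hölder bound and lives on `{|v| ≥ ε}`, which is compact in `Ω`
because `v` vanishes at the boundary (`IsTestLimit.isApprox_of_holder`). -/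

/-! ### Measure-theoretic tools and a Jensen inequality on a sublevel set -/

/-- Dominated convergence to zero with a majorant that is only asymptotically integrable. -/
theorem tendsto_lintegral_zero_of_le_add {α : Type*} [MeasurableSpace α] {μ : Measure α}
    {f e : ℕ → α → ℝ≥0∞} {H : α → ℝ≥0∞} (hf : ∀ k, AEMeasurable (f k) μ)
    (hH : AEMeasurable H μ) (hHfin : ∫⁻ x, H x ∂μ ≠ ⊤)
    (he : Tendsto (fun k => ∫⁻ x, e k x ∂μ) atTop (𝓝 0))
    (hle : ∀ k, ∀ᵐ x ∂μ, f k x ≤ H x + e k x)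
    (hlim : ∀ᵐ x ∂μ, Tendsto (fun k => f k x) atTop (𝓝 0)) :
    Tendsto (fun k => ∫⁻ x, f k x ∂μ) atTop (𝓝 0) := by
  -- The part of `f k` below `H` is handled by ordinary dominated convergence; the excess is at most
  -- `e k`.
  have h1 : Tendsto (fun k => ∫⁻ x, min (f k x) (H x) ∂μ) atTop (𝓝 0) := by
    have := tendsto_lintegral_of_dominated_convergence' (μ := μ)
      (F := fun k x => min (f k x) (H x)) (f := fun _ => 0) H
      (fun k => (hf k).min hH) (fun k => ae_of_all _ fun x => min_le_right _ _) hHfin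
      (by
        filter_upwards [hlim] with x hx
        exact tendsto_of_tendsto_of_tendsto_of_le_of_le tendsto_const_nhds hx
          (fun _ => zero_le) (fun _ => min_le_left _ _))
    simpa using this
  have h2 := h1.add he
  rw [add_zero] at h2
  refine tendsto_of_tendsto_of_tendsto_of_le_of_le tendsto_const_nhds h2
    (fun _ => zero_le) (fun k => ?_)
  change _ ≤ ∫⁻ x, min (f k x) (H x) ∂μ + ∫⁻ x, e k x ∂μ
  rw [← lintegral_add_left' ((hf k).min hH)]
  refine lintegral_mono_ae ?_
  filter_upwards [hle k] with x hx
  rcases le_total (f k x) (H x) with h | h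
  · simp [min_eq_left h]
  · simpa [min_eq_right h] using hx

/-- Superposition of a Carathéodory function with a measurable function. -/
theorem aemeasurable_caratheodory {α E : Type*} [MeasurableSpace α] {μ : Measure α}
    [TopologicalSpace E] [TopologicalSpace.MetrizableSpace E]
    {f : α → E → ℝ} (hmeas : ∀ ξ, AEMeasurable (fun x => f x ξ) μ)
    (hcont : ∀ᵐ x ∂μ, Continuous (f x)) {W : α → E} (hW : AEStronglyMeasurable W μ) :
    AEMeasurable (fun x => f x (W x)) μ := by
  classical
  obtain ⟨V, hV, hWV⟩ := hW
  have h1 : ∀ n, AEMeasurable (fun x => f x (hV.approx n x)) μ := by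
    intro n
    set s := hV.approx n
    have : (fun x => f x (s x)) =
        fun x => ∑ v ∈ s.range, (s ⁻¹' {v}).indicator (fun x => f x v) x := by
      ext x
      rw [Finset.sum_eq_single (s x)]
      · simp
      · intro b _ hb
        exact indicator_of_notMem (fun h => hb (by simpa using h.symm)) _
      · intro h
        exact absurd (s.mem_range_self x) h
    rw [this]
    exact Finset.aemeasurable_fun_sum _ fun v _ =>
      (hmeas v).indicator (s.measurableSet_preimage _)
  refine aemeasurable_of_tendsto_metrizable_ae atTop h1 ?_
  filter_upwards [hcont, hWV] with x hx hxV
  rw [hxV]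
  exact (hx.tendsto _).comp (hV.tendsto_approx x)

/-- A Jensen-type inequality for a convex function that is dominated by a function `f`
only on a sublevel set of `f`. -/
theorem ConvexOn.apply_half_integral_le {α E : Type*} [MeasurableSpace α] {μ : Measure α}
    [NormedAddCommGroup E] [NormedSpace ℝ E] [CompleteSpace E]
    {G : E → ℝ} (hG : ConvexOn ℝ univ G) (hGc : Continuous G) (hG0 : G 0 ≤ 0)
    {f : E → ℝ} {K : ℝ} (hK : 0 < K) (hfG : ∀ v, f v ≤ K → G v ≤ f v)
    {w m : α → ℝ} {W : α → E} (hw : ∀ y, 0 ≤ w y) (hwi : Integrable w μ)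
    (hw1 : ∫ y, w y ∂μ = 1)
    (hm : Integrable (fun y => w y * m y) μ) (hW : Integrable (fun y => w y • W y) μ)
    (hm0 : ∀ y, 0 ≤ m y)
    (hfm : ∀ᵐ y ∂μ, w y ≠ 0 → ∀ s : ℝ, 0 < s → s ≤ 1 → f (s • W y) ≤ s * m y)
    (hWK : f (∫ y, w y • W y ∂μ) ≤ K) :
    G ((2⁻¹ : ℝ) • ∫ y, w y • W y ∂μ) ≤ ∫ y, w y * m y ∂μ := by
  set v := ∫ y, w y • W y ∂μ with hv
  set I := ∫ y, w y * m y ∂μ with hI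
  have hI0 : 0 ≤ I := integral_nonneg fun y => mul_nonneg (hw y) (hm0 y)
  rcases lt_or_ge K I with hKI | hKI
  -- When the averaged majorant exceeds the threshold, convexity and `G 0 ≤ 0` suffice: `G (v/2) ≤ G
  -- v / 2 ≤ K / 2`.
  · have h1 : G v ≤ K := (hfG v hWK).trans hWK
    have h2 := hG.2 (mem_univ v) (mem_univ (0 : E)) (by norm_num : (0 : ℝ) ≤ 2⁻¹)
      (by norm_num : (0 : ℝ) ≤ 2⁻¹) (by norm_num)
    simp only [smul_zero, add_zero, smul_eq_mul] at h2
    linarith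
  · refine le_of_forall_lt fun a ha => ?_
    obtain ⟨a', haa', ha'⟩ := exists_between ha
    -- An affine minorant `p + b` of `G` whose value at `v/2` exceeds `a`. Since `G 0 ≤ 0`, `b ≤ 0`,
    -- so further multiples of `b` only weaken an inequality.
    obtain ⟨p, b, hpb, hpv⟩ := hG.exists_affine_le_of_lt (𝕜 := ℝ) (mem_univ _) ha' isClosed_univ
      (hGc.lowerSemicontinuous.lowerSemicontinuousOn _)
    have hle : ∀ z, p z + b ≤ G z := fun z => by simpa using hpb ⟨z, mem_univ z⟩
    have hb : b ≤ 0 := by have := hle 0; simp at this; linarith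
    have hpv' : 2⁻¹ * p v + b = a' := by simpa using hpv
    -- The minorant costs `b` once where `m y ≤ K` and `m y / K` times elsewhere. In total this is
    -- `b (1 + I / K) ≥ 2 b`, and the factor 2 is the reason for the halved argument.
    have hpt : ∀ᵐ y ∂μ, w y * p (W y) + b * (w y + w y * m y / K) ≤ w y * m y := by
      filter_upwards [hfm] with y hy
      by_cases hwy : w y = 0
      · simp [hwy]
      have key : p (W y) + b * (1 + m y / K) ≤ m y := by
        rcases le_or_gt (m y) K with hmK | hmK
        · have h1 := hy hwy 1 one_pos le_rfl
          rw [one_smul, one_mul] at h1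
          have h2 := (hle _).trans ((hfG _ (h1.trans hmK)).trans h1)
          have : b * (m y / K) ≤ 0 := mul_nonpos_of_nonpos_of_nonneg hb (by have := hm0 y; positivity)
          linarith
        -- Shrinking `W y` by `K / m y` returns it to the sublevel set; the inequality obtained
        -- there is multiplied back by `m y / K`.
        · have hmy : 0 < m y := hK.trans hmK
          have h1 := hy hwy (K / m y) (by positivity) (by rw [div_le_one hmy]; exact hmK.le)
          rw [div_mul_cancel₀ _ hmy.ne'] at h1
          have h2 := (hle _).trans ((hfG _ h1).trans h1)
          rw [map_smul, smul_eq_mul] at h2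
          have h3 : m y / K * (K / m y * p (W y) + b) ≤ m y / K * K :=
            mul_le_mul_of_nonneg_left h2 (by positivity)
          have h4 : m y / K * (K / m y * p (W y) + b) = p (W y) + m y / K * b := by
            field_simp
          have h5 : m y / K * K = m y := by field_simp
          rw [h4, h5] at h3
          linarith
      have := mul_le_mul_of_nonneg_left key (hw y)
      calc _ = w y * (p (W y) + b * (1 + m y / K)) := by ring
        _ ≤ _ := this
    have hpW : Integrable (fun y => w y * p (W y)) μ := by
      simpa using p.integrable_comp hW
    have hpI : ∫ y, w y * p (W y) ∂μ = p v := by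
      rw [hv, ← p.integral_comp_comm hW]; simp
    have hq : Integrable (fun y => b * (w y + w y * m y / K)) μ :=
      (hwi.add (hm.div_const K)).const_mul b
    have h6 := integral_mono_ae (hpW.add hq) hm hpt
    simp only [Pi.add_apply] at h6
    rw [integral_add hpW hq, hpI, integral_const_mul,
      integral_add hwi (hm.div_const K), hw1, integral_div] at h6
    change p v + b * (1 + I / K) ≤ I at h6
    have h7 : I / K ≤ 1 := by rw [div_le_one hK]; exact hKI
    nlinarith

/-! ### Lower and upper envelopes of weak `N`-functions -/

section Envelopes

variable {n d : ℕ} {Ω : Set (RSpace n)} {M : RSpace n → RSpace d → ℝ}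

namespace IsWeakNFunction

theorem ae_smul_le (h : IsWeakNFunction Ω M) :
    ∀ᵐ y ∂volume.restrict Ω, ∀ s : ℝ, 0 ≤ s → s ≤ 1 → ∀ ξ, M y (s • ξ) ≤ s * M y ξ := by
  filter_upwards [h.convex, h.map_zero] with y hc h0 s hs hs1 ξ
  have := hc.2 (mem_univ ξ) (mem_univ (0 : RSpace d)) hs (sub_nonneg.2 hs1) (by ring)
  simpa [h0] using this

theorem ae_nonneg (h : IsWeakNFunction Ω M) : ∀ᵐ y ∂volume.restrict Ω, ∀ ξ, 0 ≤ M y ξ := by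
  obtain ⟨m₁, m₂, -, -, h1, -, -, -, hb⟩ := h.bounds
  filter_upwards [hb] with y hy ξ
  exact (h1 _ (norm_nonneg _)).trans (hy ξ).1

theorem exists_bound (h : IsWeakNFunction Ω M) (R : ℝ) :
    ∃ b : ℝ, 0 ≤ b ∧ ∀ᵐ y ∂volume.restrict Ω, ∀ ξ, ‖ξ‖ ≤ R → M y ξ ≤ b := by
  obtain ⟨m₁, m₂, -, hc, -, h2, -, -, hb⟩ := h.bounds
  refine ⟨max (m₂ 0) (m₂ |R|), (h2 0 le_rfl).trans (le_max_left _ _), ?_⟩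
  filter_upwards [hb] with y hy ξ hξ
  exact (hy ξ).2.trans (hc.le_max_of_mem_Icc (mem_Ici.2 le_rfl) (mem_Ici.2 (abs_nonneg R))
    ⟨norm_nonneg ξ, hξ.trans (le_abs_self R)⟩)

/-- A convex function bounded by `b` on the ball of radius `R + 1` is `2 b`-Lipschitz on the ball of
radius `R`, and the bound `b` is common to almost every `y`. -/
theorem exists_lipschitz (h : IsWeakNFunction Ω M) (R : ℝ) :
    ∃ Λ : ℝ, 0 ≤ Λ ∧ ∀ᵐ y ∂volume.restrict Ω, ∀ ξ ζ, ‖ξ‖ < R → ‖ζ‖ < R →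
      M y ξ ≤ M y ζ + Λ * ‖ξ - ζ‖ := by
  obtain ⟨b, hb0, hb⟩ := h.exists_bound (R + 1)
  refine ⟨2 * b, by positivity, ?_⟩
  filter_upwards [hb, h.ae_nonneg, h.convex] with y hy hy0 hc ξ ζ hξ hζ
  have := (hc.subset (subset_univ (Metric.ball (0 : RSpace d) (R + 1)))
    (convex_ball _ _)).lipschitzOnWith_of_abs_le one_pos (M := b)
    (fun a ha => by
      rw [abs_of_nonneg (hy0 a)]
      exact hy a (by simpa using ha.le))
  have h2 := this.dist_le_mul ξ (by simpa using hξ) ζ (by simpa using hζ)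
  rw [Real.coe_toNNReal _ (by positivity), div_one, Real.dist_eq, dist_eq_norm] at h2
  linarith [le_abs_self (M y ξ - M y ζ)]

variable {B : Set (RSpace n)}

theorem isBoundedUnder_ge (h : IsWeakNFunction Ω M) (ξ : RSpace d) :
    IsBoundedUnder (· ≥ ·) (ae (volume.restrict (B ∩ Ω))) (fun y => M y ξ) := by
  refine isBoundedUnder_of_eventually_ge (a := 0) ?_
  filter_upwards [ae_restrict_of_ae_restrict_of_subset inter_subset_right h.ae_nonneg] with y hy
  exact hy ξ

theorem isBoundedUnder_le (h : IsWeakNFunction Ω M) (ξ : RSpace d) :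
    IsBoundedUnder (· ≤ ·) (ae (volume.restrict (B ∩ Ω))) (fun y => M y ξ) := by
  obtain ⟨b, -, hb⟩ := h.exists_bound ‖ξ‖
  refine isBoundedUnder_of_eventually_le (a := b) ?_
  filter_upwards [ae_restrict_of_ae_restrict_of_subset inter_subset_right hb] with y hy
  exact hy ξ le_rfl

/-- `NeZero` excludes the meaningless values of a real `essInf` over a null set. -/
theorem lowerEnv_le_of_ae (h : IsWeakNFunction Ω M) [NeZero (volume.restrict (B ∩ Ω))]
    {ξ ζ : RSpace d} {a c : ℝ} (ha : 0 ≤ a)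
    (hle : ∀ᵐ y ∂volume.restrict (B ∩ Ω), M y ξ ≤ a * M y ζ + c) :
    lowerEnv Ω M B ξ ≤ a * lowerEnv Ω M B ζ + c := by
  have h1 := ae_essInf_le (h.isBoundedUnder_ge (B := B) ξ)
  have hb := (h.isBoundedUnder_le (B := B) ζ).isCoboundedUnder_ge
  rcases ha.eq_or_lt with rfl | ha
  · obtain ⟨y, hy1, hy2⟩ := (h1.and hle).exists
    exact hy1.trans (by simpa using hy2)
  · have h2 : (lowerEnv Ω M B ξ - c) / a ≤ lowerEnv Ω M B ζ := by
      refine le_essInf_of_ae_le _ ?_ hb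
      filter_upwards [h1, hle] with y hy1 hy2
      rw [div_le_iff₀ ha]
      have : lowerEnv Ω M B ξ ≤ M y ξ := hy1
      linarith
    rw [div_le_iff₀ ha] at h2
    linarith

theorem upperEnv_le_of_ae (h : IsWeakNFunction Ω M) [NeZero (volume.restrict (B ∩ Ω))]
    {ξ ζ : RSpace d} {c : ℝ}
    (hle : ∀ᵐ y ∂volume.restrict (B ∩ Ω), M y ξ ≤ M y ζ + c) :
    upperEnv Ω M B ξ ≤ upperEnv Ω M B ζ + c := by
  have h1 := ae_le_essSup (h.isBoundedUnder_le (B := B) ζ)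
  refine essSup_le_of_ae_le _ ?_ (h.isBoundedUnder_ge (B := B) ξ).isCoboundedUnder_le
  filter_upwards [h1, hle] with y hy1 hy2
  have : M y ζ ≤ upperEnv Ω M B ζ := hy1
  linarith

/-- A single null set serves all `ξ`: the bounds hold off a null set for a countable dense family of
`ξ`, and the local Lipschitz constants shared by `M y` and both envelopes extend them to every `ξ`.
-/
theorem ae_lowerEnv_le_le_upperEnv (h : IsWeakNFunction Ω M) :
    ∀ᵐ y ∂volume.restrict (B ∩ Ω), ∀ ξ, lowerEnv Ω M B ξ ≤ M y ξ ∧ M y ξ ≤ upperEnv Ω M B ξ := by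
  rcases eq_or_ne (volume.restrict (B ∩ Ω)) 0 with h0 | h0
  · rw [h0]; simp
  have : NeZero (volume.restrict (B ∩ Ω)) := ⟨h0⟩
  have hsub {p : RSpace n → Prop} (hp : ∀ᵐ y ∂volume.restrict Ω, p y) :
      ∀ᵐ y ∂volume.restrict (B ∩ Ω), p y :=
    ae_restrict_of_ae_restrict_of_subset inter_subset_right hp
  choose Λ hΛ0 hΛ using fun R : ℕ => h.exists_lipschitz R
  have hlow : ∀ R : ℕ, ∀ ξ ζ : RSpace d, ‖ξ‖ < R → ‖ζ‖ < R →
      lowerEnv Ω M B ξ ≤ lowerEnv Ω M B ζ + Λ R * ‖ξ - ζ‖ := by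
    intro R ξ ζ hξ hζ
    have := h.lowerEnv_le_of_ae (B := B) (ξ := ξ) (ζ := ζ) (a := 1) (c := Λ R * ‖ξ - ζ‖) zero_le_one
      (by filter_upwards [hsub (hΛ R)] with y hy; rw [one_mul]; exact hy ξ ζ hξ hζ)
    rwa [one_mul] at this
  have hupp : ∀ R : ℕ, ∀ ξ ζ : RSpace d, ‖ξ‖ < R → ‖ζ‖ < R →
      upperEnv Ω M B ξ ≤ upperEnv Ω M B ζ + Λ R * ‖ξ - ζ‖ := by
    intro R ξ ζ hξ hζ
    exact h.upperEnv_le_of_ae (B := B)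
      (by filter_upwards [hsub (hΛ R)] with y hy; exact hy ξ ζ hξ hζ)
  have hd : ∀ᵐ y ∂volume.restrict (B ∩ Ω), ∀ k, lowerEnv Ω M B (TopologicalSpace.denseSeq _ k) ≤
      M y (TopologicalSpace.denseSeq _ k) ∧
      M y (TopologicalSpace.denseSeq _ k) ≤ upperEnv Ω M B (TopologicalSpace.denseSeq _ k) := by
    rw [ae_all_iff]
    intro k
    filter_upwards [ae_essInf_le (h.isBoundedUnder_ge (B := B) (TopologicalSpace.denseSeq _ k)),
      ae_le_essSup (h.isBoundedUnder_le (B := B) (TopologicalSpace.denseSeq _ k))] with y h1 h2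
    exact ⟨h1, h2⟩
  filter_upwards [hd, hsub (ae_all_iff.2 hΛ)] with y hy hL ξ
  obtain ⟨R, hR⟩ := exists_nat_gt (‖ξ‖ + 1)
  have happ : ∀ ε > 0, lowerEnv Ω M B ξ ≤ M y ξ + ε ∧ M y ξ ≤ upperEnv Ω M B ξ + ε := by
    intro ε hε
    obtain ⟨k, hk⟩ := (TopologicalSpace.denseRange_denseSeq (RSpace d)).exists_dist_lt ξ
      (ε := min 1 (ε / (2 * (Λ R + 1)))) (by have := hΛ0 R; positivity)
    set q := TopologicalSpace.denseSeq (RSpace d) k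
    rw [dist_eq_norm] at hk
    have hk1 := hk.trans_le (min_le_left _ _)
    have hk2 := hk.trans_le (min_le_right _ _)
    have hq : ‖q‖ < R := by
      have := norm_sub_norm_le q ξ
      rw [norm_sub_rev] at this
      linarith
    have hξ : ‖ξ‖ < R := by linarith
    have hsm : Λ R * ‖ξ - q‖ ≤ ε / 2 := by
      have h1 : (Λ R + 1) * ‖ξ - q‖ ≤ ε / 2 := by
        rw [lt_div_iff₀ (by have := hΛ0 R; positivity)] at hk2
        linarith
      nlinarith [norm_nonneg (ξ - q)]
    have e1 := hlow R ξ q hξ hq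
    have e2 := hupp R q ξ hq hξ
    have e3 := hL R ξ q hξ hq
    have e4 := hL R q ξ hq hξ
    rw [norm_sub_rev] at e2 e4
    have := hy k
    constructor <;> linarith
  exact ⟨le_of_forall_pos_le_add fun ε hε => (happ ε hε).1,
    le_of_forall_pos_le_add fun ε hε => (happ ε hε).2⟩

end IsWeakNFunction

end Envelopes

/-! ### From the balance condition to averages -/

section Envelopes

variable {n d : ℕ} {Ω : Set (RSpace n)} {M : RSpace n → RSpace d → ℝ}

namespace IsWeakNFunction

variable {B : Set (RSpace n)}

theorem lowerEnv_smul_le (h : IsWeakNFunction Ω M) [NeZero (volume.restrict (B ∩ Ω))]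
    {s : ℝ} (hs : 0 ≤ s) (hs1 : s ≤ 1) (ξ : RSpace d) :
    lowerEnv Ω M B (s • ξ) ≤ s * lowerEnv Ω M B ξ := by
  have := h.lowerEnv_le_of_ae (B := B) (ξ := s • ξ) (ζ := ξ) (a := s) (c := 0) hs (by
    filter_upwards [ae_restrict_of_ae_restrict_of_subset inter_subset_right h.ae_smul_le] with y hy
    simpa using hy s hs hs1 ξ)
  simpa using this

theorem lowerEnv_pos (h : IsWeakNFunction Ω M) [NeZero (volume.restrict (B ∩ Ω))]
    {ξ : RSpace d} (hξ : ξ ≠ 0) : 0 < lowerEnv Ω M B ξ := by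
  have hb := (h.isBoundedUnder_le (B := B) ξ).isCoboundedUnder_ge
  obtain ⟨m₁, m₂, -, -, -, -, -, hpos, hm⟩ := h.bounds
  refine (hpos ‖ξ‖ (norm_pos_iff.2 hξ)).trans_le (le_essInf_of_ae_le _ ?_ hb)
  filter_upwards [ae_restrict_of_ae_restrict_of_subset inter_subset_right hm] with y hy
  exact (hy ξ).1

theorem lowerEnv_nonneg (h : IsWeakNFunction Ω M) [NeZero (volume.restrict (B ∩ Ω))]
    (ξ : RSpace d) : 0 ≤ lowerEnv Ω M B ξ := by
  have hb := (h.isBoundedUnder_le (B := B) ξ).isCoboundedUnder_ge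
  refine le_essInf_of_ae_le _ ?_ hb
  filter_upwards [ae_restrict_of_ae_restrict_of_subset inter_subset_right h.ae_nonneg] with y hy
  exact hy ξ

theorem bddAbove_lowerEnv_sphere (h : IsWeakNFunction Ω M) [NeZero (volume.restrict (B ∩ Ω))]
    (t : ℝ) : BddAbove (range fun η : Metric.sphere (0 : RSpace d) 1 =>
      lowerEnv Ω M B (t • (η : RSpace d))) := by
  obtain ⟨b, -, hb⟩ := h.exists_bound |t|
  refine ⟨b, ?_⟩
  rintro _ ⟨η, rfl⟩
  obtain ⟨y, hy1, hy2⟩ := ((h.ae_lowerEnv_le_le_upperEnv (B := B)).and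
    (ae_restrict_of_ae_restrict_of_subset inter_subset_right hb)).exists
  refine (hy1 _).1.trans (hy2 _ ?_)
  rw [norm_smul, Real.norm_eq_abs, mem_sphere_zero_iff_norm.1 η.2, mul_one]

/-- Converts a norm bound into the premise of the balance condition: a nonzero `v` is a contraction
of the point of the sphere of radius `t` on its ray, and the envelope does not decrease along rays.
-/
theorem lowerEnv_le_iSup_sphere (h : IsWeakNFunction Ω M) [NeZero (volume.restrict (B ∩ Ω))]
    [Nonempty (Metric.sphere (0 : RSpace d) 1)]
    {t : ℝ} (ht : 0 < t) {v : RSpace d} (hv : ‖v‖ ≤ t) :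
    lowerEnv Ω M B v ≤ ⨆ η : Metric.sphere (0 : RSpace d) 1,
      lowerEnv Ω M B (t • (η : RSpace d)) := by
  have hbdd := h.bddAbove_lowerEnv_sphere (B := B) t
  rcases eq_or_ne v 0 with rfl | hv0
  · have η : Metric.sphere (0 : RSpace d) 1 := Classical.arbitrary _
    have h1 := h.lowerEnv_smul_le (B := B) le_rfl zero_le_one (t • (η : RSpace d))
    rw [zero_smul, zero_mul] at h1
    exact h1.trans ((h.lowerEnv_nonneg _).trans (le_ciSup hbdd η))
  · have hvn : 0 < ‖v‖ := norm_pos_iff.2 hv0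
    let η : Metric.sphere (0 : RSpace d) 1 :=
      ⟨‖v‖⁻¹ • v, by simp [norm_smul, hvn.ne']⟩
    have h1 := h.lowerEnv_smul_le (B := B) (s := ‖v‖ / t) (by positivity)
      ((div_le_one ht).2 hv) (t • (η : RSpace d))
    have h2 : (‖v‖ / t) • (t • (η : RSpace d)) = v := by
      simp only [η, smul_smul]
      rw [← mul_assoc, div_mul_cancel₀ _ ht.ne', mul_inv_cancel₀ hvn.ne', one_smul]
    rw [h2] at h1
    have h3 : ‖v‖ / t * lowerEnv Ω M B (t • (η : RSpace d)) ≤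
        1 * lowerEnv Ω M B (t • (η : RSpace d)) :=
      mul_le_mul_of_nonneg_right ((div_le_one ht).2 hv) (h.lowerEnv_nonneg _)
    rw [one_mul] at h3
    exact h1.trans (h3.trans (le_ciSup hbdd η))

theorem aemeasurable_comp (h : IsWeakNFunction Ω M) {W : RSpace n → RSpace d}
    (hW : AEStronglyMeasurable W (volume.restrict Ω)) :
    AEMeasurable (fun y => M y (W y)) (volume.restrict Ω) :=
  aemeasurable_caratheodory h.measurable_left h.continuous_right hW

/-- The null set of `x` is fixed before `w` and `W`, because the weight will later be `κ(x - ·)`.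
The Jensen inequality is applied with `f` the lower envelope, `G = M(x, ·/C) - 1`, and as threshold
the supremum over the sphere. -/
theorem ae_average_le (h : IsWeakNFunction Ω M) (hΩ : IsOpen Ω) (hB : IsOpen B)
    {t C : ℝ} (ht : 0 < t) (hC : 1 < C)
    (hbal : ∀ ξ : RSpace d, lowerEnv Ω M B (C • ξ) ≤
      (⨆ η : Metric.sphere (0 : RSpace d) 1, lowerEnv Ω M B (t • (η : RSpace d))) →
      upperEnv Ω M B ξ ≤ lowerEnv Ω M B (C • ξ) + 1) :
    ∀ᵐ x ∂volume.restrict (B ∩ Ω), ∀ (w : RSpace n → ℝ) (W : RSpace n → RSpace d),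
      (∀ y, 0 ≤ w y) → Integrable w → ∫ y, w y = 1 → (∀ y, w y ≠ 0 → y ∈ B) →
      (∀ y, y ∉ Ω → W y = 0) → Integrable (fun y => w y • W y) →
      Integrable (fun y => w y * Ω.indicator (fun y => M y (W y)) y) →
      ‖∫ y, w y • W y‖ ≤ t →
      M x ((2 * C)⁻¹ • ∫ y, w y • W y) ≤ 1 + ∫ y, w y * Ω.indicator (fun y => M y (W y)) y := by
  rcases (B ∩ Ω).eq_empty_or_nonempty with h0 | hne
  · rw [h0]; simp
  have : NeZero (volume.restrict (B ∩ Ω)) := ⟨by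
    rw [Ne, Measure.restrict_eq_zero]
    exact ((hB.inter hΩ).measure_pos _ hne).ne'⟩
  have hsub {p : RSpace n → Prop} (hp : ∀ᵐ y ∂volume.restrict Ω, p y) :
      ∀ᵐ y ∂volume.restrict (B ∩ Ω), p y :=
    ae_restrict_of_ae_restrict_of_subset inter_subset_right hp
  have hm0 : ∀ (W : RSpace n → RSpace d) y, 0 ≤ Ω.indicator (fun y => M y (W y)) y :=
    fun W y => indicator_nonneg (fun y hy => h.nonneg y hy _) y
  -- For `d = 0` the sphere is empty and the supremum is `0`, which is not an admissible threshold.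
  rcases Nat.eq_zero_or_pos d with rfl | hd
  · filter_upwards [hsub h.map_zero] with x hx w W hw _ _ _ _ _ _ _
    rw [Subsingleton.elim ((2 * C)⁻¹ • ∫ y, w y • W y) 0, hx]
    have : 0 ≤ ∫ y, w y * Ω.indicator (fun y => M y (W y)) y :=
      integral_nonneg fun y => mul_nonneg (hw y) (hm0 W y)
    linarith
  have : Nonempty (Fin d) := ⟨⟨0, hd⟩⟩
  have : Nonempty (Metric.sphere (0 : RSpace d) 1) := by
    obtain ⟨v, hv⟩ := exists_norm_eq (RSpace d) zero_le_one
    exact ⟨⟨v, by simpa using hv⟩⟩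
  set K := ⨆ η : Metric.sphere (0 : RSpace d) 1, lowerEnv Ω M B (t • (η : RSpace d)) with hK
  have hK0 : 0 < K := by
    have η : Metric.sphere (0 : RSpace d) 1 := Classical.arbitrary _
    refine (h.lowerEnv_pos (B := B) (ξ := t • (η : RSpace d)) ?_).trans_le
      (le_ciSup (h.bddAbove_lowerEnv_sphere (B := B) t) η)
    have := mem_sphere_zero_iff_norm.1 η.2
    rw [smul_ne_zero_iff, ← norm_ne_zero_iff (a := (η : RSpace d)), this]
    exact ⟨ht.ne', one_ne_zero⟩
  have hbelow : ∀ᵐ y, y ∈ B ∩ Ω → (∀ ξ, lowerEnv Ω M B ξ ≤ M y ξ) ∧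
      ∀ s : ℝ, 0 ≤ s → s ≤ 1 → ∀ ξ, M y (s • ξ) ≤ s * M y ξ := by
    rw [← ae_restrict_iff' (hB.inter hΩ).measurableSet]
    filter_upwards [h.ae_lowerEnv_le_le_upperEnv (B := B), hsub h.ae_smul_le] with y h1 h2
    exact ⟨fun ξ => (h1 ξ).1, h2⟩
  filter_upwards [h.ae_lowerEnv_le_le_upperEnv (B := B), hsub h.convex, hsub h.continuous_right,
    hsub h.map_zero] with x hx hxc hxcont hx0 w W hw hwi hw1 hwB hWΩ hWi hmi hle
  have hC0 : 0 < C := by linarith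
  set G : RSpace d → ℝ := fun v => M x (C⁻¹ • v) - 1 with hG
  have hGconv : ConvexOn ℝ univ G := by
    have h1 := hxc.comp_linearMap (C⁻¹ • (LinearMap.id : RSpace d →ₗ[ℝ] RSpace d))
    have h2 := h1.add_const (-1)
    simpa [Function.comp_def, hG, sub_eq_add_neg] using! h2
  have hGc : Continuous G := (hxcont.comp (continuous_const_smul _)).sub continuous_const
  -- This is the balance condition at `C⁻¹ • v`.
  have hfG : ∀ v, lowerEnv Ω M B v ≤ K → G v ≤ lowerEnv Ω M B v := by
    intro v hv
    have hv' : C • C⁻¹ • v = v := by rw [smul_smul, mul_inv_cancel₀ hC0.ne', one_smul]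
    have h1 := hbal (C⁻¹ • v) (by rw [hv']; exact hv)
    rw [hv'] at h1
    have := (hx (C⁻¹ • v)).2
    simp only [hG]
    linarith
  have key := hGconv.apply_half_integral_le (μ := volume) hGc (by simp [hG, hx0]) hK0 hfG
    (w := w) (W := W) (m := Ω.indicator (fun y => M y (W y))) hw hwi hw1 hmi hWi (hm0 W) ?_
    (h.lowerEnv_le_iSup_sphere ht hle)
  · simp only [hG, smul_smul] at key
    rw [mul_inv_rev]
    linarith
  · filter_upwards [hbelow] with y hy hwy s hs hs1
    by_cases hyΩ : y ∈ Ω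
    · obtain ⟨h1, h2⟩ := hy ⟨hwB y hwy, hyΩ⟩
      rw [indicator_of_mem hyΩ]
      exact (h1 _).trans (h2 s hs.le hs1 _)
    · rw [indicator_of_notMem hyΩ, hWΩ y hyΩ, smul_zero, mul_zero]
      have h1 := h.lowerEnv_smul_le (B := B) le_rfl zero_le_one (0 : RSpace d)
      rwa [zero_smul, zero_mul] at h1

end IsWeakNFunction

/-- The balance condition allows one to bound `M x` at averages by averages of `M`. -/
theorem BalanceGen.exists_average_le {γ : ℝ} {M : RSpace n → RSpace n → ℝ}
    (h : BalanceGen Ω γ M) (hΩ : IsOpen Ω) :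
    ∃ κ t N : ℝ, 0 < κ ∧ 0 < t ∧ 0 ≤ N ∧ ∀ (a : RSpace n) (r : ℝ), 0 < r → r ≤ 1 →
    ∀ᵐ x ∂volume.restrict (Metric.ball a r ∩ Ω),
      ∀ (w : RSpace n → ℝ) (W : RSpace n → RSpace n),
      (∀ y, 0 ≤ w y) → Integrable w → ∫ y, w y = 1 → (∀ y, w y ≠ 0 → y ∈ Metric.ball a r) →
      AEStronglyMeasurable W volume →
      (∀ y, y ∉ Ω → W y = 0) → Integrable (fun y => w y • W y) →
      Integrable (fun y => w y * Ω.indicator (fun y => M y (W y)) y) →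
      ‖∫ y, w y • W y‖ ≤ t * r ^ (γ - 1) →
      M x (κ • ∫ y, w y • W y) ≤ N + ∫ y, w y * Ω.indicator (fun y => M y (W y)) y := by
  obtain ⟨N, ℓ, P, Mj, -, -, hMj, hsum, c, C, hc, hC, hbal⟩ := h
  -- `p` dominates every `‖P j‖`, so a vector of norm at most `(c / p) r^(γ-1)` has all its blocks
  -- in the ball of radius `c r^(γ-1)`. Each of the `N` blocks contributes an additive error `1`.
  set p : ℝ := 1 + ∑ j, ‖P j‖ with hp
  have hp0 : 0 < p := by have := Finset.sum_nonneg fun j (_ : j ∈ Finset.univ) => norm_nonneg (P j)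
                         linarith
  refine ⟨(2 * C)⁻¹, c / p, N, by positivity, by positivity, by positivity, fun a r hr hr1 => ?_⟩
  rcases (Metric.ball a r ∩ Ω).eq_empty_or_nonempty with h0 | hne
  · rw [h0]; simp
  have hj : ∀ j, _ := fun j => (hMj j).ae_average_le hΩ (Metric.isOpen_ball (x := a) (ε := r))
    (t := c * r ^ (γ - 1)) (C := C) (by positivity) hC (hbal a r hr hr1 hne j)
  filter_upwards [ae_all_iff.2 hj, ae_restrict_mem (Metric.isOpen_ball.inter hΩ).measurableSet]
    with x hx hxΩ w W hw hwi hw1 hwB hWm hWΩ hWi hmi hle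
  have hPi : ∀ j, Integrable (fun y => w y • P j (W y)) := fun j => by
    simpa using (P j).integrable_comp hWi
  have hPint : ∀ j, ∫ y, w y • P j (W y) = P j (∫ y, w y • W y) := fun j => by
    rw [← (P j).integral_comp_comm hWi]; simp
  have hm : ∀ y, Ω.indicator (fun y => M y (W y)) y =
      ∑ j, Ω.indicator (fun y => Mj j y (P j (W y))) y := by
    intro y
    by_cases hy : y ∈ Ω
    · simp only [indicator_of_mem hy]; exact hsum y hy _
    · simp only [indicator_of_notMem hy]; simp
  have hjm0 : ∀ j y, 0 ≤ Ω.indicator (fun y => Mj j y (P j (W y))) y := fun j y =>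
    indicator_nonneg (fun y hy => (hMj j).nonneg y hy _) y
  have hmji : ∀ j, Integrable (fun y => w y * Ω.indicator (fun y => Mj j y (P j (W y))) y) := by
    intro j
    refine hmi.mono' ?_ (ae_of_all _ fun y => ?_)
    · refine hwi.aestronglyMeasurable.mul (AEMeasurable.aestronglyMeasurable ?_)
      rw [aemeasurable_indicator_iff hΩ.measurableSet]
      exact (hMj j).aemeasurable_comp
        ((P j).continuous.comp_aestronglyMeasurable hWm.restrict)
    · rw [Real.norm_of_nonneg (mul_nonneg (hw y) (hjm0 j y)), hm]
      exact mul_le_mul_of_nonneg_left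
        (Finset.single_le_sum (fun i _ => hjm0 i y) (Finset.mem_univ j)) (hw y)
  have hest : ∀ j, Mj j x (P j ((2 * C)⁻¹ • ∫ y, w y • W y)) ≤
      1 + ∫ y, w y * Ω.indicator (fun y => Mj j y (P j (W y))) y := by
    intro j
    have := hx j w (fun y => P j (W y)) hw hwi hw1 hwB (fun y hy => by simp [hWΩ y hy]) (hPi j)
      (hmji j) ?_
    · rwa [hPint, ← map_smul] at this
    · rw [hPint]
      have h1 : ‖P j‖ ≤ p := by
        have := Finset.single_le_sum (fun i _ => norm_nonneg (P i)) (Finset.mem_univ j)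
        linarith
      calc _ ≤ ‖P j‖ * ‖∫ y, w y • W y‖ := (P j).le_opNorm _
        _ ≤ p * (c / p * r ^ (γ - 1)) := by gcongr
        _ = _ := by field_simp
  rw [hsum x hxΩ.2]
  refine (Finset.sum_le_sum fun j _ => hest j).trans_eq ?_
  rw [Finset.sum_add_distrib, ← integral_finsetSum _ fun j _ => hmji j]
  simp only [hm, Finset.mul_sum]
  simp

end Envelopes

/-! ### Gradients -/

section Gradient

variable {n : ℕ}

theorem norm_gradient (f : RSpace n → ℝ) (x : RSpace n) : ‖gradient f x‖ = ‖fderiv ℝ f x‖ := by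
  simp [gradient]

theorem inner_gradient_eq_fderiv (f : RSpace n → ℝ) (x v : RSpace n) :
    inner ℝ v (gradient f x) = fderiv ℝ f x v := by
  rw [real_inner_comm, inner_gradient_left]

theorem continuous_gradient {f : RSpace n → ℝ} (hf : ContDiff ℝ ∞ f) : Continuous (gradient f) :=
  (InnerProductSpace.toDual ℝ (RSpace n)).symm.continuous.comp (hf.continuous_fderiv (by simp))

theorem support_gradient_subset (f : RSpace n → ℝ) :
    Function.support (gradient f) ⊆ tsupport f := by
  refine subset_trans ?_ (support_fderiv_subset ℝ (f := f))
  intro x hx h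
  exact hx (by simp [gradient, h])

theorem HasCompactSupport.gradient {f : RSpace n → ℝ} (hf : HasCompactSupport f) :
    HasCompactSupport (gradient f) :=
  hf.mono' (support_gradient_subset f)

theorem gradient_comp_sub_left {f : RSpace n → ℝ} (hf : ContDiff ℝ ∞ f) (x y : RSpace n) :
    gradient (fun y => f (x - y)) y = - gradient f (x - y) := by
  have h1 : HasFDerivAt (fun y => f (x - y)) (-(fderiv ℝ f (x - y))) y := by
    have h2 := ((hf.differentiable (by simp)) (x - y)).hasFDerivAt.comp y
      ((hasFDerivAt_id y).const_sub x)
    simpa [Function.comp_def] using! h2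
  simp [gradient, h1.fderiv]

theorem gradient_comp_smul {f : RSpace n → ℝ} (hf : ContDiff ℝ ∞ f) (b c : ℝ) (x : RSpace n) :
    gradient (fun x => b * f (c • x)) x = (b * c) • gradient f (c • x) := by
  have h1 : HasFDerivAt (fun x => b * f (c • x)) ((b * c) • (fderiv ℝ f (c • x))) x := by
    have h2 := (((hf.differentiable (by simp)) (c • x)).hasFDerivAt.comp x
      ((hasFDerivAt_id x).const_smul c)).const_mul b
    refine h2.congr_fderiv ?_
    ext v
    simp [mul_assoc]
  simp [gradient, h1.fderiv]

/-- Integration by parts against the constant `1`. It allows a constant to be subtracted from `u` in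
`∇(κ * u)`. -/
theorem integral_gradient_eq_zero {f : RSpace n → ℝ} (hf : ContDiff ℝ ∞ f)
    (hc : HasCompactSupport f) : ∫ x, gradient f x = 0 := by
  have hi : Integrable (gradient f) := (continuous_gradient hf).integrable_of_hasCompactSupport
    hc.gradient
  refine ext_inner_left ℝ fun v => ?_
  rw [← integral_inner hi, inner_zero_right]
  have hfi : Integrable (fun x => fderiv ℝ f x v) := by
    have := hi.const_inner (𝕜 := ℝ) v
    simpa only [inner_gradient_eq_fderiv] using this
  have := integral_mul_fderiv_eq_neg_fderiv_mul_of_integrable (μ := (volume : Measure (RSpace n)))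
    (f := fun _ => (1 : ℝ)) (g := f) (v := v) (by simp) (by simpa using hfi)
    (by simpa using hf.continuous.integrable_of_hasCompactSupport hc)
    (fun x _ => by fun_prop) (fun x _ => hf.differentiable (by simp) x)
  simp only [one_mul, fderiv_fun_const, Pi.zero_apply, zero_mul, integral_zero, neg_zero,
    zero_apply] at this
  simpa only [inner_gradient_eq_fderiv] using this

end Gradient

/-! ### Mollification -/

/-- Nonnegative smooth kernels of integral one supported in the ball of radius `r`, which need not
be symmetric. -/
structure IsMollifier {n : ℕ} (κ : RSpace n → ℝ) (r : ℝ) : Prop where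
  contDiff : ContDiff ℝ ∞ κ
  nonneg : ∀ x, 0 ≤ κ x
  integral_eq_one : ∫ x, κ x = 1
  norm_le : ∀ x, κ x ≠ 0 → ‖x‖ ≤ r

/-- The convolution of `κ` and `f`. -/
noncomputable def mollify {n : ℕ} {E : Type*} [NormedAddCommGroup E] [NormedSpace ℝ E]
    (κ : RSpace n → ℝ) (f : RSpace n → E) (x : RSpace n) : E :=
  ∫ y, κ (x - y) • f y

namespace IsMollifier

variable {n : ℕ} {κ : RSpace n → ℝ} {r : ℝ}
variable {E : Type*} [NormedAddCommGroup E] [NormedSpace ℝ E]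

theorem support_subset (h : IsMollifier κ r) :
    Function.support κ ⊆ Metric.closedBall 0 r := fun x hx => by simpa using h.norm_le x hx

theorem tsupport_subset (h : IsMollifier κ r) : tsupport κ ⊆ Metric.closedBall 0 r :=
  closure_minimal h.support_subset Metric.isClosed_closedBall

theorem hasCompactSupport (h : IsMollifier κ r) : HasCompactSupport κ :=
  HasCompactSupport.of_support_subset_isCompact (isCompact_closedBall 0 r) h.support_subset

theorem integrable (h : IsMollifier κ r) : Integrable κ :=
  h.contDiff.continuous.integrable_of_hasCompactSupport h.hasCompactSupport

theorem integrable_gradient (h : IsMollifier κ r) : Integrable (gradient κ) :=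
  (continuous_gradient h.contDiff).integrable_of_hasCompactSupport h.hasCompactSupport.gradient

/-- After scaling, a kernel centred at `v` moves supports by about `δ v` besides smoothing; with `v`
pointing inwards this keeps mollifications away from the boundary. -/
theorem exists_center (v : RSpace n) : ∃ κ : RSpace n → ℝ, IsMollifier κ (‖v‖ + 1) ∧
    ∀ x, κ x ≠ 0 → ‖x - v‖ ≤ 1 := by
  let b : ContDiffBump v := ⟨2⁻¹, 1, by norm_num, by norm_num⟩
  have hs : ∀ x, b.normed volume x ≠ 0 → ‖x - v‖ ≤ 1 := fun x hx => by
    have : x ∈ Function.support (b.normed volume) := hx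
    rw [b.support_normed_eq, mem_ball_iff_norm] at this
    exact this.le
  refine ⟨b.normed volume, ⟨b.contDiff_normed, b.nonneg_normed, b.integral_normed, fun x hx => ?_⟩,
    hs⟩
  have := norm_add_le (x - v) v
  rw [sub_add_cancel] at this
  linarith [hs x hx]

theorem scale (h : IsMollifier κ r) {δ : ℝ} (hδ : 0 < δ) :
    IsMollifier (fun x => (δ ^ n)⁻¹ * κ (δ⁻¹ • x)) (r * δ) where
  contDiff := contDiff_const.mul (h.contDiff.comp (contDiff_const_smul _))
  nonneg x := mul_nonneg (by positivity) (h.nonneg _)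
  integral_eq_one := by
    rw [integral_const_mul, Measure.integral_comp_smul, h.integral_eq_one]
    simp only [finrank_euclideanSpace, Fintype.card_fin, smul_eq_mul, mul_one]
    rw [inv_pow, inv_inv, abs_of_pos (by positivity), inv_mul_cancel₀ (by positivity)]
  norm_le x hx := by
    have := h.norm_le (δ⁻¹ • x) (fun h0 => hx (by simp [h0]))
    rw [norm_smul, Real.norm_of_nonneg (by positivity), inv_mul_le_iff₀ hδ] at this
    linarith

theorem integral_norm_gradient_scale (h : IsMollifier κ r) {δ : ℝ} (hδ : 0 < δ) :
    ∫ x, ‖gradient (fun x => (δ ^ n)⁻¹ * κ (δ⁻¹ • x)) x‖ = δ⁻¹ * ∫ x, ‖gradient κ x‖ := by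
  simp only [gradient_comp_smul h.contDiff, norm_smul]
  rw [integral_const_mul, Measure.integral_comp_smul volume (fun x => ‖gradient κ x‖)]
  simp only [finrank_euclideanSpace, Fintype.card_fin, smul_eq_mul]
  rw [inv_pow, inv_inv, abs_of_pos (by positivity), Real.norm_of_nonneg (by positivity)]
  field_simp

theorem integrable_smul (h : IsMollifier κ r) {f : RSpace n → E} (hf : Integrable f)
    (x : RSpace n) : Integrable (fun y => κ (x - y) • f y) := by
  obtain ⟨C, hC⟩ := h.contDiff.continuous.bounded_above_of_compact_support h.hasCompactSupport
  exact hf.bdd_smul C (h.contDiff.continuous.comp (continuous_const.sub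
    continuous_id)).aestronglyMeasurable (ae_of_all _ fun y => hC _)

theorem integral_sub (h : IsMollifier κ r) (x : RSpace n) : ∫ y, κ (x - y) = 1 := by
  rw [integral_sub_left_eq_self κ volume x, h.integral_eq_one]

theorem mollify_eq_convolution (f : RSpace n → E) :
    mollify κ f = convolution κ f (ContinuousLinearMap.lsmul ℝ ℝ) volume := by
  ext x
  rw [convolution_lsmul_swap, mollify]

theorem contDiff_mollify (h : IsMollifier κ r) {u : RSpace n → ℝ} (hu : Integrable u) :
    ContDiff ℝ ∞ (mollify κ u) := by
  rw [mollify_eq_convolution]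
  exact h.hasCompactSupport.contDiff_convolution_left (n := ⊤) _ h.contDiff hu.locallyIntegrable

theorem exists_of_mollify_ne_zero {f : RSpace n → E} {x : RSpace n}
    (hx : mollify κ f x ≠ 0) : ∃ z, κ z ≠ 0 ∧ f (x - z) ≠ 0 := by
  by_contra! H
  refine hx (integral_eq_zero_of_ae (ae_of_all _ fun y => ?_))
  by_cases hy : κ (x - y) = 0
  · simp [hy]
  · simpa using Or.inr (H _ hy)

theorem integrable_gradient_smul (h : IsMollifier κ r) {u : RSpace n → ℝ} (hu : Integrable u)
    (x : RSpace n) : Integrable (fun y => u y • gradient κ (x - y)) := by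
  have hc := continuous_gradient h.contDiff
  obtain ⟨C, hC⟩ := hc.bounded_above_of_compact_support h.hasCompactSupport.gradient
  exact hu.smul_bdd C (hc.comp (continuous_const.sub continuous_id)).aestronglyMeasurable
    (ae_of_all _ fun y => hC _)

theorem gradient_mollify_eq (h : IsMollifier κ r) {u : RSpace n → ℝ} (hu : Integrable u)
    (x : RSpace n) : gradient (mollify κ u) x = ∫ y, u y • gradient κ (x - y) := by
  refine ext_inner_left ℝ fun v => ?_
  rw [← integral_inner (h.integrable_gradient_smul hu x), real_inner_comm, inner_gradient_left]
  have h1 := h.hasCompactSupport.hasFDerivAt_convolution_left (ContinuousLinearMap.lsmul ℝ ℝ)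
    (μ := volume) (h.contDiff.of_le (by simp)) hu.locallyIntegrable x
  rw [mollify_eq_convolution, h1.fderiv, convolution_eq_swap,
    ContinuousLinearMap.integral_apply]
  · refine integral_congr_ae (ae_of_all _ fun y => ?_)
    simp only [inner_smul_right]
    rw [real_inner_comm, inner_gradient_left]
    simp [mul_comm]
  · have h2 := ((h.hasCompactSupport.fderiv ℝ).convolutionExists_left
      ((ContinuousLinearMap.lsmul ℝ ℝ).precompL (RSpace n))
      (h.contDiff.continuous_fderiv (by simp)) hu.locallyIntegrable x).integrable_swap
    exact h2

/-- Since `∇κ` has integral zero, `u y` may be replaced by `u y - u x`, so only the oscillation of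
`u` at scale `r` matters. -/
theorem norm_gradient_mollify_le (h : IsMollifier κ r) {u : RSpace n → ℝ} (hu : Integrable u)
    {x : RSpace n} {A : ℝ} (hA : ∀ y, ‖x - y‖ ≤ r → |u x - u y| ≤ A) :
    ‖gradient (mollify κ u) x‖ ≤ A * ∫ y, ‖gradient κ y‖ := by
  have hi : Integrable (fun y => gradient κ (x - y)) := h.integrable_gradient.comp_sub_left x
  have h0 : ∫ y, u x • gradient κ (x - y) = 0 := by
    rw [integral_smul, integral_sub_left_eq_self (fun y => gradient κ y) volume x,
      integral_gradient_eq_zero h.contDiff h.hasCompactSupport, smul_zero]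
  have h1 : gradient (mollify κ u) x = ∫ y, (u y - u x) • gradient κ (x - y) := by
    simp only [sub_smul]
    have hi' : Integrable (fun y => u x • gradient κ (x - y)) := hi.smul (u x)
    rw [MeasureTheory.integral_sub (h.integrable_gradient_smul hu x) hi', h0, sub_zero,
      h.gradient_mollify_eq hu]
  rw [h1, ← integral_const_mul, ← integral_sub_left_eq_self (fun y => A * ‖gradient κ y‖) volume x]
  refine norm_integral_le_of_norm_le (hi.norm.const_mul A) (ae_of_all _ fun y => ?_)
  rw [norm_smul]
  by_cases hy : gradient κ (x - y) = 0
  · simp [hy]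
  · refine mul_le_mul_of_nonneg_right ?_ (norm_nonneg _)
    rw [Real.norm_eq_abs, abs_sub_comm]
    refine hA y ?_
    simpa using h.tsupport_subset (support_gradient_subset κ hy)

/-- `κ * f - f` is the `κ`-average of the differences `f(· - t) - f`; Tonelli's theorem moves the
`L¹` norm inside. -/
theorem lintegral_enorm_mollify_sub_le [CompleteSpace E] (h : IsMollifier κ r) {f : RSpace n → E}
    (hf : Integrable f) {ε : ℝ≥0∞}
    (hε : ∀ t : RSpace n, ‖t‖ ≤ r → ∫⁻ x, ‖f (x - t) - f x‖ₑ ≤ ε) :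
    ∫⁻ x, ‖mollify κ f x - f x‖ₑ ≤ ε := by
  have hrep : ∀ x, mollify κ f x - f x = ∫ t, κ t • (f (x - t) - f x) := by
    intro x
    have e1 : mollify κ f x = ∫ t, κ t • f (x - t) := by
      rw [mollify, ← integral_sub_left_eq_self _ volume x]
      simp
    have i1 : Integrable (fun t => κ t • f (x - t)) := by
      simpa using (h.integrable_smul hf x).comp_sub_left x
    simp only [smul_sub]
    rw [MeasureTheory.integral_sub i1 (h.integrable.smul_const _), integral_smul_const,
      h.integral_eq_one, one_smul, e1]
  have hmeas : AEMeasurable (Function.uncurry fun x t => ‖κ t • (f (x - t) - f x)‖ₑ)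
      ((volume : Measure (RSpace n)).prod volume) := by
    have m1 : AEStronglyMeasurable (fun p : RSpace n × RSpace n => f (p.1 - p.2))
        (volume.prod volume) :=
      hf.aestronglyMeasurable.comp_quasiMeasurePreserving (quasiMeasurePreserving_sub _ _)
    have m2 : AEStronglyMeasurable (fun p : RSpace n × RSpace n => f p.1)
        (volume.prod volume) := hf.aestronglyMeasurable.comp_fst
    exact ((h.contDiff.continuous.comp continuous_snd).aestronglyMeasurable.smul
      (m1.sub m2)).enorm
  calc ∫⁻ x, ‖mollify κ f x - f x‖ₑ
      ≤ ∫⁻ x, ∫⁻ t, ‖κ t • (f (x - t) - f x)‖ₑ := by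
        refine lintegral_mono fun x => ?_
        rw [hrep]
        exact enorm_integral_le_lintegral_enorm _
    _ = ∫⁻ t, ∫⁻ x, ‖κ t • (f (x - t) - f x)‖ₑ := lintegral_lintegral_swap hmeas
    _ ≤ ∫⁻ t, ‖κ t‖ₑ * ε := by
        refine lintegral_mono fun t => ?_
        simp only [enorm_smul]
        by_cases ht : κ t = 0
        · simp [ht]
        · rw [lintegral_const_mul' _ _ enorm_ne_top]
          exact mul_le_mul_right (hε t (h.norm_le t ht)) _
    _ = (∫⁻ t, ‖κ t‖ₑ) * ε := lintegral_mul_const'' _ h.integrable.aestronglyMeasurable.enorm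
    _ = ε := by
        have : ∫⁻ t, ‖κ t‖ₑ = 1 := by
          rw [← ofReal_integral_norm_eq_lintegral_enorm h.integrable]
          simp only [fun t => Real.norm_of_nonneg (h.nonneg t), h.integral_eq_one]
          simp
        rw [this, one_mul]

end IsMollifier

/-- Continuity of translations in `L¹`. -/
theorem tendsto_lintegral_enorm_comp_sub {n : ℕ} {E : Type*} [NormedAddCommGroup E]
    {f : RSpace n → E} (hf : Integrable f) :
    Tendsto (fun t : RSpace n => ∫⁻ x, ‖f (x - t) - f x‖ₑ) (𝓝 0) (𝓝 0) := by
  have hL : MemLp f 1 volume := memLp_one_iff_integrable.2 hf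
  -- Translations as a continuous family of continuous maps, the form in which composition is
  -- continuous into `L¹`.
  let g : C(RSpace n, C(RSpace n, RSpace n)) :=
    (ContinuousMap.mk (fun p : RSpace n × RSpace n => p.2 - p.1)
      (continuous_snd.sub continuous_fst)).curry
  have hg : ∀ t, MeasurePreserving (g t) volume volume := fun t =>
    measurePreserving_sub_right volume t
  have hcont : Continuous fun t => Lp.compMeasurePreserving (g t) (hg t) hL.toLp :=
    (continuous_const (y := hL.toLp)).compMeasurePreservingLp g.continuous hg ENNReal.one_ne_top
  have h0 : Tendsto (fun t => edist (Lp.compMeasurePreserving (g t) (hg t) hL.toLp)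
      hL.toLp) (𝓝 0) (𝓝 0) := by
    have h1 : Lp.compMeasurePreserving (g 0) (hg 0) hL.toLp = hL.toLp := by
      refine Lp.ext ?_
      filter_upwards [Lp.coeFn_compMeasurePreserving hL.toLp (hg 0)] with x hx
      rw [hx]
      simp [g]
    have h2 := (hcont.tendsto 0).edist (tendsto_const_nhds (x := hL.toLp))
    rwa [h1, edist_self] at h2
  refine h0.congr fun t => ?_
  rw [Lp.edist_def, eLpNorm_one_eq_lintegral_enorm]
  refine lintegral_congr_ae ?_
  filter_upwards [Lp.coeFn_compMeasurePreserving hL.toLp (hg t), hL.coeFn_toLp,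
    (hg t).quasiMeasurePreserving.ae hL.coeFn_toLp] with x h1 h2 h3
  rw [Pi.sub_apply, h1, h2, Function.comp_apply, h3]
  rfl

theorem IsMollifier.tendsto_lintegral_enorm_mollify_scale {n : ℕ} {κ : RSpace n → ℝ} {r : ℝ}
    {E : Type*} [NormedAddCommGroup E] [NormedSpace ℝ E] [CompleteSpace E]
    (h : IsMollifier κ r) {f : RSpace n → E} (hf : Integrable f) :
    Tendsto (fun δ : ℝ => ∫⁻ x, ‖mollify (fun x => (δ ^ n)⁻¹ * κ (δ⁻¹ • x)) f x - f x‖ₑ)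
      (𝓝[>] 0) (𝓝 0) := by
  rw [ENNReal.tendsto_nhds_zero]
  intro ε hε
  have h1 := (ENNReal.tendsto_nhds_zero.1 (tendsto_lintegral_enorm_comp_sub hf)) ε hε
  obtain ⟨ρ, hρ, hball⟩ := Metric.eventually_nhds_iff.1 h1
  have h2 : Tendsto (fun δ : ℝ => r * δ) (𝓝[>] 0) (𝓝 0) := by
    have : Tendsto (fun δ : ℝ => r * δ) (𝓝 0) (𝓝 (r * 0)) := (continuous_const_mul r).tendsto 0
    rw [mul_zero] at this
    exact this.mono_left nhdsWithin_le_nhds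
  filter_upwards [self_mem_nhdsWithin, h2.eventually (gt_mem_nhds hρ)] with δ hδ hδρ
  refine (h.scale hδ).lintegral_enorm_mollify_sub_le hf fun t ht => hball ?_
  rw [dist_zero_right]
  exact ht.trans_lt hδρ

/-! ### Weak gradients on the whole space -/

/-- `u` is in `W^{1,1}(ℝⁿ)` with weak gradient `G`. -/
structure HasWeakGrad {n : ℕ} (u : RSpace n → ℝ) (G : RSpace n → RSpace n) : Prop where
  integrable : Integrable u
  integrable_grad : Integrable G
  integral_eq : ∀ φ : RSpace n → ℝ, ContDiff ℝ ∞ φ → HasCompactSupport φ →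
    ∫ x, u x • gradient φ x = - ∫ x, φ x • G x

/-- `(u, G)` is the limit in `L¹` of pairs `(φ, ∇φ)` with test functions `φ`. -/
structure IsTestLimit {n : ℕ} (u : RSpace n → ℝ) (G : RSpace n → RSpace n) : Prop where
  integrable : Integrable u
  integrable_grad : Integrable G
  exists_seq : ∃ φ : ℕ → RSpace n → ℝ, (∀ k, ContDiff ℝ ∞ (φ k) ∧ HasCompactSupport (φ k)) ∧
    Tendsto (fun k => ∫⁻ x, ‖φ k x - u x‖ₑ) atTop (𝓝 0) ∧
    Tendsto (fun k => ∫⁻ x, ‖gradient (φ k) x - G x‖ₑ) atTop (𝓝 0)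

section

variable {n : ℕ} {u v : RSpace n → ℝ} {G H : RSpace n → RSpace n}

theorem exists_norm_le_of_test {φ : RSpace n → ℝ} (h1 : ContDiff ℝ ∞ φ)
    (h2 : HasCompactSupport φ) :
    ∃ C : ℝ, 0 ≤ C ∧ ∀ x, ‖φ x‖ ≤ C ∧ ‖gradient φ x‖ ≤ C := by
  obtain ⟨C, hC⟩ := h1.continuous.bounded_above_of_compact_support h2
  obtain ⟨D, hD⟩ := (continuous_gradient h1).bounded_above_of_compact_support h2.gradient
  exact ⟨max C D, ((norm_nonneg _).trans (hC 0)).trans (le_max_left _ _),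
    fun x => ⟨(hC x).trans (le_max_left _ _), (hD x).trans (le_max_right _ _)⟩⟩

theorem integrable_smul_gradient {μ : Measure (RSpace n)} (hu : Integrable u μ) {φ : RSpace n → ℝ}
    (h1 : ContDiff ℝ ∞ φ) (h2 : HasCompactSupport φ) :
    Integrable (fun x => u x • gradient φ x) μ := by
  obtain ⟨C, -, hC⟩ := exists_norm_le_of_test h1 h2
  exact hu.smul_bdd C (continuous_gradient h1).aestronglyMeasurable
    (ae_of_all _ fun x => (hC x).2)

theorem integrable_test_smul {μ : Measure (RSpace n)} (hG : Integrable G μ) {φ : RSpace n → ℝ}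
    (h1 : ContDiff ℝ ∞ φ) (h2 : HasCompactSupport φ) :
    Integrable (fun x => φ x • G x) μ := by
  obtain ⟨C, -, hC⟩ := exists_norm_le_of_test h1 h2
  exact hG.bdd_smul C h1.continuous.aestronglyMeasurable (ae_of_all _ fun x => (hC x).1)

namespace HasWeakGrad

theorem congr (h : HasWeakGrad u G) (huv : u =ᵐ[volume] v) (hGH : G =ᵐ[volume] H) :
    HasWeakGrad v H where
  integrable := h.integrable.congr huv
  integrable_grad := h.integrable_grad.congr hGH
  integral_eq φ h1 h2 := by
    have e1 : ∫ x, v x • gradient φ x = ∫ x, u x • gradient φ x :=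
      integral_congr_ae (by filter_upwards [huv] with x hx; rw [hx])
    have e2 : ∫ x, φ x • H x = ∫ x, φ x • G x :=
      integral_congr_ae (by filter_upwards [hGH] with x hx; rw [hx])
    rw [e1, e2, h.integral_eq φ h1 h2]

theorem add (hu : HasWeakGrad u G) (hv : HasWeakGrad v H) :
    HasWeakGrad (fun x => u x + v x) (fun x => G x + H x) where
  integrable := hu.integrable.add hv.integrable
  integrable_grad := hu.integrable_grad.add hv.integrable_grad
  integral_eq φ h1 h2 := by
    simp only [add_smul, smul_add]
    rw [integral_add (integrable_smul_gradient hu.integrable h1 h2)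
      (integrable_smul_gradient hv.integrable h1 h2),
      integral_add (integrable_test_smul hu.integrable_grad h1 h2)
      (integrable_test_smul hv.integrable_grad h1 h2), hu.integral_eq φ h1 h2,
      hv.integral_eq φ h1 h2, neg_add]

theorem neg (hu : HasWeakGrad u G) : HasWeakGrad (fun x => - u x) (fun x => - G x) where
  integrable := hu.integrable.neg
  integrable_grad := hu.integrable_grad.neg
  integral_eq φ h1 h2 := by
    simp only [neg_smul, smul_neg, integral_neg, hu.integral_eq φ h1 h2]

theorem zero : HasWeakGrad (fun _ : RSpace n => (0 : ℝ)) (fun _ => 0) where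
  integrable := integrable_zero _ _ _
  integrable_grad := integrable_zero _ _ _
  integral_eq φ _ _ := by simp

theorem sum {ι : Type*} (s : Finset ι) {u : ι → RSpace n → ℝ} {G : ι → RSpace n → RSpace n}
    (h : ∀ i ∈ s, HasWeakGrad (u i) (G i)) :
    HasWeakGrad (fun x => ∑ i ∈ s, u i x) (fun x => ∑ i ∈ s, G i x) := by
  classical
  induction s using Finset.induction_on with
  | empty => simpa using zero
  | insert a s ha ih =>
    simp only [Finset.sum_insert ha]
    exact (h a (Finset.mem_insert_self a s)).add
      (ih fun i hi => h i (Finset.mem_insert_of_mem hi))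

theorem of_tendsto {u' : ℕ → RSpace n → ℝ} {G' : ℕ → RSpace n → RSpace n}
    (h : ∀ k, HasWeakGrad (u' k) (G' k)) (hu : Integrable u) (hG : Integrable G)
    (h1 : Tendsto (fun k => ∫⁻ x, ‖u' k x - u x‖ₑ) atTop (𝓝 0))
    (h2 : Tendsto (fun k => ∫⁻ x, ‖G' k x - G x‖ₑ) atTop (𝓝 0)) : HasWeakGrad u G := by
  refine ⟨hu, hG, fun φ hφ hφc => ?_⟩
  obtain ⟨C, hC0, hC⟩ := exists_norm_le_of_test hφ hφc
  have key : ∀ f : ℕ → ℝ≥0∞, Tendsto f atTop (𝓝 0) →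
      Tendsto (fun k => f k * ENNReal.ofReal C) atTop (𝓝 0) := fun f hf => by
    simpa using ENNReal.Tendsto.mul_const hf (Or.inr ENNReal.ofReal_ne_top)
  have hCe : ∀ x, ‖φ x‖ₑ ≤ ENNReal.ofReal C ∧ ‖gradient φ x‖ₑ ≤ ENNReal.ofReal C := fun x => by
    simp only [← ofReal_norm]
    exact ⟨ENNReal.ofReal_le_ofReal (hC x).1, ENNReal.ofReal_le_ofReal (hC x).2⟩
  have t1 : Tendsto (fun k => ∫ x, u' k x • gradient φ x) atTop (𝓝 (∫ x, u x • gradient φ x)) := by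
    refine tendsto_integral_of_L1 _ (integrable_smul_gradient hu hφ hφc).aestronglyMeasurable
      (Eventually.of_forall fun k => integrable_smul_gradient (h k).integrable hφ hφc)
      (tendsto_of_tendsto_of_tendsto_of_le_of_le tendsto_const_nhds (key _ h1)
        (fun _ => zero_le) fun k => ?_)
    change _ ≤ (∫⁻ x, ‖u' k x - u x‖ₑ) * ENNReal.ofReal C
    rw [← lintegral_mul_const' _ _ ENNReal.ofReal_ne_top]
    refine lintegral_mono fun x => ?_
    rw [← sub_smul, enorm_smul]
    exact mul_le_mul_right (hCe x).2 _
  have t2 : Tendsto (fun k => ∫ x, φ x • G' k x) atTop (𝓝 (∫ x, φ x • G x)) := by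
    refine tendsto_integral_of_L1 _ (integrable_test_smul hG hφ hφc).aestronglyMeasurable
      (Eventually.of_forall fun k => integrable_test_smul (h k).integrable_grad hφ hφc)
      (tendsto_of_tendsto_of_tendsto_of_le_of_le tendsto_const_nhds (key _ h2)
        (fun _ => zero_le) fun k => ?_)
    change _ ≤ (∫⁻ x, ‖G' k x - G x‖ₑ) * ENNReal.ofReal C
    rw [← lintegral_mul_const' _ _ ENNReal.ofReal_ne_top]
    refine lintegral_mono fun x => ?_
    rw [← smul_sub, enorm_smul, mul_comm]
    exact mul_le_mul_right (hCe x).1 _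
  exact tendsto_nhds_unique (t1.congr fun k => (h k).integral_eq φ hφ hφc) t2.neg

/-- Continuously differentiable functions with compact support. -/
theorem of_contDiff {f : RSpace n → ℝ} (hf : ContDiff ℝ 1 f) (hc : HasCompactSupport f) :
    HasWeakGrad f (gradient f) := by
  have hgc : Continuous (gradient f) :=
    (InnerProductSpace.toDual ℝ (RSpace n)).symm.continuous.comp (hf.continuous_fderiv (by simp))
  have hi : Integrable f := hf.continuous.integrable_of_hasCompactSupport hc
  have hgi : Integrable (gradient f) := hgc.integrable_of_hasCompactSupport hc.gradient
  refine ⟨hi, hgi, fun φ h1 h2 => ext_inner_left ℝ fun v => ?_⟩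
  have i1 := integrable_smul_gradient hi h1 h2
  have i2 := integrable_test_smul hgi h1 h2
  rw [← integral_inner i1, inner_neg_right, ← integral_inner i2]
  have i1' := i1.const_inner (𝕜 := ℝ) v
  have i2' := i2.const_inner (𝕜 := ℝ) v
  simp only [inner_smul_right, inner_gradient_eq_fderiv] at i1' i2' ⊢
  rw [integral_mul_fderiv_eq_neg_fderiv_mul_of_integrable (μ := (volume : Measure (RSpace n)))
    (f := f) (g := φ) (v := v) (by simpa only [mul_comm] using i2') i1' ?_
    (fun x _ => hf.differentiable (by simp) x) (fun x _ => h1.differentiable (by simp) x)]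
  · simp only [mul_comm]
  · exact (hf.continuous.mul h1.continuous).integrable_of_hasCompactSupport hc.mul_right

theorem gradient_mollify (h : HasWeakGrad u G) {κ : RSpace n → ℝ} {r : ℝ} (hκ : IsMollifier κ r)
    (x : RSpace n) : gradient (mollify κ u) x = mollify κ G x := by
  rw [hκ.gradient_mollify_eq h.integrable, mollify]
  have hc : ContDiff ℝ ∞ (fun y => κ (x - y)) := hκ.contDiff.comp (contDiff_const.sub contDiff_id)
  have h1 := h.integral_eq (fun y => κ (x - y)) hc
    (hκ.hasCompactSupport.comp_homeomorph (Homeomorph.subLeft x))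
  simp only [gradient_comp_sub_left hκ.contDiff, smul_neg, integral_neg] at h1
  exact neg_injective h1

/-- The product rule. -/
theorem mul (h : HasWeakGrad u G) {θ : RSpace n → ℝ} (hθ : ContDiff ℝ ∞ θ)
    (h1 : Integrable (fun x => θ x * u x)) (h2 : Integrable (fun x => θ x • G x))
    (h3 : Integrable (fun x => u x • gradient θ x)) :
    HasWeakGrad (fun x => θ x * u x) (fun x => θ x • G x + u x • gradient θ x) := by
  refine ⟨h1, h2.add h3, fun φ hφ hφc => ?_⟩
  have hc : ContDiff ℝ ∞ (fun x => θ x * φ x) := hθ.mul hφ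
  have hcc : HasCompactSupport (fun x => θ x * φ x) := hφc.mul_left
  have hg : ∀ x, gradient (fun x => θ x * φ x) x = θ x • gradient φ x + φ x • gradient θ x := by
    intro x
    have := ((hθ.differentiable (by simp) x).hasFDerivAt.mul
      (hφ.differentiable (by simp) x).hasFDerivAt).fderiv
    simp only [gradient]
    rw [← map_smul, ← map_smul, ← map_add]
    exact congrArg _ this
  have e := h.integral_eq _ hc hcc
  have i2 := integrable_test_smul h2 hφ hφc
  have i3 := integrable_test_smul h3 hφ hφc
  have i1 := integrable_smul_gradient h1 hφ hφc
  simp only [smul_add]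
  rw [integral_add i2 i3]
  simp only [hg, smul_add, smul_smul] at e i1 i2 i3 ⊢
  rw [integral_add (by simpa only [smul_smul, smul_eq_mul, mul_comm] using i1)
    (by simpa only [smul_smul, smul_eq_mul, mul_comm] using i3)] at e
  have c1 : ∀ x, u x * θ x = θ x * u x := fun x => mul_comm _ _
  have c2 : ∀ x, u x * φ x = φ x * u x := fun x => mul_comm _ _
  have c3 : ∀ x, θ x * φ x = φ x * θ x := fun x => mul_comm _ _
  simp only [c1, c2, c3] at e
  rw [eq_sub_of_add_eq e]
  abel

theorem isWeakGradient {Ω : Set (RSpace n)} (h : HasWeakGrad u G) : IsWeakGradient Ω u G := by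
  refine ⟨(h.integrable.locallyIntegrable).locallyIntegrableOn _,
    (h.integrable_grad.locallyIntegrable).locallyIntegrableOn _, fun φ hφ => ?_⟩
  rw [setIntegral_eq_integral_of_forall_compl_eq_zero, setIntegral_eq_integral_of_forall_compl_eq_zero,
    h.integral_eq φ hφ.1 hφ.2.1]
  · intro x hx
    rw [image_eq_zero_of_notMem_tsupport fun h => hx (hφ.2.2 h), zero_smul]
  · intro x hx
    have : gradient φ x = 0 := by
      by_contra h0
      exact hx (hφ.2.2 (support_gradient_subset φ h0))
    rw [this, smul_zero]

end HasWeakGrad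

theorem IsWeakGradient.ae_eq {Ω : Set (RSpace n)} (hΩ : IsOpen Ω) (hG : IsWeakGradient Ω u G)
    (hH : IsWeakGradient Ω v H) (huv : u =ᵐ[volume.restrict Ω] v) :
    G =ᵐ[volume.restrict Ω] H := by
  have hint : ∀ {w : RSpace n → ℝ} {K : RSpace n → RSpace n}, IsWeakGradient Ω w K →
      ∀ φ ∈ TestFunctions Ω, Integrable (fun x => φ x • K x) := by
    intro w K hK φ hφ
    have i1 : IntegrableOn K (tsupport φ) :=
      hK.2.1.integrableOn_compact_subset hφ.2.2 hφ.2.1.isCompact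
    have i2 : IntegrableOn (fun x => φ x • K x) (tsupport φ) :=
      integrable_test_smul i1 hφ.1 hφ.2.1
    refine (integrableOn_iff_integrable_of_support_subset fun x hx => ?_).1 i2
    exact subset_tsupport φ fun h0 => hx (by simp [h0])
  have h1 := hΩ.ae_eq_zero_of_integral_contDiff_smul_eq_zero (μ := volume)
    (f := fun x => G x - H x) (hG.2.1.sub hH.2.1) ?_
  · rw [EventuallyEq, ae_restrict_iff' hΩ.measurableSet]
    filter_upwards [h1] with x hx hxΩ
    exact sub_eq_zero.1 (hx hxΩ)
  · intro φ h1 h2 h3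
    have hφ : φ ∈ TestFunctions Ω := ⟨h1, h2, h3⟩
    have hoff : ∀ x ∉ Ω, φ x = 0 := fun x hx =>
      image_eq_zero_of_notMem_tsupport fun h => hx (h3 h)
    have e : ∫ x in Ω, φ x • G x = ∫ x in Ω, φ x • H x := by
      refine neg_injective ?_
      rw [← hG.2.2 φ hφ, ← hH.2.2 φ hφ]
      exact integral_congr_ae (by filter_upwards [huv] with x hx; rw [hx])
    simp only [smul_sub]
    rw [integral_sub (hint hG φ hφ) (hint hH φ hφ),
      ← setIntegral_eq_integral_of_forall_compl_eq_zero (s := Ω) (fun x hx => by simp [hoff x hx]),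
      e, setIntegral_eq_integral_of_forall_compl_eq_zero (fun x hx => by simp [hoff x hx]),
      sub_self]

end

/-! ### Chain rule and truncation for limits of test functions -/

theorem exists_seq_tendsto_ae_of_tendsto_lintegral {α E : Type*} [MeasurableSpace α]
    {μ : Measure α} [NormedAddCommGroup E] {f : ℕ → α → E} {g : α → E}
    (hf : ∀ k, AEStronglyMeasurable (f k) μ) (hg : AEStronglyMeasurable g μ)
    (h : Tendsto (fun k => ∫⁻ x, ‖f k x - g x‖ₑ ∂μ) atTop (𝓝 0)) :
    ∃ ns : ℕ → ℕ, StrictMono ns ∧ ∀ᵐ x ∂μ, Tendsto (fun k => f (ns k) x) atTop (𝓝 (g x)) := by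
  refine (tendstoInMeasure_of_tendsto_eLpNorm (p := 1) one_ne_zero hf hg ?_).exists_seq_tendsto_ae
  simpa [eLpNorm_one_eq_lintegral_enorm] using h

theorem hasDerivAt_max_zero_sq (s : ℝ) :
    HasDerivAt (fun s : ℝ => (max s 0) ^ 2) (2 * max s 0) s := by
  rcases lt_trichotomy s 0 with h | rfl | h
  · rw [max_eq_right h.le, mul_zero]
    refine (hasDerivAt_const s (0 : ℝ)).congr_of_eventuallyEq ?_
    filter_upwards [eventually_lt_nhds h] with t ht
    simp [max_eq_right ht.le]
  · have : HasFDerivAt (fun s : ℝ => (max s 0) ^ 2) (0 : ℝ →L[ℝ] ℝ) 0 := by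
      refine Asymptotics.IsBigO.hasFDerivAt (n := 2) ?_ (by norm_num)
      refine Asymptotics.IsBigO.of_bound 1 (Eventually.of_forall fun t => ?_)
      simp only [norm_pow, Real.norm_eq_abs, sub_zero, one_mul, abs_abs]
      refine pow_le_pow_left₀ (abs_nonneg _) ?_ 2
      rw [abs_of_nonneg (le_max_right _ _)]
      exact max_le (le_abs_self t) (abs_nonneg t)
    simpa using this.hasDerivAt
  · rw [max_eq_left h.le]
    have := hasDerivAt_pow 2 s
    refine HasDerivAt.congr_of_eventuallyEq (by simpa using this) ?_
    filter_upwards [eventually_gt_nhds h] with t ht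
    simp [max_eq_left ht.le]

namespace IsTestLimit

variable {n : ℕ} {u : RSpace n → ℝ} {G : RSpace n → RSpace n}

theorem hasWeakGrad (h : IsTestLimit u G) : HasWeakGrad u G := by
  obtain ⟨φ, hφ, h1, h2⟩ := h.exists_seq
  exact HasWeakGrad.of_tendsto
    (fun k => HasWeakGrad.of_contDiff ((hφ k).1.of_le (by simp)) (hφ k).2)
    h.integrable h.integrable_grad h1 h2

theorem neg (h : IsTestLimit u G) : IsTestLimit (fun x => - u x) (fun x => - G x) := by
  obtain ⟨φ, hφ, h1, h2⟩ := h.exists_seq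
  refine ⟨h.integrable.neg, h.integrable_grad.neg, fun k x => - φ k x,
    fun k => ⟨(hφ k).1.neg, (hφ k).2.comp_left (g := Neg.neg) neg_zero⟩, h1.congr fun k => lintegral_congr fun x => ?_,
    h2.congr fun k => lintegral_congr fun x => ?_⟩
  · rw [← neg_sub', enorm_neg]
  · have : gradient (fun x => - φ k x) x = - gradient (φ k) x := by
      simp [gradient, fderiv_fun_neg]
    rw [this, ← neg_sub', enorm_neg]

/-- The chain rule. -/
theorem comp (h : IsTestLimit u G) {T T' : ℝ → ℝ} (hT : ∀ s, HasDerivAt T (T' s) s)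
    (hT' : Continuous T') (hT1 : ∀ s, |T' s| ≤ 1) (hT0 : T 0 = 0) :
    HasWeakGrad (fun x => T (u x)) (fun x => T' (u x) • G x) := by
  obtain ⟨φ, hφ, h1, h2⟩ := h.exists_seq
  have hlip : LipschitzWith 1 T :=
    lipschitzWith_of_nnnorm_deriv_le (fun s => (hT s).differentiableAt) fun s => by
      rw [(hT s).deriv]; exact_mod_cast hT1 s
  have hTc : Continuous T := hlip.continuous
  have hTle : ∀ a b, ‖T a - T b‖ ≤ ‖a - b‖ := fun a b => by
    have := hlip.dist_le_mul a b
    simpa [dist_eq_norm] using this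
  have hTC : ContDiff ℝ 1 T := by
    rw [contDiff_one_iff_deriv]
    refine ⟨fun s => (hT s).differentiableAt, ?_⟩
    rw [funext fun s => (hT s).deriv]
    exact hT'
  have hgr : ∀ k x, gradient (fun x => T (φ k x)) x = T' (φ k x) • gradient (φ k) x := by
    intro k x
    have := (hT (φ k x)).comp_hasFDerivAt x ((hφ k).1.differentiable (by simp) x).hasFDerivAt
    simp only [gradient]
    rw [← map_smul]
    exact congrArg _ this.fderiv
  have hm : ∀ k, AEStronglyMeasurable (φ k) volume := fun k =>
    (hφ k).1.continuous.aestronglyMeasurable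
  have hmg : ∀ k, AEStronglyMeasurable (gradient (φ k)) volume := fun k =>
    (continuous_gradient (hφ k).1).aestronglyMeasurable
  obtain ⟨ns, hns, hae⟩ := exists_seq_tendsto_ae_of_tendsto_lintegral hm
    h.integrable.aestronglyMeasurable h1
  obtain ⟨ms, hms, hae'⟩ := exists_seq_tendsto_ae_of_tendsto_lintegral (fun k => hmg (ns k))
    h.integrable_grad.aestronglyMeasurable (h2.comp hns.tendsto_atTop)
  have hum := h.integrable.aestronglyMeasurable
  have hG' : AEStronglyMeasurable (fun x => T' (u x) • G x) volume :=
    (hT'.comp_aestronglyMeasurable hum).smul h.integrable_grad.aestronglyMeasurable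
  refine HasWeakGrad.of_tendsto (u' := fun k x => T (φ (ns (ms k)) x))
    (G' := fun k => gradient (fun x => T (φ (ns (ms k)) x)))
    (fun k => HasWeakGrad.of_contDiff (hTC.comp ((hφ _).1.of_le (by simp)))
      ((hφ _).2.comp_left hT0)) ?_ ?_ ?_ ?_
  · refine h.integrable.mono (hTc.comp_aestronglyMeasurable hum) (ae_of_all _ fun x => ?_)
    simpa [hT0] using hTle (u x) 0
  · refine h.integrable_grad.mono hG' (ae_of_all _ fun x => ?_)
    rw [norm_smul]
    exact mul_le_of_le_one_left (norm_nonneg _) (hT1 _)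
  · refine tendsto_of_tendsto_of_tendsto_of_le_of_le tendsto_const_nhds
      (h1.comp (hns.comp hms).tendsto_atTop) (fun _ => zero_le) fun k => ?_
    exact lintegral_mono fun x => enorm_le_iff_norm_le.2 (hTle _ _)
  -- With `φ` the approximants, `T'(φ)∇φ - T'(u)G = T'(φ)(∇φ - G) + (T'(φ) - T'(u))G`. The first
  -- term tends to `0` in `L¹`; the second is at most `2|G|` and tends to `0` almost everywhere.
  · refine tendsto_lintegral_zero_of_le_add (H := fun x => ‖G x‖ₑ + ‖G x‖ₑ)
      (e := fun k x => ‖gradient (φ (ns (ms k))) x - G x‖ₑ) (fun k => ?_)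
      (h.integrable_grad.aestronglyMeasurable.enorm.add
        h.integrable_grad.aestronglyMeasurable.enorm) ?_
      (h2.comp (hns.comp hms).tendsto_atTop) (fun k => ae_of_all _ fun x => ?_) ?_
    · refine AEStronglyMeasurable.enorm (AEStronglyMeasurable.sub ?_ hG')
      rw [funext (hgr _)]
      exact (hT'.comp_aestronglyMeasurable (hm _)).smul (hmg _)
    · rw [lintegral_add_left' h.integrable_grad.aestronglyMeasurable.enorm]
      exact ENNReal.add_ne_top.2 ⟨h.integrable_grad.2.ne, h.integrable_grad.2.ne⟩
    · rw [hgr]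
      set g := gradient (φ (ns (ms k))) x
      have e : T' (φ (ns (ms k)) x) • g - T' (u x) • G x =
          T' (φ (ns (ms k)) x) • (g - G x) + (T' (φ (ns (ms k)) x) • G x - T' (u x) • G x) := by
        rw [smul_sub]; abel
      have l : ∀ (s : ℝ) (w : RSpace n), ‖T' s • w‖ₑ ≤ ‖w‖ₑ := fun s w => by
        refine enorm_le_iff_norm_le.2 ?_
        rw [norm_smul]
        exact mul_le_of_le_one_left (norm_nonneg _) (hT1 _)
      rw [e, add_comm]
      refine (enorm_add_le _ _).trans (add_le_add ?_ (l _ _))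
      exact (enorm_sub_le).trans (add_le_add (l _ _) (l _ _))
    · filter_upwards [hae, hae'] with x hx hx'
      have t1 := ((hT'.tendsto _).comp (hx.comp hms.tendsto_atTop)).smul hx'
      have t2 := (t1.sub (tendsto_const_nhds (x := T' (u x) • G x))).enorm
      rw [sub_self, enorm_zero] at t2
      refine t2.congr fun k => ?_
      rw [hgr]
      rfl

/-- The positive part is the limit of the regularizations `T k`, to which the chain rule applies.
The condition `0 ≤ c` ensures `T k 0 = 0`, and `T' k` tends to the indicator of `(c, ∞)`. -/
theorem posPart (h : IsTestLimit u G) {c : ℝ} (hc : 0 ≤ c) :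
    HasWeakGrad (fun x => max (u x - c) 0) ({x | c < u x}.indicator G) := by
  set ε : ℕ → ℝ := fun k => 1 / ((k : ℝ) + 1) with hε
  have hε0 : ∀ k, 0 < ε k := fun k => by positivity
  have hεt : Tendsto ε atTop (𝓝 0) := tendsto_one_div_add_atTop_nhds_zero_nat
  set T : ℕ → ℝ → ℝ := fun k s => √((max (s - c) 0) ^ 2 + ε k ^ 2) - ε k with hT
  set T' : ℕ → ℝ → ℝ := fun k s => max (s - c) 0 / √((max (s - c) 0) ^ 2 + ε k ^ 2) with hT'
  have hpos : ∀ k s, 0 < (max (s - c) 0) ^ 2 + ε k ^ 2 := fun k s => by have := hε0 k; positivity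
  have hspos : ∀ k s, 0 < √((max (s - c) 0) ^ 2 + ε k ^ 2) := fun k s => Real.sqrt_pos.2 (hpos k s)
  have hle : ∀ k s, max (s - c) 0 ≤ √((max (s - c) 0) ^ 2 + ε k ^ 2) := fun k s =>
    Real.le_sqrt_of_sq_le (by have := sq_nonneg (ε k); linarith)
  have hge : ∀ k s, √((max (s - c) 0) ^ 2 + ε k ^ 2) ≤ max (s - c) 0 + ε k := fun k s => by
    have h1 : 0 ≤ max (s - c) 0 := le_max_right _ _
    refine Real.sqrt_le_iff.2 ⟨by have := hε0 k; positivity, ?_⟩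
    nlinarith [hε0 k]
  have hderiv : ∀ k s, HasDerivAt (T k) (T' k s) s := by
    intro k s
    have h1 := ((hasDerivAt_max_zero_sq (s - c)).comp s ((hasDerivAt_id s).sub_const c))
    have h2 := ((h1.add_const (ε k ^ 2)).sqrt (hpos k s).ne').sub_const (ε k)
    refine h2.congr_deriv ?_
    simp only [hT', Function.comp_apply, id, mul_one]
    rw [mul_div_mul_left _ _ two_ne_zero]
  have hT'c : ∀ k, Continuous (T' k) := fun k => by
    refine Continuous.div (by fun_prop) (by fun_prop) fun s => (hspos k s).ne'
  have hT'1 : ∀ k s, |T' k s| ≤ 1 := fun k s => by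
    rw [abs_of_nonneg (div_nonneg (le_max_right _ _) (hspos k s).le)]
    exact (div_le_one (hspos k s)).2 (hle k s)
  have hT0 : ∀ k, T k 0 = 0 := fun k => by
    simp only [hT]
    rw [max_eq_right (by linarith), zero_pow two_ne_zero, zero_add, Real.sqrt_sq (hε0 k).le,
      sub_self]
  have hum := h.integrable.aestronglyMeasurable
  have hGm := h.integrable_grad.aestronglyMeasurable
  have hmax : ∀ s, max (s - c) 0 ≤ |s| := fun s =>
    max_le ((sub_le_self s hc).trans (le_abs_self s)) (abs_nonneg s)
  have hset : NullMeasurableSet {x | c < u x} volume :=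
    nullMeasurableSet_lt aemeasurable_const hum.aemeasurable
  have hmaxm : AEStronglyMeasurable (fun x => max (u x - c) 0) volume :=
    (by fun_prop : Continuous fun s : ℝ => max (s - c) 0).comp_aestronglyMeasurable hum
  refine HasWeakGrad.of_tendsto
    (fun k => h.comp (T := T k) (T' := T' k) (hderiv k) (hT'c k) (hT'1 k) (hT0 k)) ?_
    (h.integrable_grad.mono (hGm.indicator₀ hset)
      (ae_of_all _ fun x => norm_indicator_le_norm_self _ _)) ?_ ?_
  · refine h.integrable.mono hmaxm (ae_of_all _ fun x => ?_)
    rw [Real.norm_of_nonneg (le_max_right _ _)]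
    exact hmax _
  · refine tendsto_lintegral_zero_of_le_add (H := fun x => ‖u x‖ₑ) (e := fun _ _ => 0)
      (fun k => ?_) hum.enorm h.integrable.2.ne (by simp) (fun k => ae_of_all _ fun x => ?_)
      (ae_of_all _ fun x => ?_)
    · have : Continuous (T k) := continuous_iff_continuousAt.2 fun s => (hderiv k s).continuousAt
      exact ((this.comp_aestronglyMeasurable hum).sub hmaxm).enorm
    · rw [add_zero]
      refine enorm_le_iff_norm_le.2 ?_
      refine le_trans ?_ (hmax (u x))
      have h1 := hle k (u x)
      have h2 := hge k (u x)
      have h3 : √((max (u x - c) 0) ^ 2 + ε k ^ 2) ≥ ε k :=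
        Real.le_sqrt_of_sq_le (by have := sq_nonneg (max (u x - c) 0); linarith)
      rw [Real.norm_eq_abs, abs_le]
      simp only [hT]
      constructor <;> linarith
    · rw [← enorm_zero (E := ℝ)]
      refine Tendsto.enorm ?_
      refine squeeze_zero_norm (fun k => ?_) hεt
      have h1 := hle k (u x)
      have h2 := hge k (u x)
      rw [Real.norm_eq_abs, abs_le]
      simp only [hT]
      constructor <;> linarith
  · refine tendsto_lintegral_zero_of_le_add (H := fun x => ‖G x‖ₑ) (e := fun _ _ => 0)
      (fun k => ?_) hGm.enorm h.integrable_grad.2.ne (by simp) (fun k => ae_of_all _ fun x => ?_)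
      (ae_of_all _ fun x => ?_)
    · exact ((((hT'c k).comp_aestronglyMeasurable hum).smul hGm).sub (hGm.indicator₀ hset)).enorm
    · rw [add_zero]
      refine enorm_le_iff_norm_le.2 ?_
      by_cases hx : c < u x
      · have e : T' k (u x) • G x - G x = (T' k (u x) - 1) • G x := by rw [sub_smul, one_smul]
        rw [indicator_of_mem (by exact hx), e, norm_smul]
        refine mul_le_of_le_one_left (norm_nonneg _) ?_
        have h0 : 0 ≤ T' k (u x) := div_nonneg (le_max_right _ _) (hspos k _).le
        have h1 := (abs_le.1 (hT'1 k (u x))).2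
        rw [Real.norm_eq_abs, abs_le]
        constructor <;> linarith
      · rw [indicator_of_notMem (by exact hx), sub_zero, norm_smul]
        exact mul_le_of_le_one_left (norm_nonneg _) (hT'1 _ _)
    · rw [← enorm_zero (E := RSpace n)]
      refine Tendsto.enorm ?_
      by_cases hx : c < u x
      · rw [indicator_of_mem (by exact hx)]
        have h0 : 0 < u x - c := sub_pos.2 hx
        have hm : max (u x - c) 0 = u x - c := max_eq_left h0.le
        have t1 : Tendsto (fun k => T' k (u x)) atTop (𝓝 1) := by
          have t2 : Tendsto (fun k => (u x - c) / √((u x - c) ^ 2 + ε k ^ 2)) atTop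
              (𝓝 ((u x - c) / √((u x - c) ^ 2 + 0 ^ 2))) := by
            refine Tendsto.div tendsto_const_nhds ?_ ?_
            · exact ((hεt.pow 2).const_add _).sqrt
            · exact (Real.sqrt_pos.2 (by positivity)).ne'
          simp only [hT', hm]
          convert! t2 using 2
          rw [zero_pow two_ne_zero, add_zero, Real.sqrt_sq h0.le, div_self h0.ne']
        have t3 := (t1.smul (tendsto_const_nhds (x := G x))).sub (tendsto_const_nhds (x := G x))
        simpa using t3
      · rw [indicator_of_notMem (by exact hx)]
        have : ∀ k, T' k (u x) = 0 := fun k => by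
          simp only [hT']
          rw [max_eq_right (by linarith [not_lt.1 hx]), zero_div]
        simp [this]

/-- Truncation at the levels `±c`. -/
theorem truncate (h : IsTestLimit u G) {c : ℝ} (hc : 0 ≤ c) :
    HasWeakGrad (fun x => max (-c) (min c (u x))) ({x | |u x| ≤ c}.indicator G) := by
  -- The truncation is `u - (u - c)⁺ + (-u - c)⁺`.
  have h1 := (h.hasWeakGrad.add (h.posPart hc).neg).add (h.neg.posPart hc)
  refine h1.congr (ae_of_all _ fun x => ?_) (ae_of_all _ fun x => ?_)
  · simp only
    rcases le_total (u x) c with h1 | h1 <;> rcases le_total (-c) (u x) with h2 | h2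
    · rw [min_eq_right h1, max_eq_right h2, max_eq_right (by linarith), max_eq_right (by linarith)]
      ring
    · rw [min_eq_right h1, max_eq_left h2, max_eq_right (by linarith), max_eq_left (by linarith)]
      ring
    · rw [min_eq_left h1, max_eq_right (by linarith : -c ≤ c),
        max_eq_left (by linarith : 0 ≤ u x - c), max_eq_right (by linarith : - u x - c ≤ 0)]
      ring
    · rw [min_eq_left h1, max_eq_right (by linarith : -c ≤ c),
        max_eq_left (by linarith : 0 ≤ u x - c), max_eq_right (by linarith : - u x - c ≤ 0)]
      ring
  · simp only [indicator_apply, mem_ofPred_eq, abs_le]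
    by_cases h1 : c < u x
    · rw [if_pos h1, if_neg (by linarith), if_neg (fun h => by linarith [h.2])]
      simp
    · by_cases h2 : c < - u x
      · rw [if_neg h1, if_pos h2, if_neg (fun h => by linarith [h.1])]
        simp
      · rw [if_neg h1, if_neg h2, if_pos ⟨by linarith, by linarith⟩]
        simp

theorem nullMeasurableSet_abs_le (h : IsTestLimit u G) (c : ℝ) :
    NullMeasurableSet {x | |u x| ≤ c} volume :=
  nullMeasurableSet_le (h.integrable.aestronglyMeasurable.aemeasurable.abs) aemeasurable_const

/-- The gradient vanishes almost everywhere on the zero set. -/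
theorem ae_grad_eq_zero (h : IsTestLimit u G) : ∀ᵐ x, u x = 0 → G x = 0 := by
  -- Truncations at levels `ε k → 0` tend to `0`, while their gradients tend to `G` on `{u = 0}` and
  -- to `0` elsewhere. Uniqueness of the weak gradient of the zero function concludes.
  set ε : ℕ → ℝ := fun k => 1 / ((k : ℝ) + 1) with hε
  have hε0 : ∀ k, 0 < ε k := fun k => by positivity
  have hεt : Tendsto ε atTop (𝓝 0) := tendsto_one_div_add_atTop_nhds_zero_nat
  have hum := h.integrable.aestronglyMeasurable
  have hGm := h.integrable_grad.aestronglyMeasurable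
  have hset : NullMeasurableSet {x | |u x| ≤ 0} volume := h.nullMeasurableSet_abs_le 0
  have hlim : HasWeakGrad (fun _ => 0) ({x | |u x| ≤ 0}.indicator G) := by
    refine HasWeakGrad.of_tendsto (fun k => h.truncate (hε0 k).le) (integrable_zero _ _ _)
      (h.integrable_grad.mono (hGm.indicator₀ hset)
        (ae_of_all _ fun x => norm_indicator_le_norm_self _ _)) ?_ ?_
    · have hb : ∀ (k : ℕ) (s : ℝ), |max (-ε k) (min (ε k) s)| ≤ min (ε k) |s| := by
        intro k s
        have := hε0 k
        refine le_min (abs_le.2 ⟨le_max_left _ _, max_le (by linarith) (min_le_left _ _)⟩)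
          (abs_le.2 ⟨?_, max_le (by linarith [abs_nonneg s])
            ((min_le_right _ _).trans (le_abs_self s))⟩)
        rcases le_total s (-ε k) with h1 | h1
        · exact le_max_of_le_left (by linarith [neg_abs_le s])
        · refine le_max_of_le_right (le_min ?_ (neg_abs_le s))
          linarith [abs_nonneg s]
      refine tendsto_lintegral_zero_of_le_add (H := fun x => ‖u x‖ₑ) (e := fun _ _ => 0)
        (fun k => ?_) hum.enorm h.integrable.2.ne (by simp) (fun k => ae_of_all _ fun x => ?_)
        (ae_of_all _ fun x => ?_)
      · simp only [sub_zero]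
        exact ((by fun_prop : Continuous fun s : ℝ =>
          max (-ε k) (min (ε k) s)).comp_aestronglyMeasurable hum).enorm
      · rw [add_zero, sub_zero]
        exact enorm_le_iff_norm_le.2 ((hb k _).trans (min_le_right _ _))
      · rw [← enorm_zero (E := ℝ)]
        refine Tendsto.enorm (squeeze_zero_norm (fun k => ?_) hεt)
        rw [sub_zero]
        exact (hb k _).trans (min_le_left _ _)
    · refine tendsto_lintegral_zero_of_le_add (H := fun x => ‖G x‖ₑ) (e := fun _ _ => 0)
        (fun k => ?_) hGm.enorm h.integrable_grad.2.ne (by simp) (fun k => ae_of_all _ fun x => ?_)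
        (ae_of_all _ fun x => ?_)
      · exact ((hGm.indicator₀ (h.nullMeasurableSet_abs_le _)).sub (hGm.indicator₀ hset)).enorm
      · rw [add_zero]
        refine enorm_le_iff_norm_le.2 ?_
        simp only [indicator_apply, mem_ofPred_eq]
        split_ifs with h1 h2 h2
        · simp
        · simp
        · exact absurd (h2.trans (hε0 k).le) h1
        · simp
      · rw [← enorm_zero (E := RSpace n)]
        refine Tendsto.enorm ?_
        refine tendsto_const_nhds.congr' ?_
        simp only [indicator_apply, mem_ofPred_eq]
        rcases (abs_nonneg (u x)).eq_or_lt with h0 | h0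
        · refine Eventually.of_forall fun k => ?_
          simp only
          rw [if_pos (h0.symm.le.trans (hε0 k).le), if_pos h0.symm.le, sub_self]
        · filter_upwards [hεt.eventually (gt_mem_nhds h0)] with k hk
          rw [if_neg (not_le.2 hk), if_neg (not_le.2 h0), sub_self]
  have := (hlim.isWeakGradient (Ω := univ)).ae_eq isOpen_univ HasWeakGrad.zero.isWeakGradient
    EventuallyEq.rfl
  rw [Measure.restrict_univ] at this
  filter_upwards [this] with x hx hux
  rwa [indicator_of_mem (by simp [hux])] at hx

end IsTestLimit

/-- Functions in `W^{1,1}_0(Ω)`, extended by zero. -/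
theorem isTestLimit_of_mem_W110 {n : ℕ} {Ω : Set (RSpace n)} (hΩ : IsOpen Ω) {u : RSpace n → ℝ}
    (hu : u ∈ W110 Ω) : IsTestLimit (Ω.indicator u) (Ω.indicator (weakGradient Ω u)) := by
  obtain ⟨⟨h1, -, h2⟩, φ, hφ, h3, h4⟩ := hu
  have hms := hΩ.measurableSet
  refine ⟨(integrable_indicator_iff hms).2 h1, (integrable_indicator_iff hms).2 h2, φ,
    fun k => ⟨(hφ k).1, (hφ k).2.1⟩, ?_, ?_⟩
  · refine h3.congr fun k => ?_
    rw [eLpNorm_one_eq_lintegral_enorm, ← lintegral_indicator hms]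
    refine lintegral_congr fun x => ?_
    by_cases hx : x ∈ Ω
    · rw [indicator_of_mem hx, indicator_of_mem hx, enorm_sub_rev]
    · rw [indicator_of_notMem hx, indicator_of_notMem hx,
        image_eq_zero_of_notMem_tsupport fun h => hx ((hφ k).2.2 h)]
      simp
  · refine h4.congr fun k => ?_
    rw [eLpNorm_one_eq_lintegral_enorm, ← lintegral_indicator hms]
    refine lintegral_congr fun x => ?_
    by_cases hx : x ∈ Ω
    · rw [indicator_of_mem hx, indicator_of_mem hx, enorm_sub_rev]
    · have : gradient (φ k) x = 0 := by
        by_contra h0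
        exact hx ((hφ k).2.2 (support_gradient_subset _ h0))
      rw [indicator_of_notMem hx, indicator_of_notMem hx, this]
      simp

/-- A function whose weak gradient vanishes in a ball is constant there. -/
theorem HasWeakGrad.ae_eq_const {n : ℕ} {u : RSpace n → ℝ} {G : RSpace n → RSpace n}
    (h : HasWeakGrad u G) {p : RSpace n} {r : ℝ} (hr : 0 < r)
    (hG : ∀ᵐ x, x ∈ Metric.ball p r → G x = 0) :
    ∃ c, ∀ᵐ x, x ∈ Metric.ball p (r / 2) → u x = c := by
  obtain ⟨κ, hκ, -⟩ := IsMollifier.exists_center (0 : RSpace n)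
  rw [norm_zero, zero_add] at hκ
  set δ : ℕ → ℝ := fun k => (r / 2) * (1 / ((k : ℝ) + 1)) with hδ
  have hδ0 : ∀ k, 0 < δ k := fun k => by positivity
  have hδr : ∀ k, δ k ≤ r / 2 := fun k =>
    mul_le_of_le_one_right (by positivity) (by
      rw [div_le_one (by positivity)]; linarith [k.cast_nonneg (α := ℝ)])
  have hδt : Tendsto δ atTop (𝓝[>] 0) := by
    refine tendsto_nhdsWithin_iff.2 ⟨?_, Eventually.of_forall hδ0⟩
    simpa [hδ] using tendsto_one_div_add_atTop_nhds_zero_nat.const_mul (r / 2)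
  set κs : ℕ → RSpace n → ℝ := fun k x => (δ k ^ n)⁻¹ * κ ((δ k)⁻¹ • x) with hκs
  have hκk : ∀ k, IsMollifier (κs k) (1 * δ k) := fun k => hκ.scale (hδ0 k)
  obtain ⟨ns, hns, hae⟩ := exists_seq_tendsto_ae_of_tendsto_lintegral
    (fun k => ((hκk k).contDiff_mollify h.integrable).continuous.aestronglyMeasurable)
    h.integrable.aestronglyMeasurable
    ((hκ.tendsto_lintegral_enorm_mollify_scale h.integrable).comp hδt)
  -- On the half ball a mollification at scale `δ k ≤ r / 2` sees `G` only in the full ball, so its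
  -- gradient vanishes there. Its constancy passes to the almost everywhere limit.
  have hconst : ∀ k, ∀ x ∈ Metric.ball p (r / 2), ∀ y ∈ Metric.ball p (r / 2),
      mollify (κs k) u x = mollify (κs k) u y := by
    intro k x hx y hy
    have hd : Differentiable ℝ (mollify (κs k) u) :=
      ((hκk k).contDiff_mollify h.integrable).differentiable (by simp)
    refine Metric.isOpen_ball.is_const_of_fderiv_eq_zero
      (convex_ball p (r / 2)).isPreconnected hd.differentiableOn (fun z hz => ?_) hx hy
    rw [Pi.zero_apply, ← norm_eq_zero, ← norm_gradient, h.gradient_mollify (hκk k), norm_eq_zero]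
    refine integral_eq_zero_of_ae ?_
    filter_upwards [hG] with w hw
    by_cases hz0 : κs k (z - w) = 0
    · simp [hz0]
    · have h1 := (hκk k).norm_le _ hz0
      rw [one_mul] at h1
      have h2 : w ∈ Metric.ball p r := by
        rw [mem_ball_iff_norm] at hz ⊢
        have := norm_sub_le_norm_sub_add_norm_sub w z p
        rw [norm_sub_rev w z] at this
        linarith [hδr k]
      simp [hw h2]
  have hpos : volume (Metric.ball p (r / 2)) ≠ 0 := (Metric.measure_ball_pos _ _ (by positivity)).ne'
  obtain ⟨x₀, hx₀, hx₀t⟩ : ∃ x₀ ∈ Metric.ball p (r / 2), Tendsto (fun k =>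
      mollify (κs (ns k)) u x₀) atTop (𝓝 (u x₀)) := by
    by_contra! H
    exact hpos (measure_mono_null (fun x hx => H x hx) hae)
  refine ⟨u x₀, ?_⟩
  filter_upwards [hae] with x hx hxb
  exact tendsto_nhds_unique hx (hx₀t.congr fun k => hconst _ _ hx₀ _ hxb)

/-! ### Modular inequalities and `Δ₂` -/

section Modular

variable {n d : ℕ} {Ω : Set (RSpace n)} {M : RSpace n → RSpace d → ℝ}

/-- Midpoint convexity at `2a` and `2b`. This replaces the triangle inequality for modulars. -/
theorem IsWeakNFunction.ae_add_le (h : IsWeakNFunction Ω M) :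
    ∀ᵐ x ∂volume.restrict Ω, ∀ a b : RSpace d, ENNReal.ofReal (M x (a + b)) ≤
      ENNReal.ofReal (M x ((2 : ℝ) • a)) + ENNReal.ofReal (M x ((2 : ℝ) • b)) := by
  filter_upwards [h.convex, h.ae_nonneg] with x hx h0 a b
  rw [← ENNReal.ofReal_add (h0 _) (h0 _)]
  refine ENNReal.ofReal_le_ofReal ?_
  have := hx.2 (mem_univ ((2 : ℝ) • a)) (mem_univ ((2 : ℝ) • b)) (by norm_num : (0 : ℝ) ≤ 2⁻¹)
    (by norm_num : (0 : ℝ) ≤ 2⁻¹) (by norm_num)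
  simp only [smul_smul, smul_eq_mul] at this
  norm_num at this
  have h1 := h0 ((2 : ℝ) • a)
  have h2 := h0 ((2 : ℝ) • b)
  linarith

theorem IsWeakNFunction.ae_mono_smul (h : IsWeakNFunction Ω M) :
    ∀ᵐ x ∂volume.restrict Ω, ∀ (s t : ℝ) (ξ : RSpace d), 0 ≤ s → s ≤ t →
      M x (s • ξ) ≤ M x (t • ξ) := by
  filter_upwards [h.ae_smul_le, h.ae_nonneg, h.map_zero] with x hx h0 hz s t ξ hs hst
  rcases (hs.trans hst).eq_or_lt with ht | ht
  · rw [← ht, le_antisymm (hst.trans ht.symm.le) hs]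
  · have := hx (s / t) (by positivity) ((div_le_one ht).2 hst) (t • ξ)
    rw [smul_smul, div_mul_cancel₀ _ ht.ne'] at this
    exact this.trans (mul_le_of_le_one_left (h0 _) ((div_le_one ht).2 hst))

theorem IsWeakNFunction.lintegral_add_le (h : IsWeakNFunction Ω M) {a b : RSpace n → RSpace d}
    (ha : AEStronglyMeasurable a (volume.restrict Ω)) :
    ∫⁻ x in Ω, ENNReal.ofReal (M x (a x + b x)) ≤
      (∫⁻ x in Ω, ENNReal.ofReal (M x ((2 : ℝ) • a x))) +
        ∫⁻ x in Ω, ENNReal.ofReal (M x ((2 : ℝ) • b x)) := by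
  have hm : AEMeasurable (fun x => ENNReal.ofReal (M x ((2 : ℝ) • a x))) (volume.restrict Ω) :=
    (h.aemeasurable_comp (ha.const_smul (2 : ℝ))).ennreal_ofReal
  rw [← lintegral_add_left' hm]
  refine lintegral_mono_ae ?_
  filter_upwards [h.ae_add_le] with x hx
  exact hx _ _

/-- Iterates `Δ₂` until `2 ^ k` exceeds `l`. On `‖ξ‖ ≤ C`, where `Δ₂` gives no information, `M x
(2ξ)` is bounded by a constant, which is integrable because `Ω` has finite measure. -/
theorem DeltaTwo.exists_smul_le (hΔ : DeltaTwo Ω M) (h : IsWeakNFunction Ω M)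
    (hΩ : volume Ω ≠ ⊤) (l : ℝ) (hl : 0 ≤ l) :
    ∃ (c : ℝ≥0∞) (H : RSpace n → ℝ≥0∞), c ≠ ⊤ ∧ AEMeasurable H (volume.restrict Ω) ∧
      ∫⁻ x in Ω, H x ≠ ⊤ ∧ ∀ᵐ x ∂volume.restrict Ω, ∀ ξ,
        ENNReal.ofReal (M x (l • ξ)) ≤ c * ENNReal.ofReal (M x ξ) + H x := by
  obtain ⟨c, C, g, hc, hC, hg0, hg, hΔ⟩ := hΔ
  obtain ⟨b, hb0, hb⟩ := h.exists_bound (2 * C)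
  set H₁ : RSpace n → ℝ≥0∞ := fun x => ENNReal.ofReal (g x) + ENNReal.ofReal b with hH₁
  have hgm : AEMeasurable (fun x => ENNReal.ofReal (g x)) (volume.restrict Ω) :=
    hg.aestronglyMeasurable.aemeasurable.ennreal_ofReal
  have hH₁m : AEMeasurable H₁ (volume.restrict Ω) := hgm.add_const _
  have hH₁i : ∫⁻ x in Ω, H₁ x ≠ ⊤ := by
    rw [lintegral_add_left' hgm, lintegral_const, Measure.restrict_apply_univ]
    refine ENNReal.add_ne_top.2 ⟨?_, ENNReal.mul_ne_top ENNReal.ofReal_ne_top hΩ⟩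
    exact ((lintegral_ofReal_le_lintegral_enorm g).trans_lt hg.2).ne
  have base : ∀ᵐ x ∂volume.restrict Ω, ∀ ξ, ENNReal.ofReal (M x ((2 : ℝ) • ξ)) ≤
      ENNReal.ofReal c * ENNReal.ofReal (M x ξ) + H₁ x := by
    filter_upwards [hΔ, hb, h.ae_nonneg] with x h1 h2 h3 ξ
    rw [← ENNReal.ofReal_mul hc.le]
    rcases lt_or_ge C ‖ξ‖ with hξ | hξ
    · refine (ENNReal.ofReal_le_ofReal (h1 ξ hξ)).trans (ENNReal.ofReal_add_le.trans ?_)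
      exact add_le_add le_rfl le_self_add
    · refine (ENNReal.ofReal_le_ofReal (h2 _ ?_)).trans ?_
      · rw [norm_smul, Real.norm_two]; linarith
      · rw [hH₁, ← add_assoc]; exact le_add_self
  have iter : ∀ k : ℕ, ∃ (c : ℝ≥0∞) (H : RSpace n → ℝ≥0∞), c ≠ ⊤ ∧
      AEMeasurable H (volume.restrict Ω) ∧ ∫⁻ x in Ω, H x ≠ ⊤ ∧ ∀ᵐ x ∂volume.restrict Ω, ∀ ξ,
        ENNReal.ofReal (M x ((2 : ℝ) ^ k • ξ)) ≤ c * ENNReal.ofReal (M x ξ) + H x := by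
    intro k
    induction k with
    | zero => exact ⟨1, 0, ENNReal.one_ne_top, aemeasurable_const, by simp,
        ae_of_all _ fun x ξ => by simp⟩
    | succ k ih =>
      obtain ⟨c', H, hc', hHm, hHi, hH⟩ := ih
      refine ⟨ENNReal.ofReal c * c', fun x => ENNReal.ofReal c * H x + H₁ x,
        ENNReal.mul_ne_top ENNReal.ofReal_ne_top hc', (hHm.const_mul _).add hH₁m, ?_, ?_⟩
      · rw [lintegral_add_left' (hHm.const_mul _), lintegral_const_mul' _ _ ENNReal.ofReal_ne_top]
        exact ENNReal.add_ne_top.2 ⟨ENNReal.mul_ne_top ENNReal.ofReal_ne_top hHi, hH₁i⟩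
      · filter_upwards [base, hH] with x h1 h2 ξ
        rw [pow_succ', mul_smul]
        calc _ ≤ ENNReal.ofReal c * ENNReal.ofReal (M x ((2 : ℝ) ^ k • ξ)) + H₁ x := h1 _
          _ ≤ ENNReal.ofReal c * (c' * ENNReal.ofReal (M x ξ) + H x) + H₁ x :=
            add_le_add (mul_le_mul_right (h2 ξ) _) le_rfl
          _ = _ := by ring
  obtain ⟨k, hk⟩ := pow_unbounded_of_one_lt l (one_lt_two (α := ℝ))
  obtain ⟨c', H, hc', hHm, hHi, hH⟩ := iter k
  refine ⟨c', H, hc', hHm, hHi, ?_⟩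
  filter_upwards [hH, h.ae_mono_smul] with x h1 h2 ξ
  exact (ENNReal.ofReal_le_ofReal (h2 l _ ξ hl hk.le)).trans (h1 ξ)

theorem LM.lintegral_ne_top {G : RSpace n → RSpace d} (hG : G ∈ LM Ω M) (hΔ : DeltaTwo Ω M)
    (h : IsWeakNFunction Ω M) (hΩ : volume Ω ≠ ⊤) {l : ℝ} (hl : 0 ≤ l) :
    ∫⁻ x in Ω, ENNReal.ofReal (M x (l • G x)) ≠ ⊤ := by
  obtain ⟨hGm, l₀, hl₀, hfin⟩ := hG
  obtain ⟨c, H, hc, hHm, hHi, hH⟩ := hΔ.exists_smul_le h hΩ (l * l₀) (by positivity)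
  refine ne_top_of_le_ne_top (b := c * (∫⁻ x in Ω, ENNReal.ofReal (M x (l₀⁻¹ • G x))) +
    ∫⁻ x in Ω, H x) (ENNReal.add_ne_top.2 ⟨ENNReal.mul_ne_top hc hfin.ne, hHi⟩) ?_
  rw [← lintegral_const_mul' _ _ hc, ← lintegral_add_right' _ hHm]
  refine lintegral_mono_ae ?_
  filter_upwards [hH] with x hx
  have := hx (l₀⁻¹ • G x)
  rwa [smul_smul, mul_assoc, mul_inv_cancel₀ hl₀.ne', mul_one] at this

end Modular

/-! ### Modular approximation by mollification -/

/-- `u` and `G` can be approximated by test functions and their gradients, in `L¹` and in modular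
respectively. -/
def IsApprox {n : ℕ} (Ω : Set (RSpace n)) (M : RSpace n → RSpace n → ℝ) (u : RSpace n → ℝ)
    (G : RSpace n → RSpace n) : Prop :=
  ∀ l : ℝ, 0 < l → ∀ ε : ℝ≥0∞, 0 < ε → ∃ ψ ∈ TestFunctions Ω, ∫⁻ x in Ω, ‖ψ x - u x‖ₑ ≤ ε ∧
    ∫⁻ x in Ω, ENNReal.ofReal (M x (l • (gradient ψ x - G x))) ≤ ε

section Approx

variable {n : ℕ} {Ω : Set (RSpace n)} {M : RSpace n → RSpace n → ℝ}
  {u v : RSpace n → ℝ} {G H : RSpace n → RSpace n}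

/-- Approximation in two stages; doubling `l` and halving `ε` pays for the convexity substitute of
the triangle inequality. -/
theorem isApprox_of_forall_exists (hM : IsWeakNFunction Ω M)
    (h : ∀ l : ℝ, 0 < l → ∀ ε : ℝ≥0∞, 0 < ε → ∃ v H, IsApprox Ω M v H ∧
      AEStronglyMeasurable v (volume.restrict Ω) ∧ AEStronglyMeasurable H (volume.restrict Ω) ∧
      ∫⁻ x in Ω, ‖v x - u x‖ₑ ≤ ε ∧ ∫⁻ x in Ω, ENNReal.ofReal (M x (l • (H x - G x))) ≤ ε) :
    IsApprox Ω M u G := by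
  intro l hl ε hε
  have hε2 : 0 < ε / 2 := ENNReal.half_pos hε.ne'
  obtain ⟨v, H, hv, hvm, hHm, h1, h2⟩ := h (l * 2) (by positivity) (ε / 2) hε2
  obtain ⟨ψ, hψ, h3, h4⟩ := hv (l * 2) (by positivity) (ε / 2) hε2
  refine ⟨ψ, hψ, ?_, ?_⟩
  · rw [← ENNReal.add_halves ε]
    refine le_trans ?_ (add_le_add h3 h1)
    have hm : AEMeasurable (fun x => ‖ψ x - v x‖ₑ) (volume.restrict Ω) :=
      (hψ.1.continuous.aestronglyMeasurable.sub hvm).enorm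
    rw [← lintegral_add_left' hm]
    refine lintegral_mono fun x => ?_
    have := enorm_add_le (ψ x - v x) (v x - u x)
    rwa [sub_add_sub_cancel] at this
  · rw [← ENNReal.add_halves ε]
    refine le_trans ?_ (add_le_add h4 h2)
    have := hM.lintegral_add_le (a := fun x => l • (gradient ψ x - H x))
      (b := fun x => l • (H x - G x))
      (((continuous_gradient hψ.1).aestronglyMeasurable.sub hHm).const_smul l)
    simpa only [← smul_add, sub_add_sub_cancel, smul_smul, mul_comm (2 : ℝ) l] using this

theorem gradient_add_test {φ ψ : RSpace n → ℝ} (hφ : ContDiff ℝ ∞ φ) (hψ : ContDiff ℝ ∞ ψ)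
    (x : RSpace n) : gradient (fun x => φ x + ψ x) x = gradient φ x + gradient ψ x := by
  simp only [gradient]
  rw [← map_add, fderiv_fun_add (hφ.differentiable (by simp) x) (hψ.differentiable (by simp) x)]

theorem TestFunctions.add {φ ψ : RSpace n → ℝ} (hφ : φ ∈ TestFunctions Ω)
    (hψ : ψ ∈ TestFunctions Ω) : (fun x => φ x + ψ x) ∈ TestFunctions Ω :=
  ⟨hφ.1.add hψ.1, hφ.2.1.add hψ.2.1, (tsupport_add φ ψ).trans (union_subset hφ.2.2 hψ.2.2)⟩

theorem IsApprox.add (hM : IsWeakNFunction Ω M) (hu : IsApprox Ω M u G) (hv : IsApprox Ω M v H)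
    (hum : AEStronglyMeasurable u (volume.restrict Ω))
    (hGm : AEStronglyMeasurable G (volume.restrict Ω)) :
    IsApprox Ω M (fun x => u x + v x) (fun x => G x + H x) := by
  intro l hl ε hε
  have hε2 : 0 < ε / 2 := ENNReal.half_pos hε.ne'
  obtain ⟨φ, hφ, h1, h2⟩ := hu (l * 2) (by positivity) (ε / 2) hε2
  obtain ⟨ψ, hψ, h3, h4⟩ := hv (l * 2) (by positivity) (ε / 2) hε2
  refine ⟨_, TestFunctions.add hφ hψ, ?_, ?_⟩
  · rw [← ENNReal.add_halves ε]
    refine le_trans ?_ (add_le_add h1 h3)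
    have hm : AEMeasurable (fun x => ‖φ x - u x‖ₑ) (volume.restrict Ω) :=
      (hφ.1.continuous.aestronglyMeasurable.sub hum).enorm
    rw [← lintegral_add_left' hm]
    refine lintegral_mono fun x => ?_
    rw [add_sub_add_comm]
    exact enorm_add_le _ _
  · rw [← ENNReal.add_halves ε]
    refine le_trans ?_ (add_le_add h2 h4)
    have := hM.lintegral_add_le (a := fun x => l • (gradient φ x - G x))
      (b := fun x => l • (gradient ψ x - H x))
      (((continuous_gradient hφ.1).aestronglyMeasurable.sub hGm).const_smul l)
    simpa only [← smul_add, ← add_sub_add_comm, gradient_add_test hφ.1 hψ.1, smul_smul,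
      mul_comm (2 : ℝ) l] using this

theorem isApprox_zero (hM : IsWeakNFunction Ω M) : IsApprox Ω M (fun _ => 0) (fun _ => 0) := by
  intro l _ ε _
  refine ⟨fun _ => 0, ⟨contDiff_const, HasCompactSupport.zero, ?_⟩, by simp, ?_⟩
  · have : tsupport (fun _ : RSpace n => (0 : ℝ)) = ∅ := tsupport_eq_empty_iff.2 rfl
    rw [this]
    exact empty_subset _
  · rw [lintegral_congr_ae (g := fun _ => 0)]
    · simp
    · filter_upwards [hM.map_zero] with x hx
      simp [hx]

theorem IsApprox.sum (hM : IsWeakNFunction Ω M) {ι : Type*} (s : Finset ι)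
    {u : ι → RSpace n → ℝ} {G : ι → RSpace n → RSpace n}
    (h : ∀ i ∈ s, IsApprox Ω M (u i) (G i) ∧ AEStronglyMeasurable (u i) (volume.restrict Ω) ∧
      AEStronglyMeasurable (G i) (volume.restrict Ω)) :
    IsApprox Ω M (fun x => ∑ i ∈ s, u i x) (fun x => ∑ i ∈ s, G i x) := by
  classical
  induction s using Finset.induction_on with
  | empty => simpa using isApprox_zero hM
  | insert a s ha ih =>
    simp only [Finset.sum_insert ha]
    obtain ⟨h1, h2, h3⟩ := h a (Finset.mem_insert_self a s)
    exact h1.add hM (ih fun i hi => h i (Finset.mem_insert_of_mem hi)) h2 h3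

theorem IsApprox.congr (h : IsApprox Ω M u G) (huv : u =ᵐ[volume.restrict Ω] v)
    (hGH : G =ᵐ[volume.restrict Ω] H) : IsApprox Ω M v H := by
  intro l hl ε hε
  obtain ⟨ψ, hψ, h1, h2⟩ := h l hl ε hε
  refine ⟨ψ, hψ, (lintegral_congr_ae ?_).trans_le h1, (lintegral_congr_ae ?_).trans_le h2⟩
  · filter_upwards [huv] with x hx; rw [hx]
  · filter_upwards [hGH] with x hx; rw [hx]

/-- Under the balance condition the gradients of mollifications are bounded in modular by a
mollification. -/
theorem BalanceGen.exists_mollify_le {γ : ℝ} (hB : BalanceGen Ω γ M) (hΩ : IsOpen Ω)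
    (hM : IsWeakNFunction Ω M) (hu : HasWeakGrad u G) (hGΩ : ∀ x ∉ Ω, G x = 0)
    (hmod : ∀ l : ℝ, 0 ≤ l → ∫⁻ x in Ω, ENNReal.ofReal (M x (l • G x)) ≠ ⊤)
    {κ : RSpace n → ℝ} {R A δ₀ : ℝ} (hκ : IsMollifier κ R) (hR : 0 ≤ R) (hA : 0 ≤ A)
    (hosc : ∀ δ, 0 < δ → δ < δ₀ → ∀ x y, ‖x - y‖ ≤ R * δ → |u x - u y| ≤ A * δ ^ γ) :
    ∃ (s N : ℝ) (m : RSpace n → ℝ), 0 < s ∧ 0 ≤ N ∧ Integrable m ∧ ∀ δ, 0 < δ → δ < δ₀ →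
      (R + 2) * δ ≤ 1 → ∀ᵐ x ∂volume.restrict Ω,
        M x (s • gradient (mollify (fun x => (δ ^ n)⁻¹ * κ (δ⁻¹ • x)) u) x) ≤
          N + mollify (fun x => (δ ^ n)⁻¹ * κ (δ⁻¹ • x)) m x := by
  obtain ⟨κ₀, t, N, hκ₀, ht, hN, hav⟩ := hB.exists_average_le hΩ
  set D := ∫ x, ‖gradient κ x‖ with hD
  have hD0 : 0 ≤ D := integral_nonneg fun _ => norm_nonneg _
  -- `τ` is chosen so that `τ A D δ^(γ-1)`, which bounds the gradient of the mollified `τ u`, does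
  -- not exceed `t ((R + 2) δ)^(γ-1)`, the size allowed for averages on balls of radius `(R + 2) δ`.
  set τ := t * (R + 2) ^ (γ - 1) / (A * D + 1) with hτ
  have hτ0 : 0 < τ := by positivity
  have hGm := hu.integrable_grad.aestronglyMeasurable
  set m : RSpace n → ℝ := Ω.indicator fun y => M y (τ • G y) with hm
  have hmi : Integrable m := by
    rw [hm, integrable_indicator_iff hΩ.measurableSet]
    refine ⟨(hM.aemeasurable_comp (hGm.const_smul τ).restrict).aestronglyMeasurable, ?_⟩
    rw [HasFiniteIntegral, lintegral_congr_ae (g := fun x => ENNReal.ofReal (M x (τ • G x)))]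
    · exact (hmod τ hτ0.le).lt_top
    · filter_upwards [hM.ae_nonneg] with x hx
      rw [Real.enorm_of_nonneg (hx _)]
  refine ⟨κ₀ * τ, N, m, by positivity, hN, hmi, fun δ hδ hδ0 hδ1 => ?_⟩
  set κs : RSpace n → ℝ := fun x => (δ ^ n)⁻¹ * κ (δ⁻¹ • x) with hκs
  have hκδ : IsMollifier κs (R * δ) := hκ.scale hδ
  -- Only countably many balls are used, so the exceptional set stays null. A centre within `δ` of
  -- `x` suffices: its ball of radius `(R + 2) δ` contains the support of `κs (x - ·)`.
  have hall : ∀ᵐ x ∂volume.restrict Ω, ∀ k,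
      x ∈ Metric.ball (TopologicalSpace.denseSeq (RSpace n) k) ((R + 2) * δ) →
      ∀ (w : RSpace n → ℝ) (W : RSpace n → RSpace n),
      (∀ y, 0 ≤ w y) → Integrable w → ∫ y, w y = 1 →
      (∀ y, w y ≠ 0 → y ∈ Metric.ball (TopologicalSpace.denseSeq (RSpace n) k) ((R + 2) * δ)) →
      AEStronglyMeasurable W volume →
      (∀ y, y ∉ Ω → W y = 0) → Integrable (fun y => w y • W y) →
      Integrable (fun y => w y * Ω.indicator (fun y => M y (W y)) y) →
      ‖∫ y, w y • W y‖ ≤ t * ((R + 2) * δ) ^ (γ - 1) →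
      M x (κ₀ • ∫ y, w y • W y) ≤ N + ∫ y, w y * Ω.indicator (fun y => M y (W y)) y := by
    rw [ae_all_iff]
    intro k
    rw [← ae_restrict_iff' Metric.isOpen_ball.measurableSet,
      Measure.restrict_restrict Metric.isOpen_ball.measurableSet]
    exact hav _ _ (by positivity) hδ1
  filter_upwards [hall] with x hx
  obtain ⟨k, hk⟩ := (TopologicalSpace.denseRange_denseSeq (RSpace n)).exists_dist_lt x hδ
  set a := TopologicalSpace.denseSeq (RSpace n) k
  have e1 : ∫ y, κs (x - y) • (τ • G y) = τ • gradient (mollify κs u) x := by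
    rw [hu.gradient_mollify hκδ, mollify, ← integral_smul]
    simp only [smul_comm τ]
  have hgrad : ‖gradient (mollify κs u) x‖ ≤ A * D * δ ^ (γ - 1) := by
    have := hκδ.norm_gradient_mollify_le hu.integrable (x := x) (hosc δ hδ hδ0 x)
    rw [hκ.integral_norm_gradient_scale hδ] at this
    refine this.trans_eq ?_
    rw [Real.rpow_sub_one hδ.ne']
    ring
  have key := hx k ?_ (fun y => κs (x - y)) (fun y => τ • G y) (fun y => hκδ.nonneg _)
    (hκδ.integrable.comp_sub_left x) (hκδ.integral_sub x) ?_ (hGm.const_smul τ) ?_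
    (hκδ.integrable_smul (hu.integrable_grad.smul τ) x)
    (hκδ.integrable_smul hmi x) ?_
  · rw [e1, smul_smul] at key
    exact key
  · rw [Metric.mem_ball]
    nlinarith
  · intro y hy
    have := hκδ.norm_le _ hy
    rw [Metric.mem_ball]
    have h1 := dist_triangle y x a
    rw [dist_comm y x, dist_eq_norm x y] at h1
    nlinarith
  · intro y hy
    simp [hGΩ y hy]
  · rw [e1, norm_smul, Real.norm_of_nonneg hτ0.le, Real.mul_rpow (by positivity) hδ.le]
    calc τ * ‖gradient (mollify κs u) x‖ ≤ τ * ((A * D + 1) * δ ^ (γ - 1)) := by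
          refine mul_le_mul_of_nonneg_left (hgrad.trans ?_) hτ0.le
          have : 0 ≤ δ ^ (γ - 1) := by positivity
          nlinarith
      _ = t * ((R + 2) ^ (γ - 1) * δ ^ (γ - 1)) := by
          rw [hτ]
          have : A * D + 1 ≠ 0 := by positivity
          field_simp

/-- `hosc` supplies the gradient bound required by the balance condition, and `hsupp` keeps the
supports of the mollifications in `Ω`. -/
theorem isApprox_of_mollify {γ : ℝ} (hB : BalanceGen Ω γ M) (hΩ : IsOpen Ω)
    (hΩb : Bornology.IsBounded Ω) (hΔ : DeltaTwo Ω M)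
    (hM : IsWeakNFunction Ω M) (hu : HasWeakGrad u G) (hGΩ : ∀ x ∉ Ω, G x = 0)
    (hmod : ∀ l : ℝ, 0 ≤ l → ∫⁻ x in Ω, ENNReal.ofReal (M x (l • G x)) ≠ ⊤)
    {κ : RSpace n → ℝ} {R A δ₀ : ℝ} (hκ : IsMollifier κ R) (hR : 0 ≤ R) (hA : 0 ≤ A)
    (hδ₀ : 0 < δ₀)
    (hosc : ∀ δ, 0 < δ → δ < δ₀ → ∀ x y, ‖x - y‖ ≤ R * δ → |u x - u y| ≤ A * δ ^ γ)
    (hsupp : ∀ δ, 0 < δ → δ < δ₀ → closure {x | ∃ z, κ z ≠ 0 ∧ u (x - δ • z) ≠ 0} ⊆ Ω) :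
    IsApprox Ω M u G := by
  obtain ⟨s, N, m, hs, hN, hmi, hmain⟩ := hB.exists_mollify_le hΩ hM hu hGΩ hmod hκ hR hA hosc
  intro l hl ε hε
  have hΩfin : volume Ω ≠ ⊤ := hΩb.measure_lt_top.ne
  -- With `g` the mollified gradient, `l (g - G)` is `l · 2 s⁻¹` times `(s / 2)(g - G)`: `Δ₂`
  -- removes the outer factor, and convexity separates the rest into `s g` and `-s G`.
  obtain ⟨c, H, hc, hHm, hHi, hH⟩ := hΔ.exists_smul_le hM hΩfin (l * (2 * s⁻¹)) (by positivity)
  set b := min δ₀ (1 / (R + 2)) with hb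
  have hb0 : 0 < b := by positivity
  set δ : ℕ → ℝ := fun k => (b / 2) * (1 / ((k : ℝ) + 1)) with hδ
  have hδ0 : ∀ k, 0 < δ k := fun k => by positivity
  have hδb : ∀ k, δ k < b := fun k => by
    refine (mul_le_of_le_one_right (by positivity) ?_).trans_lt (half_lt_self hb0)
    rw [div_le_one (by positivity)]
    linarith [k.cast_nonneg (α := ℝ)]
  have hδ1 : ∀ k, δ k < δ₀ := fun k => (hδb k).trans_le (min_le_left _ _)
  have hδ2 : ∀ k, (R + 2) * δ k ≤ 1 := fun k => by
    have := (hδb k).le.trans (min_le_right _ _)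
    rw [le_div_iff₀ (by positivity)] at this
    linarith
  have hδt : Tendsto δ atTop (𝓝[>] 0) := by
    refine tendsto_nhdsWithin_iff.2 ⟨?_, Eventually.of_forall hδ0⟩
    simpa [hδ] using tendsto_one_div_add_atTop_nhds_zero_nat.const_mul (b / 2)
  set κs : ℕ → RSpace n → ℝ := fun k x => (δ k ^ n)⁻¹ * κ ((δ k)⁻¹ • x) with hκs
  have hκk : ∀ k, IsMollifier (κs k) (R * δ k) := fun k => hκ.scale (hδ0 k)
  have hsm : ∀ k, ContDiff ℝ ∞ (mollify (κs k) u) := fun k =>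
    (hκk k).contDiff_mollify hu.integrable
  have htest : ∀ k, mollify (κs k) u ∈ TestFunctions Ω := by
    intro k
    have hsub : tsupport (mollify (κs k) u) ⊆ Ω := by
      refine subset_trans (closure_mono fun x hx => ?_) (hsupp (δ k) (hδ0 k) (hδ1 k))
      obtain ⟨z, hz, huz⟩ := IsMollifier.exists_of_mollify_ne_zero (f := u) hx
      refine ⟨(δ k)⁻¹ • z, fun h0 => hz (by simp [hκs, h0]), ?_⟩
      rwa [smul_smul, mul_inv_cancel₀ (hδ0 k).ne', one_smul]
    exact ⟨hsm k, Metric.isCompact_of_isClosed_isBounded (isClosed_tsupport _) (hΩb.subset hsub),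
      hsub⟩
  have hgrad : ∀ k x, gradient (mollify (κs k) u) x = mollify (κs k) G x := fun k x =>
    hu.gradient_mollify (hκk k) x
  have hgm : ∀ k, AEStronglyMeasurable (gradient (mollify (κs k) u)) (volume.restrict Ω) :=
    fun k => (continuous_gradient (hsm k)).aestronglyMeasurable
  have hGm : AEStronglyMeasurable G (volume.restrict Ω) :=
    hu.integrable_grad.aestronglyMeasurable.restrict
  have hL : ∀ {E : Type} [NormedAddCommGroup E] [NormedSpace ℝ E] [CompleteSpace E]
      {f : RSpace n → E}, Integrable f →
      Tendsto (fun k => ∫⁻ x in Ω, ‖mollify (κs k) f x - f x‖ₑ) atTop (𝓝 0) := by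
    intro E _ _ _ f hf
    exact tendsto_of_tendsto_of_tendsto_of_le_of_le tendsto_const_nhds
      ((hκ.tendsto_lintegral_enorm_mollify_scale hf).comp hδt) (fun _ => zero_le)
      fun k => setLIntegral_le_lintegral _ _
  obtain ⟨ns, hns, hae⟩ := exists_seq_tendsto_ae_of_tendsto_lintegral hgm hGm
    ((hL hu.integrable_grad).congr fun k => by simp only [hgrad])
  have hmmeas : AEMeasurable (fun x => ‖m x‖ₑ) (volume.restrict Ω) :=
    hmi.aestronglyMeasurable.restrict.enorm
  have hGs : AEMeasurable (fun x => ENNReal.ofReal (M x (s • -G x))) (volume.restrict Ω) :=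
    (hM.aemeasurable_comp (hGm.neg.const_smul s)).ennreal_ofReal
  have hGs' : ∫⁻ x in Ω, ENNReal.ofReal (M x (s • -G x)) ≠ ⊤ := by
    rw [lintegral_congr_ae (g := fun x => ENNReal.ofReal (M x (s • G x)))]
    · exact hmod s hs.le
    · filter_upwards [hM.even] with x hx
      rw [hx, smul_neg, neg_neg]
  have hlim : Tendsto (fun k => ∫⁻ x in Ω,
      ENNReal.ofReal (M x (l • (gradient (mollify (κs (ns k)) u) x - G x)))) atTop (𝓝 0) := by
    refine tendsto_lintegral_zero_of_le_add
      (H := fun x => c * (ENNReal.ofReal N + ‖m x‖ₑ + ENNReal.ofReal (M x (s • -G x))) + H x)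
      (e := fun k x => c * ‖mollify (κs (ns k)) m x - m x‖ₑ) (fun k => ?_)
      (((((aemeasurable_const.add hmmeas).add hGs).const_mul c)).add hHm) ?_ ?_ (fun k => ?_) ?_
    · exact (hM.aemeasurable_comp (((hgm _).sub hGm).const_smul l)).ennreal_ofReal
    · rw [lintegral_add_right' _ hHm, lintegral_const_mul' _ _ hc, lintegral_add_right' _ hGs,
        lintegral_add_right' _ hmmeas, lintegral_const, Measure.restrict_apply_univ]
      refine ENNReal.add_ne_top.2 ⟨ENNReal.mul_ne_top hc (ENNReal.add_ne_top.2
        ⟨ENNReal.add_ne_top.2 ⟨ENNReal.mul_ne_top ENNReal.ofReal_ne_top hΩfin,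
          hmi.restrict.2.ne⟩, hGs'⟩), hHi⟩
    · simp only [lintegral_const_mul' _ _ hc]
      simpa using ENNReal.Tendsto.const_mul ((hL hmi).comp hns.tendsto_atTop) (Or.inr hc)
    · filter_upwards [hH, hM.ae_add_le,
        hmain (δ (ns k)) (hδ0 _) (hδ1 _) (hδ2 _)] with x h1 h2 h3
      set g := gradient (mollify (κs (ns k)) u) x
      have e := h1 ((s * 2⁻¹) • (g - G x))
      rw [smul_smul, show l * (2 * s⁻¹) * (s * 2⁻¹) = l by field_simp] at e
      refine e.trans ?_
      rw [add_right_comm, ← mul_add]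
      refine add_le_add (mul_le_mul_right ?_ c) le_rfl
      have e2 := h2 ((s * 2⁻¹) • g) ((s * 2⁻¹) • -G x)
      rw [← smul_add, ← sub_eq_add_neg, smul_smul, smul_smul,
        show 2 * (s * 2⁻¹) = s by field_simp] at e2
      refine e2.trans ?_
      rw [add_right_comm]
      refine add_le_add ?_ le_rfl
      have h3' : M x (s • g) ≤ N + mollify (κs (ns k)) m x := h3
      refine (ENNReal.ofReal_le_ofReal h3').trans (ENNReal.ofReal_add_le.trans ?_)
      rw [add_assoc]
      refine add_le_add le_rfl ?_
      rw [add_comm]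
      refine (Real.ofReal_le_enorm _).trans ?_
      have := enorm_add_le (mollify (κs (ns k)) m x - m x) (m x)
      rwa [sub_add_cancel] at this
    · filter_upwards [hae, hM.continuous_right, hM.map_zero] with x h1 h2 h3
      have t1 := ((h1.sub (tendsto_const_nhds (x := G x))).const_smul l)
      rw [sub_self, smul_zero] at t1
      have t2 := (h2.tendsto 0).comp t1
      rw [h3] at t2
      simpa using! ENNReal.tendsto_ofReal t2
  have hlim' := (hL hu.integrable).comp hns.tendsto_atTop
  obtain ⟨k, h1, h2⟩ := ((ENNReal.tendsto_nhds_zero.1 hlim' ε hε).and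
    (ENNReal.tendsto_nhds_zero.1 hlim ε hε)).exists
  exact ⟨_, htest (ns k), h1, h2⟩

end Approx

/-! ### Inward directions and the case `γ = 0` -/

section

open scoped Manifold

variable {n : ℕ} {Ω : Set (RSpace n)} {M : RSpace n → RSpace n → ℝ}
  {u v : RSpace n → ℝ} {G K : RSpace n → RSpace n}

/-- Near each point of the closure of a Lipschitz domain there is a direction that points
uniformly into the domain. -/
theorem IsBoundedLipschitzDomain.exists_inward (hΩ : IsBoundedLipschitzDomain Ω) {p : RSpace n}
    (hp : p ∈ closure Ω) : ∃ (U : Set (RSpace n)) (w : RSpace n), IsOpen U ∧ p ∈ U ∧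
      ∀ S, IsCompact S → S ⊆ U → ∃ δ₀ : ℝ, 0 < δ₀ ∧ ∀ δ : ℝ, 0 < δ → δ < δ₀ →
        closure {x | ∃ z, ‖z - w‖ ≤ 1 ∧ x - δ • z ∈ S ∩ Ω} ⊆ Ω := by
  by_cases hpΩ : p ∈ Ω
  · refine ⟨Ω, 0, hΩ.isOpen, hpΩ, fun S hS hSΩ => ?_⟩
    obtain ⟨r, hr, hrΩ⟩ := hS.exists_cthickening_subset_open hΩ.isOpen hSΩ
    refine ⟨r, hr, fun δ hδ hδr => (closure_minimal ?_ Metric.isClosed_cthickening).trans hrΩ⟩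
    rintro x ⟨z, hz, hx, -⟩
    refine Metric.mem_cthickening_of_dist_le x _ r S hx ?_
    rw [dist_eq_norm, sub_sub_cancel, norm_smul, Real.norm_of_nonneg hδ.le]
    rw [sub_zero] at hz
    nlinarith
  · have hpf : p ∈ frontier Ω := ⟨hp, by rwa [hΩ.isOpen.interior_eq]⟩
    obtain ⟨e, he, Λ, g, hg, U, hU, hgraph⟩ := hΩ.exists_graph p hpf
    have hee : inner ℝ e e = (1 : ℝ) := by rw [real_inner_self_eq_norm_sq, he, one_pow]
    -- If `‖z - (Λ + 2) e‖ ≤ 1`, the step `δ z` climbs at least `(Λ + 1) δ` along `e` and moves at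
    -- most `δ` sideways, where `g` changes by at most `Λ δ`. A clearance of at least `δ` above the
    -- graph remains.
    refine ⟨interior U, ((Λ : ℝ) + 2) • e, isOpen_interior, mem_interior_iff_mem_nhds.2 hU,
      fun S hS hSU => ?_⟩
    obtain ⟨r, hr, hrU⟩ := hS.exists_cthickening_subset_open isOpen_interior hSU
    have hΛ : (0 : ℝ) ≤ Λ := Λ.2
    refine ⟨r / (Λ + 3), by positivity, fun δ hδ hδr => ?_⟩
    rw [lt_div_iff₀ (by positivity)] at hδr
    have hcont : Continuous fun x : RSpace n => inner ℝ e x - g (x - inner ℝ e x • e) :=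
      (by fun_prop : Continuous fun x : RSpace n => (inner ℝ e x : ℝ)).sub
        (hg.continuous.comp (by fun_prop))
    have hclosed : IsClosed {x : RSpace n | δ ≤ inner ℝ e x - g (x - inner ℝ e x • e)} :=
      isClosed_le continuous_const hcont
    -- Clearance at least `δ` is a closed condition, so it survives the closure and still implies
    -- the strict inequality defining `Ω`.
    refine (closure_minimal (t := Metric.cthickening r S ∩
      {x : RSpace n | δ ≤ inner ℝ e x - g (x - inner ℝ e x • e)}) ?_
      (Metric.isClosed_cthickening.inter hclosed)).trans ?_
    · rintro x ⟨z, hz, hxS, hxΩ⟩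
      have hzn : ‖z‖ ≤ Λ + 3 := by
        have h1 := norm_add_le (z - ((Λ : ℝ) + 2) • e) (((Λ : ℝ) + 2) • e)
        rw [sub_add_cancel, norm_smul, he, mul_one, Real.norm_of_nonneg (by positivity)] at h1
        linarith
      refine ⟨Metric.mem_cthickening_of_dist_le x _ r S hxS ?_, ?_⟩
      · rw [dist_eq_norm, sub_sub_cancel, norm_smul, Real.norm_of_nonneg hδ.le]
        nlinarith
      · set y := x - δ • z with hy
        have hxy : x = y + δ • z := by rw [hy]; abel
        have hmy := (hgraph y (interior_subset (hSU hxS))).1 hxΩ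
        set q := z - ((Λ : ℝ) + 2) • e with hq
        have hzq : z = q + ((Λ : ℝ) + 2) • e := by rw [hq]; abel
        have hez : inner ℝ e z = inner ℝ e q + (Λ + 2) := by
          rw [hzq, inner_add_right, inner_smul_right, hee, mul_one]
        have heq : |(inner ℝ e q : ℝ)| ≤ 1 := by
          have := abs_real_inner_le_norm e q
          rw [he, one_mul] at this
          exact this.trans hz
        have hex : inner ℝ e x = inner ℝ e y + δ * inner ℝ e z := by
          rw [hxy, inner_add_right, inner_smul_right]
        have hperp : x - inner ℝ e x • e - (y - inner ℝ e y • e) = δ • (q - inner ℝ e q • e) := by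
          rw [hex, hez, hxy, hzq]
          module
        have hpn : ‖q - inner ℝ e q • e‖ ≤ 1 := by
          have h1 : ‖q - inner ℝ e q • e‖ ^ 2 ≤ 1 := by
            rw [norm_sub_sq_real, inner_smul_right, norm_smul, he, mul_one, real_inner_comm e q,
              Real.norm_eq_abs, sq_abs]
            have := norm_nonneg q
            nlinarith [sq_nonneg (inner ℝ e q : ℝ)]
          nlinarith [norm_nonneg (q - inner ℝ e q • e)]
        have hgl := hg.dist_le_mul (x - inner ℝ e x • e) (y - inner ℝ e y • e)
        rw [dist_eq_norm (x - _), hperp, norm_smul, Real.norm_of_nonneg hδ.le, Real.dist_eq] at hgl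
        have h2 : (Λ : ℝ) * (δ * ‖q - inner ℝ e q • e‖) ≤ Λ * δ :=
          mul_le_mul_of_nonneg_left (mul_le_of_le_one_right hδ.le hpn) hΛ
        have h3 := (abs_le.1 (hgl.trans h2)).2
        have h4 := (abs_le.1 heq).1
        simp only [mem_ofPred_eq]
        rw [hex, hez] at *
        nlinarith
    · rintro x ⟨hx1, hx2⟩
      refine (hgraph x (interior_subset (hrU hx1))).2 ?_
      have : δ ≤ inner ℝ e x - g (x - inner ℝ e x • e) := hx2
      linarith

/-- Serves both truncation arguments: the gradient error is `0` or `-G`, so by evenness `M x (l • G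
x)` is an integrable majorant. -/
theorem isApprox_of_indicator (hM : IsWeakNFunction Ω M) (hu : Integrable u) (hG : Integrable G)
    (hmod : ∀ l : ℝ, 0 ≤ l → ∫⁻ x in Ω, ENNReal.ofReal (M x (l • G x)) ≠ ⊤)
    {v : ℕ → RSpace n → ℝ} {S : ℕ → Set (RSpace n)} (hS : ∀ k, NullMeasurableSet (S k))
    (happ : ∀ k, IsApprox Ω M (v k) ((S k).indicator G))
    (hvm : ∀ k, AEStronglyMeasurable (v k) volume) (hvu : ∀ k x, |v k x - u x| ≤ |u x|)
    (hlim : ∀ x, Tendsto (fun k => v k x) atTop (𝓝 (u x)))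
    (hlimG : ∀ᵐ x ∂volume.restrict Ω, ∀ᶠ k in atTop, (S k).indicator G x = G x) :
    IsApprox Ω M u G := by
  refine isApprox_of_forall_exists hM fun l hl ε hε => ?_
  have hum := hu.aestronglyMeasurable
  have hGm := hG.aestronglyMeasurable
  have hSm : ∀ k, AEStronglyMeasurable ((S k).indicator G) volume := fun k =>
    hGm.indicator₀ (hS k)
  have t1 : Tendsto (fun k => ∫⁻ x in Ω, ‖v k x - u x‖ₑ) atTop (𝓝 0) := by
    refine tendsto_lintegral_zero_of_le_add (H := fun x => ‖u x‖ₑ) (e := fun _ _ => 0)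
      (fun k => ((hvm k).sub hum).restrict.enorm) hum.restrict.enorm hu.restrict.2.ne (by simp)
      (fun k => ae_of_all _ fun x => ?_) (ae_of_all _ fun x => ?_)
    · rw [add_zero]
      exact enorm_le_iff_norm_le.2 (hvu k x)
    · have := ((hlim x).sub (tendsto_const_nhds (x := u x))).enorm
      rwa [sub_self, enorm_zero] at this
  have t2 : Tendsto (fun k => ∫⁻ x in Ω, ENNReal.ofReal (M x (l • ((S k).indicator G x - G x))))
      atTop (𝓝 0) := by
    refine tendsto_lintegral_zero_of_le_add (H := fun x => ENNReal.ofReal (M x (l • G x)))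
      (e := fun _ _ => 0) (fun k => ?_) ?_ (hmod l hl.le) (by simp) (fun k => ?_) ?_
    · exact (hM.aemeasurable_comp (((hSm k).sub hGm).const_smul l).restrict).ennreal_ofReal
    · exact (hM.aemeasurable_comp (hGm.const_smul l).restrict).ennreal_ofReal
    · filter_upwards [hM.map_zero, hM.even] with x h0 heven
      rw [add_zero]
      by_cases hx : x ∈ S k
      · simp [indicator_of_mem hx, h0]
      · rw [indicator_of_notMem hx, zero_sub, smul_neg, ← heven]
    · filter_upwards [hM.map_zero, hlimG] with x h0 hx
      refine tendsto_const_nhds.congr' ?_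
      filter_upwards [hx] with k hk
      simp [hk, h0]
  obtain ⟨k, h1, h2⟩ := ((ENNReal.tendsto_nhds_zero.1 t1 ε hε).and
    (ENNReal.tendsto_nhds_zero.1 t2 ε hε)).exists
  exact ⟨_, _, happ k, (hvm k).restrict, (hSm k).restrict, h1, h2⟩

/-- For `γ = 0` the oscillation bound is just `2 c`, so boundedness survives as the only requirement
after multiplication by a cutoff. Each piece is mollified with a kernel centred at its own inward
vector. -/
theorem isApprox_of_bounded (hB : BalanceGen Ω 0 M) (hΩ : IsBoundedLipschitzDomain Ω)
    (hΔ : DeltaTwo Ω M) (hM : IsWeakNFunction Ω M) (hv : HasWeakGrad v K) {c : ℝ}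
    (hc : ∀ x, |v x| ≤ c) (hvΩ : ∀ x ∉ Ω, v x = 0) (hKΩ : ∀ x ∉ Ω, K x = 0)
    (hmod : ∀ l : ℝ, 0 ≤ l → ∫⁻ x in Ω, ENNReal.ofReal (M x (l • K x)) ≠ ⊤) :
    IsApprox Ω M v K := by
  have hc0 : 0 ≤ c := (abs_nonneg _).trans (hc 0)
  have hΩfin : volume Ω ≠ ⊤ := hΩ.isBounded.measure_lt_top.ne
  have hcpt : IsCompact (closure Ω) := hΩ.isBounded.isCompact_closure
  choose! U w hUo hpU hin using fun p (hp : p ∈ closure Ω) => hΩ.exists_inward hp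
  obtain ⟨t, ht⟩ := hcpt.elim_finite_subcover (fun p : closure Ω => U p)
    (fun p => hUo p p.2) fun p hp => mem_iUnion.2 ⟨⟨p, hp⟩, hpU p hp⟩
  obtain ⟨f, hf⟩ := SmoothPartitionOfUnity.exists_isSubordinate 𝓘(ℝ, RSpace n)
    (isClosed_closure (s := Ω)) (fun p : t => U p) (fun p => hUo p p.1.2)
    (ht.trans (by
      refine iUnion₂_subset fun p hp => ?_
      exact subset_iUnion (fun p : t => U p) ⟨p, hp⟩))
  have hsm : ∀ p, ContDiff ℝ ∞ (f p) := fun p => (f p).contMDiff.contDiff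
  have hle : ∀ p x, |f p x| ≤ 1 := fun p x => by
    rw [abs_of_nonneg (f.nonneg p x)]; exact f.le_one p x
  have hbd : ∀ p, ∃ D : ℝ, 0 ≤ D ∧ ∀ x ∈ Ω, ‖gradient (f p) x‖ ≤ D := by
    intro p
    obtain ⟨D, hD⟩ := hcpt.exists_bound_of_continuousOn (continuous_gradient (hsm p)).continuousOn
    exact ⟨max D 0, le_max_right _ _, fun x hx => (hD x (subset_closure hx)).trans (le_max_left _ _)⟩
  have hmain : ∀ p, HasWeakGrad (fun x => f p x * v x)
      (fun x => f p x • K x + v x • gradient (f p) x) := by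
    intro p
    obtain ⟨D, hD0, hD⟩ := hbd p
    refine hv.mul (hsm p) ?_ ?_ ?_
    · exact hv.integrable.bdd_mul (c := 1) (hsm p).continuous.aestronglyMeasurable
        (ae_of_all _ fun x => hle p x)
    · exact hv.integrable_grad.bdd_smul 1 (hsm p).continuous.aestronglyMeasurable
        (ae_of_all _ fun x => hle p x)
    · refine (hv.integrable.const_mul D).mono (hv.integrable.aestronglyMeasurable.smul
        (continuous_gradient (hsm p)).aestronglyMeasurable) (ae_of_all _ fun x => ?_)
      by_cases hx : x ∈ Ω
      · rw [norm_smul, norm_mul, mul_comm, Real.norm_of_nonneg hD0]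
        exact mul_le_mul_of_nonneg_right (hD x hx) (norm_nonneg _)
      · simp [hvΩ x hx]
  have happ : ∀ p, IsApprox Ω M (fun x => f p x * v x)
      (fun x => f p x • K x + v x • gradient (f p) x) := by
    intro p
    obtain ⟨D, hD0, hD⟩ := hbd p
    obtain ⟨κ, hκ, hκw⟩ := IsMollifier.exists_center (w p)
    obtain ⟨δ₀, hδ₀, hδ⟩ := hin p p.1.2 (tsupport (f p) ∩ closure Ω)
      (hcpt.inter_left (isClosed_tsupport _)) (inter_subset_left.trans (hf p))
    refine isApprox_of_mollify hB hΩ.isOpen hΩ.isBounded hΔ hM (hmain p)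
      (fun x hx => by simp [hvΩ x hx, hKΩ x hx]) (fun l hl => ?_) hκ (by positivity)
      (A := 2 * c) (by positivity) hδ₀ (fun δ _ _ x y _ => ?_) (fun δ h1 h2 => ?_)
    · obtain ⟨b, hb0, hb⟩ := hM.exists_bound (l * 2 * (c * D))
      have hKm := hv.integrable_grad.aestronglyMeasurable
      have hm1 : AEStronglyMeasurable (fun x => l • f p x • K x) (volume.restrict Ω) :=
        (((hsm p).continuous.aestronglyMeasurable.smul hKm).const_smul l).restrict
      -- Of the two terms of the product rule, `f p • K` is dominated by `K` because `f p ≤ 1`, and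
      -- `v • gradient (f p)` is bounded on `Ω`.
      refine ne_top_of_le_ne_top ?_ ((lintegral_congr fun x => by rw [smul_add]).trans_le
        (hM.lintegral_add_le (b := fun x => l • v x • gradient (f p) x) hm1))
      refine ENNReal.add_ne_top.2 ⟨?_, ?_⟩
      · refine ne_top_of_le_ne_top (hmod (l * 2) (by positivity)) (lintegral_mono_ae ?_)
        filter_upwards [hM.ae_mono_smul] with x hx
        refine ENNReal.ofReal_le_ofReal ?_
        rw [smul_smul, smul_smul]
        have h0 := f.nonneg p x
        have h1 := f.le_one p x
        refine hx _ _ _ (by positivity) ?_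
        rw [mul_comm 2 l]
        exact mul_le_of_le_one_right (by positivity) h1
      · refine ne_top_of_le_ne_top (b := ∫⁻ _ in Ω, ENNReal.ofReal b) ?_ (lintegral_mono_ae ?_)
        · rw [lintegral_const, Measure.restrict_apply_univ]
          exact ENNReal.mul_ne_top ENNReal.ofReal_ne_top hΩfin
        · filter_upwards [hb, ae_restrict_mem hΩ.isOpen.measurableSet] with x hx hxΩ
          refine ENNReal.ofReal_le_ofReal (hx _ ?_)
          rw [norm_smul, norm_smul, norm_smul, Real.norm_two, Real.norm_of_nonneg hl, mul_comm l 2,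
            mul_assoc]
          gcongr
          · exact hc x
          · exact hD x hxΩ
    · rw [Real.rpow_zero, mul_one]
      have hb : ∀ x, |f p x * v x| ≤ c := fun x => by
        rw [abs_mul]
        exact (mul_le_of_le_one_left (abs_nonneg _) (hle p x)).trans (hc x)
      refine (abs_sub _ _).trans ?_
      linarith [hb x, hb y]
    · refine (closure_mono ?_).trans (hδ δ h1 h2)
      rintro x ⟨z, hz, hvz⟩
      have hvz' := mul_ne_zero_iff.1 hvz
      have hΩz : x - δ • z ∈ Ω := by
        by_contra h
        exact hvz'.2 (hvΩ _ h)
      exact ⟨z, hκw z hz, ⟨subset_tsupport _ hvz'.1, subset_closure hΩz⟩, hΩz⟩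
  have hsum := IsApprox.sum hM Finset.univ (u := fun p x => f p x * v x)
    (G := fun p x => f p x • K x + v x • gradient (f p) x) fun p _ =>
      ⟨happ p, (hmain p).integrable.aestronglyMeasurable.restrict,
        (hmain p).integrable_grad.aestronglyMeasurable.restrict⟩
  have hwg := HasWeakGrad.sum Finset.univ (u := fun p x => f p x * v x)
    (G := fun p x => f p x • K x + v x • gradient (f p) x) fun p _ => hmain p
  have hveq : (fun x => ∑ p, f p x * v x) =ᵐ[volume.restrict Ω] v := by
    filter_upwards [ae_restrict_mem hΩ.isOpen.measurableSet] with x hx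
    rw [← Finset.sum_mul]
    have := f.sum_eq_one (subset_closure hx)
    rw [finsum_eq_sum_of_fintype] at this
    rw [this, one_mul]
  -- The gradients of the cutoffs need not be summed: the pieces add up to `v` on `Ω`, and
  -- uniqueness of weak gradients identifies the sum with `K`.
  exact hsum.congr hveq (hwg.isWeakGradient.ae_eq hΩ.isOpen hv.isWeakGradient hveq)

theorem IsTestLimit.isApprox_of_balance_zero (hB : BalanceGen Ω 0 M)
    (hΩ : IsBoundedLipschitzDomain Ω) (hΔ : DeltaTwo Ω M) (hM : IsWeakNFunction Ω M)
    (hu : IsTestLimit u G) (huΩ : ∀ x ∉ Ω, u x = 0) (hGΩ : ∀ x ∉ Ω, G x = 0)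
    (hmod : ∀ l : ℝ, 0 ≤ l → ∫⁻ x in Ω, ENNReal.ofReal (M x (l • G x)) ≠ ⊤) :
    IsApprox Ω M u G := by
  have hk0 : ∀ k : ℕ, (0 : ℝ) ≤ k := fun k => k.cast_nonneg
  have htr := fun k : ℕ => hu.truncate (hk0 k)
  have hev : ∀ x, ∀ᶠ k : ℕ in atTop, |u x| ≤ k := fun x =>
    tendsto_natCast_atTop_atTop.eventually_ge_atTop _
  have hin : ∀ (k : ℕ) (s : ℝ), |s| ≤ k → max (-(k : ℝ)) (min k s) = s := fun k s hs => by
    rw [min_eq_right (abs_le.1 hs).2, max_eq_right (abs_le.1 hs).1]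
  refine isApprox_of_indicator hM hu.integrable hu.integrable_grad hmod
    (v := fun (k : ℕ) x => max (-(k : ℝ)) (min k (u x))) (S := fun k => {x | |u x| ≤ k})
    (fun k => hu.nullMeasurableSet_abs_le k) (fun k => ?_)
    (fun k => (htr k).integrable.aestronglyMeasurable) (fun k x => ?_) (fun x => ?_)
    (ae_of_all _ fun x => ?_)
  · refine isApprox_of_bounded hB hΩ hΔ hM (htr k) (c := k) (fun x => ?_) (fun x hx => ?_)
      (fun x hx => ?_) (fun l hl => ?_)
    · have := hk0 k
      exact abs_le.2 ⟨le_max_left _ _, max_le (by linarith) (min_le_left _ _)⟩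
    · rw [huΩ x hx]
      exact hin k 0 (by simp)
    · rw [indicator_apply, hGΩ x hx, ite_self]
    · refine ne_top_of_le_ne_top (hmod l hl) (lintegral_mono_ae ?_)
      filter_upwards [hM.map_zero] with x hx
      rw [indicator_apply]
      split_ifs
      · exact le_rfl
      · simp [hx]
  · have := hk0 k
    rcases le_total |u x| k with h | h
    · rw [hin k _ h, sub_self, abs_zero]
      exact abs_nonneg _
    · rcases le_total 0 (u x) with h0 | h0
      · rw [abs_of_nonneg h0] at h ⊢
        rw [min_eq_left h, max_eq_right (by linarith), abs_le]
        constructor <;> linarith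
      · rw [abs_of_nonpos h0] at h ⊢
        rw [min_eq_right (by linarith), max_eq_left (by linarith), abs_le]
        constructor <;> linarith
  · refine tendsto_const_nhds.congr' ?_
    filter_upwards [hev x] with k hk
    rw [hin k _ hk]
  · filter_upwards [hev x] with k hk
    exact indicator_of_mem (by exact hk) _

end

/-! ### Boundary values and the Hölder case -/

section

variable {n : ℕ} {Ω : Set (RSpace n)} {M : RSpace n → RSpace n → ℝ}
  {u : RSpace n → ℝ} {G : RSpace n → RSpace n}

/-- The part below the graph, reached from `p` by moving against `e`. There the extension by zero
vanishes on an open set, which fixes the value of a function constant near `p`. -/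
theorem IsBoundedLipschitzDomain.exists_exterior (hΩ : IsBoundedLipschitzDomain Ω) {p : RSpace n}
    (hp : p ∈ frontier Ω) {ρ : ℝ} (hρ : 0 < ρ) :
    ∃ V : Set (RSpace n), IsOpen V ∧ V.Nonempty ∧ V ⊆ Metric.ball p ρ ∧ ∀ x ∈ V, x ∉ Ω := by
  obtain ⟨e, he, Λ, g, hg, U, hU, hgraph⟩ := hΩ.exists_graph p hp
  have hee : inner ℝ e e = (1 : ℝ) := by rw [real_inner_self_eq_norm_sq, he, one_pow]
  have hcont : Continuous fun x : RSpace n => inner ℝ e x - g (x - inner ℝ e x • e) :=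
    (by fun_prop : Continuous fun x : RSpace n => (inner ℝ e x : ℝ)).sub
      (hg.continuous.comp (by fun_prop))
  have hpΩ : p ∉ Ω := fun h => hp.2 (by rwa [hΩ.isOpen.interior_eq])
  have hpm : inner ℝ e p - g (p - inner ℝ e p • e) ≤ 0 := by
    have := mt (hgraph p (mem_of_mem_nhds hU)).2 hpΩ
    linarith [not_lt.1 this]
  obtain ⟨r, hr, hrU⟩ := Metric.mem_nhds_iff.1 hU
  refine ⟨Metric.ball p (min r ρ) ∩ {x | inner ℝ e x - g (x - inner ℝ e x • e) < 0},
    Metric.isOpen_ball.inter (isOpen_lt hcont continuous_const), ?_,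
    inter_subset_left.trans (Metric.ball_subset_ball (min_le_right _ _)), ?_⟩
  · set t := min r ρ / 2 with ht
    have ht0 : 0 < t := by positivity
    refine ⟨p - t • e, ?_, ?_⟩
    · rw [mem_ball_iff_norm, sub_sub_cancel_left, norm_neg, norm_smul, he, mul_one,
        Real.norm_of_nonneg ht0.le]
      exact half_lt_self (by positivity)
    · have h1 : inner ℝ e (p - t • e) = inner ℝ e p - t := by
        rw [inner_sub_right, inner_smul_right, hee, mul_one]
      have h2 : p - t • e - (inner ℝ e p - t) • e = p - inner ℝ e p • e := by module
      simp only [mem_ofPred_eq]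
      rw [h1, h2]
      linarith
  · rintro x ⟨hx1, hx2⟩ hxΩ
    have h1 := (hgraph x (hrU (Metric.ball_subset_ball (min_le_left _ _) hx1))).1 hxΩ
    have h2 : inner ℝ e x - g (x - inner ℝ e x • e) < 0 := hx2
    linarith

/-- Uniformly continuous functions in `W^{1,1}_0(Ω)` vanish at the boundary. -/
theorem IsTestLimit.isClosed_le_abs (hΩ : IsBoundedLipschitzDomain Ω) (hu : IsTestLimit u G)
    (huΩ : ∀ x ∉ Ω, u x = 0) (hGΩ : ∀ x ∉ Ω, G x = 0) (huc : UniformContinuousOn u Ω)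
    {ε : ℝ} (hε : 0 < ε) : IsClosed {x | ε ≤ |u x|} := by
  have hsub : {x | ε ≤ |u x|} ⊆ Ω := fun x hx => by
    by_contra h
    have hx' : ε ≤ |u x| := hx
    rw [huΩ x h, abs_zero] at hx'
    linarith
  refine isClosed_of_closure_subset fun p hp => ?_
  by_cases hpΩ : p ∈ Ω
  · have hcont : ContinuousAt (fun x => |u x|) p :=
      (huc.continuousOn.continuousAt (hΩ.isOpen.mem_nhds hpΩ)).abs
    by_contra hlt
    have h1 : ∀ᶠ x in 𝓝 p, |u x| < ε := hcont.eventually (gt_mem_nhds (not_le.1 hlt))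
    obtain ⟨x, hx1, hx2⟩ := ((mem_closure_iff_frequently.1 hp).and_eventually h1).exists
    exact absurd hx2 (not_lt.2 hx1)
  -- At a boundary point `p` of the closure, uniform continuity forces `|u| > ε / 2` in `Ω` near
  -- `p`. The truncation at `ε / 2` then has zero gradient near `p` and is constant across the
  -- boundary, although it is `0` outside `Ω` and `±ε / 2` inside.
  · exfalso
    have hpf : p ∈ frontier Ω := ⟨closure_mono hsub hp, by rwa [hΩ.isOpen.interior_eq]⟩
    obtain ⟨r, hr, hru⟩ := Metric.uniformContinuousOn_iff.1 huc (ε / 4) (by positivity)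
    obtain ⟨x₀, hx₀, hx₀p⟩ := Metric.mem_closure_iff.1 hp (r / 2) (by positivity)
    have hlarge : ∀ y ∈ Ω, y ∈ Metric.ball p (r / 2) → ε / 2 < |u y| := by
      intro y hy hyp
      have hd : dist x₀ y < r := by
        have := dist_triangle x₀ p y
        rw [dist_comm x₀ p, dist_comm p y] at this
        rw [Metric.mem_ball] at hyp
        linarith
      have h1 := hru x₀ (hsub hx₀) y hy hd
      rw [Real.dist_eq] at h1
      have h2 := abs_sub_abs_le_abs_sub (u x₀) (u y)
      have h3 : ε ≤ |u x₀| := hx₀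
      linarith
    obtain ⟨c, hc⟩ := (hu.truncate (c := ε / 2) (by positivity)).ae_eq_const (p := p)
      (r := r / 2) (by positivity) (ae_of_all _ fun y hy => by
        rw [indicator_apply]
        split_ifs with h
        · by_cases hyΩ : y ∈ Ω
          · exact absurd h (not_le.2 (hlarge y hyΩ hy))
          · exact hGΩ y hyΩ
        · rfl)
    have hdense := Measure.dense_of_ae hc
    obtain ⟨V, hVo, hVne, hVb, hVΩ⟩ := hΩ.exists_exterior hpf (ρ := r / 2 / 2) (by positivity)
    obtain ⟨y, hyV, hy⟩ := hdense.exists_mem_open hVo hVne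
    have hy0 := hyV (hVb hy)
    simp only [huΩ y (hVΩ y hy)] at hy0
    rw [min_eq_right (by positivity), max_eq_right (by linarith)] at hy0
    have hne : (Ω ∩ Metric.ball p (r / 2 / 2)).Nonempty := by
      obtain ⟨z, hz, hzp⟩ := Metric.mem_closure_iff.1 hpf.1 (r / 2 / 2) (by positivity)
      exact ⟨z, hz, by rwa [Metric.mem_ball, dist_comm]⟩
    obtain ⟨z, hzV, hzΩ, hzb⟩ := hdense.exists_mem_open (hΩ.isOpen.inter Metric.isOpen_ball) hne
    have hz0 := hzV hzb
    have hzl := hlarge z hzΩ (Metric.ball_subset_ball (by linarith) hzb)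
    simp only [← hy0] at hz0
    rcases le_total 0 (u z) with h0 | h0
    · rw [abs_of_nonneg h0] at hzl
      rw [min_eq_left hzl.le, max_eq_right (by linarith)] at hz0
      linarith
    · rw [abs_of_nonpos h0] at hzl
      rw [min_eq_right (by linarith), max_eq_left (by linarith)] at hz0
      linarith

theorem abs_truncate_le {c : ℝ} (hc : 0 ≤ c) (s : ℝ) :
    |max (-c) (min c s)| ≤ c ∧ |max (-c) (min c s)| ≤ |s| := by
  refine ⟨abs_le.2 ⟨le_max_left _ _, max_le (by linarith) (min_le_left _ _)⟩,
    abs_le.2 ⟨?_, max_le (by linarith [abs_nonneg s]) ((min_le_right _ _).trans (le_abs_self s))⟩⟩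
  rcases le_total s (-c) with h1 | h1
  · exact le_max_of_le_left (by linarith [neg_abs_le s])
  · exact le_max_of_le_right (le_min (by linarith [abs_nonneg s]) (neg_abs_le s))

theorem abs_sub_truncate_sub_le (c a b : ℝ) :
    |(a - max (-c) (min c a)) - (b - max (-c) (min c b))| ≤ |a - b| := by
  wlog hab : a ≤ b generalizing a b
  · rw [abs_sub_comm, abs_sub_comm a b]
    exact this b a (le_of_not_ge hab)
  have h1 : max (-c) (min c a) ≤ max (-c) (min c b) := max_le_max le_rfl (min_le_min le_rfl hab)
  have h2 : max (-c) (min c b) ≤ max (-c) (min c a) + (b - a) := by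
    refine max_le (by linarith [le_max_left (-c) (min c a)]) ?_
    have : min c b ≤ min c a + (b - a) := by
      rw [← min_add_add_right]
      exact le_min ((min_le_left _ _).trans (by linarith)) ((min_le_right _ _).trans (by linarith))
    linarith [le_max_right (-c) (min c a)]
  rw [abs_sub_comm a b, abs_of_nonneg (sub_nonneg.2 hab), abs_le]
  constructor <;> linarith

/-- Subtracting the truncation at level `ε k` leaves a function supported in the compact set `{ε k ≤
|u|}` inside `Ω` and no more oscillating than `u`. A kernel centred at the origin therefore
suffices, without cutoffs. -/
theorem IsTestLimit.isApprox_of_holder {γ : ℝ} (hγ : 0 < γ) (hB : BalanceGen Ω γ M)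
    (hΩ : IsBoundedLipschitzDomain Ω) (hΔ : DeltaTwo Ω M) (hM : IsWeakNFunction Ω M)
    (hu : IsTestLimit u G) (huΩ : ∀ x ∉ Ω, u x = 0) (hGΩ : ∀ x ∉ Ω, G x = 0)
    (hmod : ∀ l : ℝ, 0 ≤ l → ∫⁻ x in Ω, ENNReal.ofReal (M x (l • G x)) ≠ ⊤)
    {C : NNReal} (huH : HolderOnWith C γ.toNNReal u Ω) :
    IsApprox Ω M u G := by
  have huc : UniformContinuousOn u Ω := huH.uniformContinuousOn (Real.toNNReal_pos.2 hγ)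
  set ε : ℕ → ℝ := fun k => 1 / ((k : ℝ) + 1) with hε
  have hε0 : ∀ k, 0 < ε k := fun k => by positivity
  have hεt : Tendsto ε atTop (𝓝 0) := tendsto_one_div_add_atTop_nhds_zero_nat
  have hwg : ∀ k, HasWeakGrad (fun x => u x - max (-ε k) (min (ε k) (u x)))
      ({x | |u x| ≤ ε k}ᶜ.indicator G) := by
    intro k
    refine (hu.hasWeakGrad.add (hu.truncate (hε0 k).le).neg).congr
      (ae_of_all _ fun x => (sub_eq_add_neg _ _).symm) (ae_of_all _ fun x => ?_)
    by_cases hx : x ∈ {x | |u x| ≤ ε k}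
    · simp only [indicator_of_mem hx, indicator_of_notMem (notMem_compl_iff.2 hx)]
      exact add_neg_cancel _
    · simp only [indicator_of_notMem hx, indicator_of_mem (mem_compl hx)]
      rw [neg_zero, add_zero]
  refine isApprox_of_indicator hM hu.integrable hu.integrable_grad hmod
    (v := fun k x => u x - max (-ε k) (min (ε k) (u x))) (S := fun k => {x | |u x| ≤ ε k}ᶜ)
    (fun k => (hu.nullMeasurableSet_abs_le _).compl) (fun k => ?_)
    (fun k => (hwg k).integrable.aestronglyMeasurable) (fun k x => ?_) (fun x => ?_) ?_
  · have hv0 : ∀ x, ¬ ε k ≤ |u x| → u x - max (-ε k) (min (ε k) (u x)) = 0 := by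
      intro x hx
      have := abs_lt.1 (not_le.1 hx)
      rw [min_eq_right this.2.le, max_eq_right this.1.le, sub_self]
    have hsub : {x | ε k ≤ |u x|} ⊆ Ω := fun x hx => by
      by_contra h
      have hx' : ε k ≤ |u x| := hx
      rw [huΩ x h, abs_zero] at hx'
      linarith [hε0 k]
    have hcpt : IsCompact {x | ε k ≤ |u x|} := Metric.isCompact_of_isClosed_isBounded
      (hu.isClosed_le_abs hΩ huΩ hGΩ huc (hε0 k)) (hΩ.isBounded.subset hsub)
    obtain ⟨r, hr, hrΩ⟩ := hcpt.exists_cthickening_subset_open hΩ.isOpen hsub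
    obtain ⟨κ, hκ, -⟩ := IsMollifier.exists_center (0 : RSpace n)
    rw [norm_zero, zero_add] at hκ
    -- The Hölder bound is available only in `Ω`; `δ < r` puts `y` in `Ω` as soon as `x` lies in the
    -- superlevel set. If neither point lies there, both values are `0`.
    have hosc : ∀ δ, 0 < δ → δ < r → ∀ x y, ‖x - y‖ ≤ 1 * δ → ε k ≤ |u x| →
        |(u x - max (-ε k) (min (ε k) (u x))) - (u y - max (-ε k) (min (ε k) (u y)))| ≤
          C * δ ^ γ := by
      intro δ hδ hδr x y hxy hx
      have hyΩ : y ∈ Ω := hrΩ (Metric.mem_cthickening_of_dist_le y x r _ hx (by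
        rw [dist_comm, dist_eq_norm]; linarith))
      refine (abs_sub_truncate_sub_le _ _ _).trans ?_
      have := huH.dist_le (hsub hx) hyΩ
      rw [Real.coe_toNNReal _ hγ.le, Real.dist_eq] at this
      refine this.trans (mul_le_mul_of_nonneg_left ?_ C.2)
      rw [dist_eq_norm]
      exact Real.rpow_le_rpow (norm_nonneg _) (by linarith) hγ.le
    refine isApprox_of_mollify hB hΩ.isOpen hΩ.isBounded hΔ hM (hwg k)
      (fun x hx => by rw [indicator_apply, hGΩ x hx, ite_self]) (fun l hl => ?_) hκ zero_le_one
      (A := C) C.2 hr (fun δ h1 h2 x y hxy => ?_) (fun δ h1 h2 => ?_)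
    · refine ne_top_of_le_ne_top (hmod l hl) (lintegral_mono_ae ?_)
      filter_upwards [hM.map_zero] with x hx
      rw [indicator_apply]
      split_ifs
      · exact le_rfl
      · simp [hx]
    · by_cases hx : ε k ≤ |u x|
      · exact hosc δ h1 h2 x y hxy hx
      by_cases hy : ε k ≤ |u y|
      · rw [abs_sub_comm]
        exact hosc δ h1 h2 y x (by rwa [norm_sub_rev]) hy
      · rw [hv0 x hx, hv0 y hy, sub_self, abs_zero]
        have := C.2
        positivity
    · refine (closure_minimal ?_ Metric.isClosed_cthickening).trans hrΩ
      rintro x ⟨z, hz, hvz⟩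
      refine Metric.mem_cthickening_of_dist_le x (x - δ • z) r _
        (by by_contra h; exact hvz (hv0 _ h)) ?_
      rw [dist_eq_norm, sub_sub_cancel, norm_smul, Real.norm_of_nonneg h1.le]
      nlinarith [hκ.norm_le z hz]
  · rw [sub_sub_cancel_left, abs_neg]
    exact (abs_truncate_le (hε0 k).le _).2
  · have h1 : Tendsto (fun k => max (-ε k) (min (ε k) (u x))) atTop (𝓝 0) :=
      squeeze_zero_norm (fun k => (abs_truncate_le (hε0 k).le _).1) hεt
    simpa using (tendsto_const_nhds (x := u x)).sub h1
  -- The cut-off gradients never see `{u = 0}`, but `G` vanishes almost everywhere on that set.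
  · filter_upwards [ae_restrict_of_ae hu.ae_grad_eq_zero] with x hx
    rcases (abs_nonneg (u x)).eq_or_lt with h0 | h0
    · have := hx (abs_eq_zero.1 h0.symm)
      exact Eventually.of_forall fun k => by rw [indicator_apply, this, ite_self]
    · filter_upwards [hεt.eventually (gt_mem_nhds h0)] with k hk
      exact indicator_of_mem (by exact not_le.2 hk) _

end

/-! ### Passage to the limit in the energy -/

section

variable {n : ℕ} {Ω : Set (RSpace n)} {M : RSpace n → RSpace n → ℝ}
  {u v : RSpace n → ℝ} {G H : RSpace n → RSpace n}

theorem isWeakGradient_weakGradient (h : ∃ G, IsWeakGradient Ω u G) :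
    IsWeakGradient Ω u (weakGradient Ω u) := by
  rw [weakGradient, dif_pos h]
  exact h.choose_spec

theorem IsWeakGradient.weakGradient_ae_eq (hΩ : IsOpen Ω) (h : IsWeakGradient Ω u G) :
    weakGradient Ω u =ᵐ[volume.restrict Ω] G :=
  (isWeakGradient_weakGradient ⟨G, h⟩).ae_eq hΩ h EventuallyEq.rfl

theorem IsWeakGradient.add (hu : IsWeakGradient Ω u G) (hv : IsWeakGradient Ω v H)
    (hui : IntegrableOn u Ω) (hGi : IntegrableOn G Ω) (hvi : IntegrableOn v Ω)
    (hHi : IntegrableOn H Ω) : IsWeakGradient Ω (u + v) (G + H) := by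
  refine ⟨hu.1.add hv.1, hu.2.1.add hv.2.1, fun φ hφ => ?_⟩
  simp only [Pi.add_apply, add_smul, smul_add]
  rw [integral_add (integrable_smul_gradient hui hφ.1 hφ.2.1)
    (integrable_smul_gradient hvi hφ.1 hφ.2.1),
    integral_add (integrable_test_smul hGi hφ.1 hφ.2.1)
    (integrable_test_smul hHi hφ.1 hφ.2.1), hu.2.2 φ hφ, hv.2.2 φ hφ, neg_add]

theorem hasWeakGrad_of_mem_testFunctions (hu : u ∈ TestFunctions Ω) :
    HasWeakGrad u (gradient u) :=
  HasWeakGrad.of_contDiff (hu.1.of_le (by simp)) hu.2.1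

theorem mem_V10LM_of_mem_testFunctions (hΩ : IsOpen Ω) (hΩfin : volume Ω ≠ ⊤)
    (hM : IsWeakNFunction Ω M) (hu : u ∈ TestFunctions Ω) : u ∈ V10LM Ω M := by
  have hw := hasWeakGrad_of_mem_testFunctions hu
  have hae := (hw.isWeakGradient (Ω := Ω)).weakGradient_ae_eq hΩ
  refine ⟨⟨⟨hw.integrable.integrableOn, ⟨_, hw.isWeakGradient⟩,
    hw.integrable_grad.integrableOn.congr hae.symm⟩, fun _ => u, fun _ => hu, by simp, ?_⟩, ?_⟩
  · refine tendsto_const_nhds.congr fun _ => ?_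
    rw [eLpNorm_congr_ae (g := 0), eLpNorm_zero]
    filter_upwards [hae] with x hx
    rw [hx, sub_self, Pi.zero_apply]
  · refine ⟨(hw.integrable_grad.integrableOn.congr hae.symm).aestronglyMeasurable, 1, one_pos, ?_⟩
    obtain ⟨C, -, hC⟩ := exists_norm_le_of_test hu.1 hu.2.1
    obtain ⟨b, -, hb⟩ := hM.exists_bound C
    refine lt_of_le_of_lt (b := ∫⁻ _ in Ω, ENNReal.ofReal b) (lintegral_mono_ae ?_) ?_
    · filter_upwards [hae, hb] with x h1 h2
      rw [h1, inv_one, one_smul]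
      exact ENNReal.ofReal_le_ofReal (h2 _ (hC x).2)
    · rw [lintegral_const, Measure.restrict_apply_univ]
      exact (ENNReal.mul_ne_top ENNReal.ofReal_ne_top hΩfin).lt_top

theorem mem_holderClass_of_mem_testFunctions (hΩ : Bornology.IsBounded Ω) {γ : ℝ} (hγ : γ ≤ 1)
    (hu : u ∈ TestFunctions Ω) : u ∈ HolderClass Ω γ := by
  obtain ⟨C, hC⟩ := hu.1.lipschitzWith_of_hasCompactSupport hu.2.1 (by simp)
  obtain ⟨D, hD⟩ := Metric.isBounded_iff.1 hΩ
  refine ⟨_, (holderOnWith_one.2 (hC.lipschitzOnWith (s := Ω))).of_le (D := D.toNNReal)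
    (fun x hx y hy => ?_) (Real.toNNReal_le_one.2 hγ)⟩
  rw [edist_dist]
  exact ENNReal.ofReal_le_ofReal (hD hx hy)

/-- Turns modular convergence into convergence of gradients: by convexity and `m₁ 0 = 0`, `m₁` stays
above `m₁ ε > 0` beyond `ε`. -/
theorem IsWeakNFunction.ae_tendsto_zero (hM : IsWeakNFunction Ω M) :
    ∀ᵐ x ∂volume.restrict Ω, ∀ ξ : ℕ → RSpace n, Tendsto (fun k => M x (ξ k)) atTop (𝓝 0) →
      Tendsto ξ atTop (𝓝 0) := by
  obtain ⟨m₁, m₂, hconv, -, -, -, h0, hpos, hm⟩ := hM.bounds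
  filter_upwards [hm] with x hx ξ hξ
  rw [Metric.tendsto_nhds]
  intro ε hε
  filter_upwards [hξ.eventually (gt_mem_nhds (hpos ε hε))] with k hk
  rw [dist_zero_right]
  by_contra! hle
  have hn : 0 < ‖ξ k‖ := hε.trans_le hle
  have h1 := hconv.2 (mem_Ici.2 hn.le) (mem_Ici.2 (le_refl (0 : ℝ)))
    (by positivity : 0 ≤ ε / ‖ξ k‖) (sub_nonneg.2 ((div_le_one hn).2 hle)) (by ring)
  simp only [smul_eq_mul, mul_zero, add_zero, h0, div_mul_cancel₀ _ hn.ne'] at h1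
  have h2 : ε / ‖ξ k‖ * m₁ ‖ξ k‖ ≤ m₁ ‖ξ k‖ := by
    refine mul_le_of_le_one_left ?_ ((div_le_one hn).2 hle)
    have h3 : 0 < ε / ‖ξ k‖ * m₁ ‖ξ k‖ := (hpos ε hε).trans_le h1
    exact (pos_of_mul_pos_right h3 (by positivity)).le
  linarith [(hx (ξ k)).1]

/-- Continuity of the energy along approximation by test functions. -/
theorem IsApprox.iInf_energy_le (hΩ : IsOpen Ω) (hΩfin : volume Ω ≠ ⊤)
    (hM : IsWeakNFunction Ω M) (hΔ : DeltaTwo Ω M) {F : RSpace n → ℝ → RSpace n → ℝ}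
    (hFmeas : ∀ z ξ, AEMeasurable (fun x => F x z ξ) (volume.restrict Ω))
    (hFcont : ∀ x ∈ Ω, Continuous (fun p : ℝ × RSpace n => F x p.1 p.2)) {L : ℝ} (hL : 0 ≤ L)
    (hF0 : ∀ x ∈ Ω, ∀ z ξ, 0 ≤ F x z ξ) (hF : ∀ x ∈ Ω, ∀ z ξ, F x z ξ ≤ L * (M x ξ + 1))
    (hu : u ∈ V1LM Ω M) (hv : v ∈ V10LM Ω M) (happ : IsApprox Ω M v (weakGradient Ω v)) :
    (⨅ φ ∈ TestFunctions Ω, energy Ω F (u + φ)) ≤ energy Ω F (u + v) := by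
  rcases eq_or_ne (energy Ω F (u + v)) ⊤ with htop | htop
  · rw [htop]; exact le_top
  set G := weakGradient Ω u with hG
  set H := weakGradient Ω v with hH
  have hum : AEStronglyMeasurable u (volume.restrict Ω) := hu.1.1.aestronglyMeasurable
  have hvm : AEStronglyMeasurable v (volume.restrict Ω) := hv.1.1.1.aestronglyMeasurable
  have hGm : AEStronglyMeasurable G (volume.restrict Ω) := hu.1.2.2.aestronglyMeasurable
  have hHm : AEStronglyMeasurable H (volume.restrict Ω) := hv.1.1.2.2.aestronglyMeasurable
  have hGw : IsWeakGradient Ω u G := isWeakGradient_weakGradient hu.1.2.1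
  have hHw : IsWeakGradient Ω v H := isWeakGradient_weakGradient hv.1.1.2.1
  have huv : weakGradient Ω (u + v) =ᵐ[volume.restrict Ω] G + H :=
    (hGw.add hHw hu.1.1 hu.1.2.2 hv.1.1.1 hv.1.1.2.2).weakGradient_ae_eq hΩ
  have hεpos : ∀ k : ℕ, (0 : ℝ≥0∞) < ((k : ℝ≥0∞) + 1)⁻¹ := fun k =>
    ENNReal.inv_pos.2 (by simp)
  have hεt : Tendsto (fun k : ℕ => ((k : ℝ≥0∞) + 1)⁻¹) atTop (𝓝 0) := by
    have := (tendsto_add_atTop_iff_nat 1).2 ENNReal.tendsto_inv_nat_nhds_zero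
    simpa using this
  -- The scale `2` is what `M (G + ∇ψ) ≤ M (2(G + H)) + M (2(∇ψ - H))` requires: the first term is
  -- integrable, the second tends to `0` in `L¹`.
  choose ψ hψ h1 h2 using fun k : ℕ => happ 2 two_pos _ (hεpos k)
  have hψm : ∀ k, AEStronglyMeasurable (ψ k) (volume.restrict Ω) := fun k =>
    (hψ k).1.continuous.aestronglyMeasurable
  have hgm : ∀ k, AEStronglyMeasurable (gradient (ψ k)) (volume.restrict Ω) := fun k =>
    (continuous_gradient (hψ k).1).aestronglyMeasurable
  have t1 := tendsto_of_tendsto_of_tendsto_of_le_of_le tendsto_const_nhds hεt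
    (fun _ => zero_le) h1
  have t2 := tendsto_of_tendsto_of_tendsto_of_le_of_le tendsto_const_nhds hεt
    (fun _ => zero_le) h2
  obtain ⟨ns, hns, hae1⟩ := exists_seq_tendsto_ae_of_tendsto_lintegral hψm hvm t1
  obtain ⟨ms, hms, hae2⟩ := exists_seq_tendsto_ae_of_tendsto_lintegral (μ := volume.restrict Ω)
    (f := fun k x => M x ((2 : ℝ) • (gradient (ψ (ns k)) x - H x))) (g := fun _ => 0)
    (fun k => (hM.aemeasurable_comp
      (((hgm (ns k)).sub hHm).const_smul (2 : ℝ))).aestronglyMeasurable)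
    aestronglyMeasurable_const (by
      refine (t2.comp hns.tendsto_atTop).congr fun k => lintegral_congr_ae ?_
      filter_upwards [hM.ae_nonneg] with x hx
      rw [sub_zero, Real.enorm_of_nonneg (hx _)])
  set χ : ℕ → RSpace n → ℝ := fun k => ψ (ns (ms k)) with hχ
  have hχgrad : ∀ k, weakGradient Ω (u + χ k) =ᵐ[volume.restrict Ω] G + gradient (χ k) := fun k =>
    (hGw.add (hasWeakGrad_of_mem_testFunctions (hψ _)).isWeakGradient hu.1.1 hu.1.2.2
      (hasWeakGrad_of_mem_testFunctions (hψ _)).integrable.integrableOn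
      (hasWeakGrad_of_mem_testFunctions (hψ _)).integrable_grad.integrableOn).weakGradient_ae_eq hΩ
  have hFc : ∀ᵐ x ∂volume.restrict Ω, Continuous (fun p : ℝ × RSpace n => F x p.1 p.2) := by
    filter_upwards [ae_restrict_mem hΩ.measurableSet] with x hx
    exact hFcont x hx
  have hFm : ∀ {w : RSpace n → ℝ} {W : RSpace n → RSpace n},
      AEStronglyMeasurable w (volume.restrict Ω) → AEStronglyMeasurable W (volume.restrict Ω) →
      AEMeasurable (fun x => F x (w x) (W x)) (volume.restrict Ω) := fun hw hW =>
    aemeasurable_caratheodory (f := fun x (p : ℝ × RSpace n) => F x p.1 p.2)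
      (fun p => hFmeas p.1 p.2) hFc (hw.prodMk hW)
  have heuv : energy Ω F (u + v) = ∫⁻ x in Ω, ENNReal.ofReal (F x (u x + v x) (G x + H x)) :=
    lintegral_congr_ae (by filter_upwards [huv] with x hx; rw [hx]; rfl)
  have heuχ : ∀ k, energy Ω F (u + χ k) =
      ∫⁻ x in Ω, ENNReal.ofReal (F x (u x + χ k x) (G x + gradient (χ k) x)) := fun k =>
    lintegral_congr_ae (by filter_upwards [hχgrad k] with x hx; rw [hx]; rfl)
  have hFuv : AEMeasurable (fun x => F x (u x + v x) (G x + H x)) (volume.restrict Ω) :=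
    hFm (hum.add hvm) (hGm.add hHm)
  have hFuχ : ∀ k, AEMeasurable (fun x => F x (u x + χ k x) (G x + gradient (χ k) x))
      (volume.restrict Ω) := fun k => hFm (hum.add (hψm _)) (hGm.add (hgm _))
  have hMGH : AEMeasurable (fun x => ENNReal.ofReal (M x ((2 : ℝ) • (G x + H x))))
      (volume.restrict Ω) :=
    (hM.aemeasurable_comp ((hGm.add hHm).const_smul (2 : ℝ))).ennreal_ofReal
  have hMGHfin : ∫⁻ x in Ω, ENNReal.ofReal (M x ((2 : ℝ) • (G x + H x))) ≠ ⊤ := by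
    have hle := hM.lintegral_add_le (a := fun x => (2 : ℝ) • G x) (b := fun x => (2 : ℝ) • H x)
      (hGm.const_smul (2 : ℝ))
    simp only [smul_smul, ← smul_add] at hle
    exact ne_top_of_le_ne_top (ENNReal.add_ne_top.2
      ⟨LM.lintegral_ne_top hu.2 hΔ hM hΩfin (by norm_num),
        LM.lintegral_ne_top hv.2 hΔ hM hΩfin (by norm_num)⟩) hle
  have hLtop : ENNReal.ofReal L ≠ ⊤ := ENNReal.ofReal_ne_top
  have hlim : Tendsto (fun k => ∫⁻ x in Ω, ‖F x (u x + χ k x) (G x + gradient (χ k) x) -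
      F x (u x + v x) (G x + H x)‖ₑ) atTop (𝓝 0) := by
    refine tendsto_lintegral_zero_of_le_add
      (H := fun x => ENNReal.ofReal L * (ENNReal.ofReal (M x ((2 : ℝ) • (G x + H x))) + 1) +
        ENNReal.ofReal (F x (u x + v x) (G x + H x)))
      (e := fun k x => ENNReal.ofReal L *
        ENNReal.ofReal (M x ((2 : ℝ) • (gradient (χ k) x - H x))))
      (fun k => ((hFuχ k).sub hFuv).enorm)
      (((hMGH.add_const 1).const_mul _).add hFuv.ennreal_ofReal) ?_ ?_ (fun k => ?_) ?_
    · rw [lintegral_add_right' _ hFuv.ennreal_ofReal, lintegral_const_mul' _ _ hLtop,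
        lintegral_add_right' _ aemeasurable_const, lintegral_const, Measure.restrict_apply_univ,
        one_mul, ← heuv]
      exact ENNReal.add_ne_top.2
        ⟨ENNReal.mul_ne_top hLtop (ENNReal.add_ne_top.2 ⟨hMGHfin, hΩfin⟩), htop⟩
    · simp only [lintegral_const_mul' _ _ hLtop]
      simpa using ENNReal.Tendsto.const_mul (t2.comp (hns.comp hms).tendsto_atTop) (Or.inr hLtop)
    · filter_upwards [ae_restrict_mem hΩ.measurableSet, hM.ae_add_le, hM.ae_nonneg]
        with x hx hadd hnn
      refine enorm_sub_le.trans ?_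
      rw [Real.enorm_of_nonneg (hF0 x hx _ _), Real.enorm_of_nonneg (hF0 x hx _ _),
        add_right_comm, ← mul_add]
      refine add_le_add ?_ le_rfl
      refine (ENNReal.ofReal_le_ofReal (hF x hx _ _)).trans ?_
      rw [ENNReal.ofReal_mul hL, ENNReal.ofReal_add (hnn _) zero_le_one, ENNReal.ofReal_one,
        add_right_comm]
      refine mul_le_mul_right (add_le_add ?_ le_rfl) _
      have := hadd (G x + H x) (gradient (χ k) x - H x)
      rwa [add_add_sub_cancel] at this
    · filter_upwards [hae1, hae2, hFc, hM.ae_tendsto_zero] with x hx1 hx2 hx3 hx4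
      have s1 : Tendsto (fun k => χ k x) atTop (𝓝 (v x)) := hx1.comp hms.tendsto_atTop
      have s2 := (hx4 _ hx2).const_smul (2⁻¹ : ℝ)
      simp only [smul_smul, inv_mul_cancel₀ (two_ne_zero (α := ℝ)), one_smul, smul_zero] at s2
      have s3 : Tendsto (fun k => gradient (χ k) x) atTop (𝓝 (H x)) := by
        have := s2.add_const (H x)
        simpa using! this
      have s4 := (hx3.tendsto (u x + v x, G x + H x)).comp
        ((s1.const_add (u x)).prodMk_nhds (s3.const_add (G x)))
      have s5 := (s4.sub (tendsto_const_nhds (x := F x (u x + v x) (G x + H x)))).enorm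
      rwa [sub_self, enorm_zero] at s5
  have hle : ∀ k, (⨅ φ ∈ TestFunctions Ω, energy Ω F (u + φ)) ≤ energy Ω F (u + v) +
      ∫⁻ x in Ω, ‖F x (u x + χ k x) (G x + gradient (χ k) x) -
        F x (u x + v x) (G x + H x)‖ₑ := by
    intro k
    refine (iInf₂_le (χ k) (hψ _)).trans ?_
    rw [heuχ, heuv, ← lintegral_add_left' hFuv.ennreal_ofReal]
    refine lintegral_mono fun x => ?_
    set a := F x (u x + χ k x) (G x + gradient (χ k) x)
    set b := F x (u x + v x) (G x + H x)
    have h3 : ENNReal.ofReal (b + (a - b)) ≤ ENNReal.ofReal b + ENNReal.ofReal (a - b) :=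
      ENNReal.ofReal_add_le
    rw [add_sub_cancel] at h3
    exact h3.trans (add_le_add le_rfl (Real.ofReal_le_enorm _))
  have hfin := (tendsto_const_nhds (x := energy Ω F (u + v))).add hlim
  rw [add_zero] at hfin
  exact ge_of_tendsto' hfin hle

end

theorem mainTheorem4 {n : ℕ} (hn : 1 ≤ n) (Ω : Set (RSpace n))
    (hΩ : IsBoundedLipschitzDomain Ω)
    (M : RSpace n → RSpace n → ℝ) (hM : IsWeakNFunction Ω M)
    (hMcont : ContinuousOn (fun p : RSpace n × RSpace n => M p.1 p.2) (Ω ×ˢ Set.univ))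
    (hMΔ : DeltaTwo Ω M)
    (F : RSpace n → ℝ → RSpace n → ℝ)
    (hFmeas : ∀ z ξ, AEMeasurable (fun x => F x z ξ) (volume.restrict Ω))
    (hFcont : ∀ x ∈ Ω, Continuous (fun p : ℝ × RSpace n => F x p.1 p.2))
    (ν β L : ℝ) (hν : 0 < ν) (hν' : ν < 1) (hβ : 0 < β) (hβ' : β < 1) (hL : 1 < L)
    (hF : ∀ x ∈ Ω, ∀ z ξ, ν * M x (β • ξ) ≤ F x z ξ ∧ F x z ξ ≤ L * (M x ξ + 1)) :
    (BalanceGen Ω 0 M → ∀ u₀ ∈ V1LM Ω M,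
      (⨅ φ ∈ V10LM Ω M, energy Ω F (u₀ + φ)) =
        (⨅ φ ∈ TestFunctions Ω, energy Ω F (u₀ + φ))) ∧
    (∀ γ : ℝ, 0 < γ → γ ≤ 1 → BalanceGen Ω γ M → ∀ u₀ ∈ V1LM Ω M ∩ HolderClass Ω γ,
      (⨅ φ ∈ V10LM Ω M ∩ HolderClass Ω γ, energy Ω F (u₀ + φ)) =
        (⨅ φ ∈ TestFunctions Ω, energy Ω F (u₀ + φ))) := by
  have hΩfin : volume Ω ≠ ⊤ := hΩ.isBounded.measure_lt_top.ne
  have hF0 : ∀ x ∈ Ω, ∀ z ξ, 0 ≤ F x z ξ := fun x hx z ξ =>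
    (mul_nonneg hν.le (hM.nonneg x hx _)).trans (hF x hx z ξ).1
  have hle : ∀ u₀ ∈ V1LM Ω M, ∀ φ ∈ V10LM Ω M, IsApprox Ω M φ (weakGradient Ω φ) →
      (⨅ φ ∈ TestFunctions Ω, energy Ω F (u₀ + φ)) ≤ energy Ω F (u₀ + φ) :=
    fun u₀ hu₀ φ hφ happ => happ.iInf_energy_le hΩ.isOpen hΩfin hM hMΔ hFmeas hFcont
      (by linarith) hF0 (fun x hx z ξ => (hF x hx z ξ).2) hu₀ hφ
  have heq : ∀ {α : Type} [Zero α] (f : RSpace n → α),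
      Ω.indicator f =ᵐ[volume.restrict Ω] f := fun f => by
    filter_upwards [ae_restrict_mem hΩ.isOpen.measurableSet] with x hx
    exact indicator_of_mem hx f
  have hmod : ∀ φ ∈ V10LM Ω M, ∀ l : ℝ, 0 ≤ l →
      ∫⁻ x in Ω, ENNReal.ofReal (M x (l • Ω.indicator (weakGradient Ω φ) x)) ≠ ⊤ := by
    intro φ hφ l hl
    rw [lintegral_congr_ae (g := fun x => ENNReal.ofReal (M x (l • weakGradient Ω φ x)))]
    · exact LM.lintegral_ne_top hφ.2 hMΔ hM hΩfin hl
    · filter_upwards [heq (weakGradient Ω φ)] with x hx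
      rw [hx]
  have hoff : ∀ {α : Type} [Zero α] (f : RSpace n → α), ∀ x ∉ Ω, Ω.indicator f x = 0 :=
    fun f x hx => indicator_of_notMem hx f
  constructor
  · intro hB u₀ hu₀
    refine le_antisymm (le_iInf₂ fun φ hφ =>
      iInf₂_le φ (mem_V10LM_of_mem_testFunctions hΩ.isOpen hΩfin hM hφ)) (le_iInf₂ fun φ hφ => ?_)
    have := (isTestLimit_of_mem_W110 hΩ.isOpen hφ.1).isApprox_of_balance_zero hB hΩ hMΔ hM
      (hoff _) (hoff _) (hmod φ hφ)
    exact hle u₀ hu₀ φ hφ (this.congr (heq _) (heq _))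
  · rintro γ hγ hγ1 hB u₀ ⟨hu₀, -⟩
    refine le_antisymm (le_iInf₂ fun φ hφ =>
      iInf₂_le φ ⟨mem_V10LM_of_mem_testFunctions hΩ.isOpen hΩfin hM hφ,
        mem_holderClass_of_mem_testFunctions hΩ.isBounded hγ1 hφ⟩)
      (le_iInf₂ fun φ hφ => ?_)
    obtain ⟨hφ, C, hC⟩ := hφ
    have hCΩ : HolderOnWith C γ.toNNReal (Ω.indicator φ) Ω := fun x hx y hy => by
      rw [indicator_of_mem hx, indicator_of_mem hy]
      exact hC x hx y hy
    have := (isTestLimit_of_mem_W110 hΩ.isOpen hφ.1).isApprox_of_holder hγ hB hΩ hMΔ hM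
      (hoff _) (hoff _) (hmod φ hφ) hCΩ
    exact hle u₀ hu₀ φ hφ (this.congr (heq _) (heq _))
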